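/- **Setting.** Let $\mathbb S=\mathbb R/\mathbb Z$; functions on $\mathbb S$ are identified with 1-periodic functions on $\mathbb R$, and symbols on $T^*\mathbb S$ with symbols on $\mathbb R^2$ that are 1-periodic in $x$. Let $P=P(x,\xi;h)$, $0<h<1$, be a Hermitian $2\times2$ matrix symbol on $T^*\mathbb S$ and let $P_k$ $(k\ge 0)$ be $2\times 2$ matrix symbols on $T^*\mathbb S$ such that either $P_k\in S(1)$ for all $k$ (all derivatives bounded), or $P_k\in S^{2-k}$ for all $k$ (that is, $|\partial_\xi^j\partial_x^lP_k|\le C_{jl}(1+|\xi|)^{2-k-j}$ for all $j,l$), and such that $P-\sum_{k=0}^Nh^kP_k=\mathcal O_{S(1)}(h^{N+1})$ uniformly in $0<h<1$, for every $N\ge1$. Let $\xi_0\in\mathbb R$, $\omega>0$. Assume that $P_0(x,\xi)$ is positive semi-definite for all $(x,\xi)$, that $$P_0(x,\xi)=\big((\xi-\xi_0)^2+\omega^2x^2\big)\operatorname{id}_2+\mathcal O\big(|(x,\xi-\xi_0)|^3\big)\quad\text{near }(0,\xi_0),$$ and that $P_1(0,\xi_0)=\operatorname{diag}(\mu_1,\mu_2)$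 with $\mu_1,\mu_2\in\mathbb R$. Denote by $a^w(x,hD)$ the semiclassical Weyl quantization $a^w(x,hD)u(x)=\frac1{2\pi h}\iint e^{i(x-y)\xi/h}a(\tfrac{x+y}2,\xi)u(y)\,dy\,d\xi$ (interpreted weakly on periodic functions), by $T^w(y,D)$ the Weyl quantization with $h=1$ of $T(y,\eta)=P(h^{1/2}y,h^{1/2}\eta+\xi_0;h)$, and by $\phi_{n,\omega}(y)=(2^nn!)^{-1/2}(\omega/\pi)^{1/4}H_n(\sqrt\omega\, y)$ the polynomial factor of the $n$-th normalized Hermite function, with $H_n$ the $n$-th (physicists') Hermite polynomial. Put $e_{j,n}=(2n+1)\omega+\mu_j$ and $$\Phi_{1,n}=(\phi_{n,\omega},0),\qquad \Phi_{2,n}=(0,\phi_{n,\omega}),\qquad j=1,2,\ n\in\mathbb N_0 .$$ **Quasimodes on the line.** Fix $\ell\in\mathbb N_0$. By a *line quasimode of order $\ell$ at level $(j,n)$* we mean a pair $$v(y)=\sum_{i=0}^{2\ell}h^{i/2}v_i(y)e^{-\omega y^2/2},\qquad \lambda=h\sum_{i=0}^{2\ell}h^{i/2}\lambda_i,$$ with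 $\mathbb C^2$-valued polynomials $v_i$ and real numbers $\lambda_i$ that do not depend on $h$, such that $\lambda_0=e_{j,n}$, the polynomial $v_0$ is a linear combination of the $\Phi_{k,m}$ with $e_{k,m}=e_{j,n}$, $\|v_0e^{-\omega y^2/2}\|_{L^2(\mathbb R)}=1$, and $$(T^w(y,D)-\lambda)v=\mathcal O_{\mathscr S}(h^{\ell+3/2})\quad\text{uniformly in }0<h<1 .$$ **Theorem.** (1) For every line quasimode $(v,\lambda)$ of order $\ell$ at any level $(j,n)$, the series $$u(x)=h^{-1/4}\sum_{k\in\mathbb Z}e^{i\xi_0(x-k)/h}\,v\big((x-k)h^{-1/2}\big)$$ converges and defines, for each $0<h<1$, a function $u\in C^\infty(\mathbb S)$. The semiclassical wavefront set is $\mathrm{WF}_h(u)=\{(0,\xi_0)\}\subset T^*\mathbb S$; moreover, uniformly in $0<h<1$, $$\|u\|_{L^2(\mathbb S)}=1+\mathcal O(h^{1/2}),\qquad (P^w(x,hD)-\lambda)u=\mathcal O_{L^2(\mathbb S)}(h^{\ell+3/2}).$$ (2) Such quasimodes exist at all levels: there are line quasimodes $(v^{(j)}(n),\lambda^{(j)}(n))$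 of order $\ell$ at level $(j,n)$, for all $j=1,2$ and $n\in\mathbb N_0$, whose leading terms $v^{(j)}_0(n)e^{-\omega y^2/2}$ form an orthonormal system in $L^2(\mathbb R;\mathbb C^2)$, and with $v_0^{(j)}(n)=\Phi_{j,n}$ whenever $\ell=0$ or $e_{j,n}\neq e_{k,m}$ for $k\ne j$ and all $m\in\mathbb N_0$. Hence their periodizations $u^{(j)}(n)$ have all the properties in (1). -/

import Mathlib

open scoped ComplexOrder Polynomial Topology
open Filter Asymptotics

noncomputable section

/-- The fibre `ℂ²` with its Hermitian norm. -/
abbrev C2 : Type := EuclideanSpace ℂ (Fin 2)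

/-- Complex `2 × 2` matrices. -/
abbrev Mat2 : Type := Matrix (Fin 2) (Fin 2) ℂ

/-- The action of a matrix on a vector of `ℂ²`. -/
def matAct (A : Mat2) (w : C2) : C2 := WithLp.toLp 2 (A.mulVec w.ofLp)

/-! ### Symbol classes -/

/-- `∂_ξ^j ∂_x^k a (x, ξ)`. -/
def mixedDeriv (j k : ℕ) (a : ℝ → ℝ → ℂ) (x ξ : ℝ) : ℂ :=
  iteratedDeriv j (fun ζ => iteratedDeriv k (fun z => a z ζ) x) ξ

/-- Joint smoothness in `(x, ξ)`. -/
def IsSmoothSymbol (a : ℝ → ℝ → ℂ) : Prop :=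
  ContDiff ℝ ((⊤ : ℕ∞) : WithTop ℕ∞) (fun p : ℝ × ℝ => a p.1 p.2)

/-- The class `S(1)` of matrix symbols (entrywise). -/
def IsS1 (A : ℝ → ℝ → Mat2) : Prop :=
  ∀ r s : Fin 2, IsSmoothSymbol (fun x ξ => A x ξ r s) ∧
    ∀ j k : ℕ, ∃ C : ℝ, ∀ x ξ : ℝ, ‖mixedDeriv j k (fun x ξ => A x ξ r s) x ξ‖ ≤ C

/-- The Kohn-Nirenberg class `S^m` of matrix symbols (entrywise). -/
def IsKN (m : ℤ) (A : ℝ → ℝ → Mat2) : Prop :=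
  ∀ r s : Fin 2, IsSmoothSymbol (fun x ξ => A x ξ r s) ∧
    ∀ j k : ℕ, ∃ C : ℝ, ∀ x ξ : ℝ,
      ‖mixedDeriv j k (fun x ξ => A x ξ r s) x ξ‖ ≤ C * (1 + |ξ|) ^ (m - (j : ℤ))

/-- `A(h) = O_{S(1)}(h^N)` for a family of matrix symbols, uniformly in `0 < h < 1`. -/
def IsBigOS1 (N : ℕ) (A : ℝ → ℝ → ℝ → Mat2) : Prop :=
  ∀ r s : Fin 2,
    (∀ h ∈ Set.Ioo (0 : ℝ) 1, IsSmoothSymbol (fun x ξ => A h x ξ r s)) ∧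
    ∀ j k : ℕ, ∃ C : ℝ, ∀ h ∈ Set.Ioo (0 : ℝ) 1, ∀ x ξ : ℝ,
      ‖mixedDeriv j k (fun x ξ => A h x ξ r s) x ξ‖ ≤ C * h ^ N

/-- `P = P(x, ξ; h)`, `0 < h < 1`, is a Hermitian matrix symbol on `T*(ℝ/ℤ)` (1-periodic in `x`)
with an expansion `P ∼ ∑ h^k P_k`, where either all `P_k ∈ S(1)` or all `P_k ∈ S^{2-k}`. -/
structure HasSymbolExpansion (P : ℝ → ℝ → ℝ → Mat2) (Pk : ℕ → ℝ → ℝ → Mat2) : Prop where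
  hermitian : ∀ h ∈ Set.Ioo (0 : ℝ) 1, ∀ x ξ : ℝ, (P h x ξ).IsHermitian
  periodic : ∀ h ∈ Set.Ioo (0 : ℝ) 1, ∀ x ξ : ℝ, P h (x + 1) ξ = P h x ξ
  periodic_coeff : ∀ (k : ℕ) (x ξ : ℝ), Pk k (x + 1) ξ = Pk k x ξ
  classes : (∀ k : ℕ, IsS1 (Pk k)) ∨ (∀ k : ℕ, IsKN (2 - (k : ℤ)) (Pk k))
  remainder : ∀ N : ℕ, 1 ≤ N → IsBigOS1 (N + 1)
    (fun h x ξ => P h x ξ - ∑ k ∈ Finset.range (N + 1), ((h : ℂ) ^ k) • Pk k x ξ)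

/-- `P₀` is positive semi-definite everywhere and
`P₀(x, ξ) = (a (ξ - ξ₀)² + b (x - x₀)²) id + O(|(x, ξ) - (x₀, ξ₀)|³)` near `(x₀, ξ₀)`, `a, b > 0`. -/
def HasPotentialWell (P₀ : ℝ → ℝ → Mat2) (a b x₀ ξ₀ : ℝ) : Prop :=
  0 < a ∧ 0 < b ∧ (∀ x ξ : ℝ, (P₀ x ξ).PosSemidef) ∧
    ∀ r s : Fin 2,
      (fun p : ℝ × ℝ => (P₀ p.1 p.2 -
        ((a * (p.2 - ξ₀) ^ 2 + b * (p.1 - x₀) ^ 2 : ℝ) : ℂ) • (1 : Mat2)) r s)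
      =O[𝓝 (x₀, ξ₀)] (fun p : ℝ × ℝ => ‖p - (x₀, ξ₀)‖ ^ 3)

/-! ### Weyl quantization -/

/-- Weyl quantization of `A` on the line, applied to a Schwartz function `φ`:
`(2πh)⁻¹ ∫ (∫ e^{i(x-y)ξ/h} A((x+y)/2, ξ) φ(y) dy) dξ`. For the symbols considered here the inner
integral is rapidly decreasing in `ξ`, so that both integrals converge absolutely. -/
def weyl (h : ℝ) (A : ℝ → ℝ → Mat2) (φ : ℝ → C2) (x : ℝ) : C2 :=
  (((2 * Real.pi * h)⁻¹ : ℝ) : ℂ) • ∫ ξ : ℝ, ∫ y : ℝ,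
    Complex.exp (Complex.I * (((x - y) * ξ / h : ℝ) : ℂ)) • matAct (A ((x + y) / 2) ξ) (φ y)

/-- `f = A^w(x, hD) u` for a 1-periodic function `u`, in the weak sense: `f` is the (unique) smooth
1-periodic function with `(φ, f) = ((A*)^w(x, hD) φ, u)` for every Schwartz function `φ`. -/
def IsWeylOnCircle (h : ℝ) (A : ℝ → ℝ → Mat2) (u f : ℝ → C2) : Prop :=
  ContDiff ℝ ((⊤ : ℕ∞) : WithTop ℕ∞) f ∧ Function.Periodic f 1 ∧
    ∀ φ : SchwartzMap ℝ C2,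
      ∫ x : ℝ, inner ℂ (φ x) (f x) =
        ∫ x : ℝ, inner ℂ (weyl h (fun z ζ => (A z ζ).conjTranspose) φ x) (u x)

/-- The norm of `L²(ℝ/ℤ; ℂ²)` for a (continuous) 1-periodic function. -/
def circleNorm (f : ℝ → C2) : ℝ := Real.sqrt (∫ x in (0 : ℝ)..1, ‖f x‖ ^ 2)

/-- Scalar symbols in `C_c^∞(T*(ℝ/ℤ))`. -/
def IsCircleTestSymbol (a : ℝ → ℝ → ℂ) : Prop :=
  IsSmoothSymbol a ∧ (∀ x ξ : ℝ, a (x + 1) ξ = a x ξ) ∧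
    ∃ R : ℝ, ∀ x ξ : ℝ, R < |ξ| → a x ξ = 0

/-- `a^w(x, hD) u(h) = O(h^∞)` in `L²(ℝ/ℤ)` as `h → 0⁺`. -/
def IsMicrolocallyNegligible (a : ℝ → ℝ → ℂ) (u : ℝ → ℝ → C2) : Prop :=
  ∃ f : ℝ → ℝ → C2,
    (∀ h ∈ Set.Ioo (0 : ℝ) 1, IsWeylOnCircle h (fun x ξ => a x ξ • (1 : Mat2)) (u h) (f h)) ∧
    ∀ N : ℕ, (fun h => circleNorm (f h)) =O[𝓝[>] (0 : ℝ)] (fun h => h ^ N)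

/-- The semiclassical wavefront set in `T*(ℝ/ℤ)` of a family of functions on the circle: a point is
outside of it iff some `a ∈ C_c^∞(T*(ℝ/ℤ))` with `a ≠ 0` there satisfies
`a^w(x, hD) u(h) = O(h^∞)` in `L²(ℝ/ℤ)`. -/
def circleWF (u : ℝ → ℝ → C2) : Set (UnitAddCircle × ℝ) :=
  {p | ¬ ∃ (a : ℝ → ℝ → ℂ) (x : ℝ), IsCircleTestSymbol a ∧ (x : UnitAddCircle) = p.1 ∧
    a x p.2 ≠ 0 ∧ IsMicrolocallyNegligible a u}

/-! ### Quasimodes on the line -/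

/-- `r(h) = O(h^s)` in the Schwartz space, uniformly in `0 < h < 1`. -/
def IsBigOSchwartz (s : ℝ) (r : ℝ → ℝ → C2) : Prop :=
  (∀ h ∈ Set.Ioo (0 : ℝ) 1, ContDiff ℝ ((⊤ : ℕ∞) : WithTop ℕ∞) (r h)) ∧
    ∀ p q : ℕ, ∃ C : ℝ, ∀ h ∈ Set.Ioo (0 : ℝ) 1, ∀ y : ℝ,
      |y| ^ p * ‖iteratedDeriv q (r h) y‖ ≤ C * h ^ s

/-- The physicists' Hermite polynomial `H_n`, in terms of the probabilists' one. -/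
def hermiteH (n : ℕ) (t : ℝ) : ℝ :=
  Real.sqrt 2 ^ n * Polynomial.aeval (Real.sqrt 2 * t) (Polynomial.hermite n)

/-- `φ_{n,ω}(y) = (2^n n!)^{-1/2} (ω/π)^{1/4} H_n(√ω y)`, the normalized Hermite function of the
oscillator `D² + ω² y²` without its factor `e^{-ω y²/2}`. -/
def hermiteAmp (ω : ℝ) (n : ℕ) (y : ℝ) : ℝ :=
  (Real.sqrt (2 ^ n * (n.factorial : ℝ)))⁻¹ * (ω / Real.pi) ^ ((1 : ℝ) / 4) *
    hermiteH n (Real.sqrt ω * y)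

/-- The amplitude `(φ_{n,ω}, 0)` for `j = 0` and `(0, φ_{n,ω})` for `j = 1`. -/
def oscAmp (ω : ℝ) (j : Fin 2) (n : ℕ) (y : ℝ) : C2 :=
  EuclideanSpace.single j ((hermiteAmp ω n y : ℝ) : ℂ)

/-- The eigenvalue `(2n+1) ω + μ_j` of the `j`-th oscillator. -/
def oscEnergy (ω : ℝ) (μ : Fin 2 → ℝ) (j : Fin 2) (n : ℕ) : ℝ := (2 * (n : ℝ) + 1) * ω + μ j

/-- A pair of polynomials as a `ℂ²`-valued function on the line. -/
def polyVec (q : Fin 2 → ℂ[X]) (y : ℝ) : C2 := WithLp.toLp 2 (fun k => (q k).eval (y : ℂ))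

/-- `v(y; h) = ∑_{i ≤ 2ℓ} h^{i/2} v_i(y) e^{-ω y²/2}`. -/
def lineMode (ω : ℝ) (ℓ : ℕ) (v : ℕ → Fin 2 → ℂ[X]) (h y : ℝ) : C2 :=
  ∑ i ∈ Finset.range (2 * ℓ + 1),
    ((h ^ ((i : ℝ) / 2) * Real.exp (-(ω * y ^ 2 / 2)) : ℝ) : ℂ) • polyVec (v i) y

/-- `λ(h) = h ∑_{i ≤ 2ℓ} h^{i/2} λ_i`. -/
def approxEigenvalue (ℓ : ℕ) (lam : ℕ → ℝ) (h : ℝ) : ℝ :=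
  h * ∑ i ∈ Finset.range (2 * ℓ + 1), h ^ ((i : ℝ) / 2) * lam i

/-- The rescaled symbol `T(y, η) = P(√h y, √h η + ξ₀; h)`. -/
def normalForm (P : ℝ → ℝ → ℝ → Mat2) (ξ₀ h : ℝ) (y η : ℝ) : Mat2 :=
  P h (Real.sqrt h * y) (Real.sqrt h * η + ξ₀)

/-- The `L²(ℝ; ℂ²)` inner product of `f e^{-ω y²/2}` and `g e^{-ω y²/2}`. -/
def gaussInner (ω : ℝ) (f g : ℝ → C2) : ℂ :=
  ∫ y : ℝ, ((Real.exp (-(ω * y ^ 2)) : ℝ) : ℂ) * inner ℂ (f y) (g y)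

/-- `v`, `lam` are the coefficients of a quasimode of order `ℓ` of `T^w(y, D)` at the level
`(2n+1) ω + μ_j`: the leading amplitude is normalized and is a combination of the oscillator
amplitudes of that level, and `(T^w(y, D) - λ) v = O_𝓢(h^{ℓ+3/2})`. -/
structure IsLineQuasimode (P : ℝ → ℝ → ℝ → Mat2) (ξ₀ ω : ℝ) (μ : Fin 2 → ℝ) (ℓ : ℕ)
    (j : Fin 2) (n : ℕ) (v : ℕ → Fin 2 → ℂ[X]) (lam : ℕ → ℝ) : Prop where
  energy : lam 0 = oscEnergy ω μ j n
  leading : polyVec (v 0) ∈ Submodule.span ℂ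
    {g : ℝ → C2 | ∃ (k : Fin 2) (m : ℕ), oscEnergy ω μ k m = oscEnergy ω μ j n ∧ g = oscAmp ω k m}
  normalized : gaussInner ω (polyVec (v 0)) (polyVec (v 0)) = 1
  equation : IsBigOSchwartz ((ℓ : ℝ) + 3 / 2) (fun h y =>
    weyl 1 (normalForm P ξ₀ h) (lineMode ω ℓ v h) y -
      ((approxEigenvalue ℓ lam h : ℝ) : ℂ) • lineMode ω ℓ v h y)

/-! ### Periodization -/

/-- The term `h^{-1/4} e^{iξ₀(x-k)/h} w((x-k) h^{-1/2}; h)`. -/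
def periodTerm (ξ₀ : ℝ) (w : ℝ → ℝ → C2) (h x : ℝ) (k : ℤ) : C2 :=
  (((h ^ (-(1 : ℝ) / 4) : ℝ) : ℂ) * Complex.exp (Complex.I * ((ξ₀ * (x - k) / h : ℝ) : ℂ))) •
    w h ((x - k) * h ^ (-(1 : ℝ) / 2))

/-- `u(x; h) = h^{-1/4} ∑_{k ∈ ℤ} e^{iξ₀(x-k)/h} w((x-k) h^{-1/2}; h)`. -/
def periodize (ξ₀ : ℝ) (w : ℝ → ℝ → C2) (h x : ℝ) : C2 := ∑' k : ℤ, periodTerm ξ₀ w h x k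

/-- The periodization `u` of `w` is a well-defined family in `C^∞(ℝ/ℤ)` with wavefront set
`{(0, ξ₀)}` and norm `1 + O(h^{1/2})`, and `(P^w(x, hD) - λ) u = O(h^{ℓ+3/2})` in `L²(ℝ/ℤ)`. -/
structure IsCircleQuasimode (P : ℝ → ℝ → ℝ → Mat2) (ξ₀ : ℝ) (ℓ : ℕ)
    (w : ℝ → ℝ → C2) (lam : ℝ → ℝ) : Prop where
  summable : ∀ h ∈ Set.Ioo (0 : ℝ) 1, ∀ x : ℝ, Summable (periodTerm ξ₀ w h x)
  smooth : ∀ h ∈ Set.Ioo (0 : ℝ) 1, ContDiff ℝ ((⊤ : ℕ∞) : WithTop ℕ∞) (periodize ξ₀ w h)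
  periodic : ∀ h ∈ Set.Ioo (0 : ℝ) 1, Function.Periodic (periodize ξ₀ w h) 1
  wavefront : circleWF (periodize ξ₀ w) = {((0 : UnitAddCircle), ξ₀)}
  norm_eq : ∃ C : ℝ, ∀ h ∈ Set.Ioo (0 : ℝ) 1,
    |circleNorm (periodize ξ₀ w h) - 1| ≤ C * h ^ ((1 : ℝ) / 2)
  equation : ∃ f : ℝ → ℝ → C2,
    (∀ h ∈ Set.Ioo (0 : ℝ) 1, IsWeylOnCircle h (P h) (periodize ξ₀ w h) (f h)) ∧
    ∃ C : ℝ, ∀ h ∈ Set.Ioo (0 : ℝ) 1,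
      circleNorm (fun x => f h x - ((lam h : ℝ) : ℂ) • periodize ξ₀ w h x)
        ≤ C * h ^ ((ℓ : ℝ) + 3 / 2)

end

noncomputable section

open MeasureTheory

/-! ### Uniform families of Schwartz functions and of symbols -/

/-! The theorem reduces to perturbation theory of a harmonic oscillator. A wave packet `h^{-1/4}
e^{iξ₀x/h} w(x/√h)` intertwines the `h`-quantization of `P` exactly with the `h = 1` quantization of
`T(y, η) = P(√h y, √h η + ξ₀; h)` (`weylVec_wavePacket`). Write `ε = √h`. Taylor expansion at the
bottom of the well, combined with `P ∼ ∑ h^k P_k`, gives `T ∼ ∑ ε^i T_i` with polynomial symbols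
`T_i`; the remainder is `ε^N` times a symbol of polynomial growth, uniformly in `h`
(`HasSymbolExpansion.unifSymMat_normalRem`). The well condition says that `T_0 = T_1 = 0` and `T_2 =
(η² + ω²y²) id + diag(μ₁, μ₂)`.

Existence on the line. Quantized polynomials preserve polynomials times the Gaussian
(`exists_amplitude_op_mat`), so one has a formal series of symmetric operators on pairs of
polynomials whose leading term is diagonal in the Hermite basis, with finite levels. The levels of
the two oscillators may coincide, hence degenerate perturbation theory is required. At each order
the residuals of the vectors sharing a formal eigenvalue form a Hermitian matrix (`formalRes_symm`).
A unitary rotation diagonalizes it, its eigenvalues are the next coefficients of `λ`, and the other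
components of the residual are removed by adding suitably delayed multiples of the remaining
eigenvectors (`FormalEigensystem.exists_succ`). All of this is algebra: Hermite amplitudes span the
polynomials, so every expansion is finite. Stopping at order `2ℓ` leaves an error `O(ε^{2ℓ+3}) =
O(h^{ℓ+3/2})`.

Passage to the circle. A Weyl operator with periodic symbol commutes with integer translations, so
it acts termwise on a periodic sum; duality with Schwartz functions makes this precise
(`isWeylOnCircle_perSum`). Distinct translates of a packet are almost orthogonal, hence the norm of
a periodization is that of its profile up to `O(h)` in the square. This yields the norm of `u` and
the bound on the residual. For the wavefront set, an operator with symbol `a` acts on the profile as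
`a(0, ξ₀) + O(ε)`, so it is not negligible if `a(0, ξ₀) ≠ 0`; if `a` is flat at `(0, ξ₀)`, all its
Taylor parts vanish and the result is `O(h^∞)`.

Uniformity in `h` is carried throughout by bounded families: `UnifSchwartz` for functions, `UnifSym`
for symbols. Weyl quantization maps bounded families to bounded families
(`UnifSchwartz.weylScalar`). -/

/-- A family of functions that is bounded in the Schwartz space. -/
structure UnifSchwartz {ι E : Type*} [NormedAddCommGroup E] [NormedSpace ℝ E]
    (φ : ι → ℝ → E) : Prop where
  smooth : ∀ i, ContDiff ℝ ((⊤ : ℕ∞) : WithTop ℕ∞) (φ i)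
  bound : ∀ p q : ℕ, ∃ C : ℝ, ∀ i y, |y| ^ p * ‖iteratedDeriv q (φ i) y‖ ≤ C

theorem iteratedDeriv_clm_comp {E F : Type*} [NormedAddCommGroup E] [NormedSpace ℝ E]
    [NormedAddCommGroup F] [NormedSpace ℝ F] (L : E →L[ℝ] F) {f : ℝ → E}
    (hf : ContDiff ℝ ((⊤ : ℕ∞) : WithTop ℕ∞) f) (q : ℕ) (y : ℝ) :
    iteratedDeriv q (fun y => L (f y)) y = L (iteratedDeriv q f y) := by
  induction q generalizing y f with
  | zero => simp
  | succ q ih =>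
    obtain ⟨h1, h2⟩ := contDiff_infty_iff_deriv.1 hf
    have e : deriv (fun y => L (f y)) = fun y => L (deriv f y) := by
      funext z
      exact (L.hasFDerivAt.comp_hasDerivAt z (h1 z).hasDerivAt).deriv
    rw [iteratedDeriv_succ', iteratedDeriv_succ', e, ih h2]

namespace UnifSchwartz

variable {ι κ E F : Type*} [NormedAddCommGroup E] [NormedSpace ℝ E]
  [NormedAddCommGroup F] [NormedSpace ℝ F] {φ ψ : ι → ℝ → E}

theorem contDiffAt (h : UnifSchwartz φ) (i : ι) (n : ℕ) (y : ℝ) : ContDiffAt ℝ n (φ i) y :=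
  ((h.smooth i).of_le (by exact_mod_cast le_top)).contDiffAt

theorem differentiable (h : UnifSchwartz φ) (i : ι) : Differentiable ℝ (φ i) :=
  (h.smooth i).differentiable (by simp)

theorem continuous (h : UnifSchwartz φ) (i : ι) : Continuous (φ i) := (h.smooth i).continuous

theorem comp_index (h : UnifSchwartz φ) (f : κ → ι) : UnifSchwartz (fun k => φ (f k)) :=
  ⟨fun k => h.smooth (f k), fun p q => (h.bound p q).imp fun _ hC k y => hC (f k) y⟩

theorem deriv (h : UnifSchwartz φ) : UnifSchwartz (fun i => deriv (φ i)) := by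
  refine ⟨fun i => (contDiff_infty_iff_deriv.1 (h.smooth i)).2, fun p q => ?_⟩
  obtain ⟨C, hC⟩ := h.bound p (q + 1)
  exact ⟨C, fun i y => by simpa [iteratedDeriv_succ'] using hC i y⟩

theorem add (h : UnifSchwartz φ) (h' : UnifSchwartz ψ) :
    UnifSchwartz (fun i y => φ i y + ψ i y) := by
  refine ⟨fun i => (h.smooth i).add (h'.smooth i), fun p q => ?_⟩
  obtain ⟨C, hC⟩ := h.bound p q
  obtain ⟨D, hD⟩ := h'.bound p q
  refine ⟨C + D, fun i y => ?_⟩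
  rw [iteratedDeriv_fun_add (h.contDiffAt i q y) (h'.contDiffAt i q y)]
  calc _ ≤ |y| ^ p * (‖iteratedDeriv q (φ i) y‖ + ‖iteratedDeriv q (ψ i) y‖) := by
        gcongr; exact norm_add_le _ _
    _ ≤ _ := by rw [mul_add]; exact add_le_add (hC i y) (hD i y)

theorem zero : UnifSchwartz (fun (_ : ι) (_ : ℝ) => (0 : E)) :=
  ⟨fun _ => contDiff_const, fun p q => ⟨0, fun i y => by simp⟩⟩

theorem sum {α : Type*} (s : Finset α) {f : α → ι → ℝ → E} (h : ∀ a ∈ s, UnifSchwartz (f a)) :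
    UnifSchwartz (fun i y => ∑ a ∈ s, f a i y) := by
  classical
  induction s using Finset.induction_on with
  | empty => simpa using zero
  | insert a s ha ih =>
    simp only [Finset.sum_insert ha]
    exact (h a (by simp)).add (ih fun b hb => h b (by simp [hb]))

/-- Composition with a bounded family of linear maps. -/
theorem clm (h : UnifSchwartz φ) {L : ι → E →L[ℝ] F} {B : ℝ} (hL : ∀ i, ‖L i‖ ≤ B) :
    UnifSchwartz (fun i y => L i (φ i y)) := by
  refine ⟨fun i => (L i).contDiff.comp (h.smooth i), fun p q => ?_⟩
  obtain ⟨C, hC⟩ := h.bound p q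
  refine ⟨B * C, fun i y => ?_⟩
  have := iteratedDeriv_clm_comp (L i) (h.smooth i) q y
  rw [this]
  have hB : 0 ≤ B := (norm_nonneg _).trans (hL i)
  calc |y| ^ p * ‖L i (iteratedDeriv q (φ i) y)‖
      ≤ |y| ^ p * (B * ‖iteratedDeriv q (φ i) y‖) := by
        gcongr; exact ((L i).le_opNorm _).trans (by gcongr; exact hL i)
    _ = B * (|y| ^ p * ‖iteratedDeriv q (φ i) y‖) := by ring
    _ ≤ B * C := by gcongr; exact hC i y

/-- Multiplication by the variable. -/
theorem mul_id {φ : ι → ℝ → ℂ} (h : UnifSchwartz φ) :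
    UnifSchwartz (fun i y => (y : ℂ) * φ i y) := by
  have hid : ContDiff ℝ ((⊤ : ℕ∞) : WithTop ℕ∞) (fun y : ℝ => (y : ℂ)) :=
    Complex.ofRealCLM.contDiff
  refine ⟨fun i => hid.mul (h.smooth i), fun p q => ?_⟩
  induction q generalizing φ with
  | zero =>
    obtain ⟨C, hC⟩ := h.bound (p + 1) 0
    refine ⟨C, fun i y => ?_⟩
    simpa [pow_succ, mul_assoc] using hC i y
  | succ q ih =>
    obtain ⟨C, hC⟩ := h.bound p q
    obtain ⟨D, hD⟩ := ih h.deriv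
    refine ⟨C + D, fun i y => ?_⟩
    have e : _root_.deriv (fun y : ℝ => (y : ℂ) * φ i y) =
        fun y => φ i y + (y : ℂ) * _root_.deriv (φ i) y := by
      funext z
      have := (Complex.ofRealCLM.hasDerivAt (x := z)).mul (h.differentiable i z).hasDerivAt
      have e2 := this.deriv
      simp only [Complex.ofRealCLM_apply, Complex.ofReal_one, one_mul] at e2
      exact e2
    rw [iteratedDeriv_succ', e, iteratedDeriv_fun_add (h.contDiffAt i q y)
      (((hid.mul (h.deriv.smooth i)).of_le (by exact_mod_cast le_top)).contDiffAt)]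
    calc _ ≤ |y| ^ p * (‖iteratedDeriv q (φ i) y‖ +
          ‖iteratedDeriv q (fun y : ℝ => (y : ℂ) * _root_.deriv (φ i) y) y‖) := by
          gcongr; exact norm_add_le _ _
      _ ≤ _ := by rw [mul_add]; exact add_le_add (hC i y) (hD i y)

/-- Rapid decay, in the form used to dominate integrals. -/
theorem decay (h : UnifSchwartz φ) (K : ℕ) :
    ∃ C : ℝ, 0 ≤ C ∧ ∀ i y, (1 + |y|) ^ K * ‖φ i y‖ ≤ C * (1 + y ^ 2)⁻¹ := by
  obtain ⟨C, hC⟩ := h.bound 0 0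
  obtain ⟨D, hD⟩ := h.bound (K + 2) 0
  -- Two powers beyond `K` pay for `1 + y²`; the power of 2 comes from `1 + |y| ≤ 2 max(1, |y|)`.
  refine ⟨2 ^ (K + 2) * (|C| + |D|), by positivity, fun i y => ?_⟩
  rw [← div_eq_mul_inv, le_div_iff₀ (by positivity)]
  have h1 : 1 + y ^ 2 ≤ (1 + |y|) ^ 2 := by nlinarith [abs_nonneg y, sq_abs y]
  have h2 : (1 + |y|) ^ (K + 2) ≤ 2 ^ (K + 2) * (1 + |y| ^ (K + 2)) := by
    rcases le_total |y| 1 with hy | hy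
    · calc (1 + |y|) ^ (K + 2) ≤ 2 ^ (K + 2) * 1 := by
            rw [mul_one]; gcongr; linarith
        _ ≤ _ := by gcongr; linarith [pow_nonneg (abs_nonneg y) (K + 2)]
    · calc (1 + |y|) ^ (K + 2) ≤ (2 * |y|) ^ (K + 2) := by gcongr; linarith
        _ ≤ _ := by rw [mul_pow]; gcongr; linarith
  have hC' := hC i y
  have hD' := hD i y
  simp only [pow_zero, one_mul, iteratedDeriv_zero] at hC' hD'
  calc (1 + |y|) ^ K * ‖φ i y‖ * (1 + y ^ 2) ≤ (1 + |y|) ^ K * ‖φ i y‖ * (1 + |y|) ^ 2 := by gcongr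
    _ = (1 + |y|) ^ (K + 2) * ‖φ i y‖ := by ring
    _ ≤ 2 ^ (K + 2) * (1 + |y| ^ (K + 2)) * ‖φ i y‖ := by gcongr
    _ = 2 ^ (K + 2) * (‖φ i y‖ + |y| ^ (K + 2) * ‖φ i y‖) := by ring
    _ ≤ _ := by gcongr; exacts [hC'.trans (le_abs_self _), hD'.trans (le_abs_self _)]

theorem integrable (h : UnifSchwartz φ) (i : ι) : Integrable (φ i) := by
  obtain ⟨C, _, hC⟩ := h.decay 0
  refine (integrable_inv_one_add_sq.const_mul C).mono' (h.continuous i).aestronglyMeasurable ?_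
  filter_upwards with y
  simpa using hC i y

end UnifSchwartz

/-- The class of Schwartz functions is closed under differentiation; a family of functions with this
kind of closure consists of smooth functions. -/
theorem contDiff_of_hasDerivAt_seq {E : Type*} [NormedAddCommGroup E] [NormedSpace ℝ E]
    {f : ℕ → ℝ → E} (h : ∀ n x, HasDerivAt (f n) (f (n + 1) x) x) :
    ContDiff ℝ ((⊤ : ℕ∞) : WithTop ℕ∞) (f 0) ∧ ∀ n, iteratedDeriv n (f 0) = f n := by
  have hd : ∀ n, deriv (f n) = f (n + 1) := fun n => funext fun x => (h n x).deriv
  have hi : ∀ n, iteratedDeriv n (f 0) = f n := by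
    intro n
    induction n with
    | zero => simp
    | succ n ih => rw [iteratedDeriv_succ, ih, hd]
  refine ⟨contDiff_of_differentiable_iteratedDeriv fun m _ => ?_, hi⟩
  rw [hi]
  exact fun x => (h m x).differentiableAt

/-! ### Calculus of smooth symbols and their mixed derivatives -/

/-- `∂_x a`. -/
def symDx (a : ℝ → ℝ → ℂ) (x ξ : ℝ) : ℂ := deriv (fun z => a z ξ) x

/-- `∂_ξ a`. -/
def symDxi (a : ℝ → ℝ → ℂ) (x ξ : ℝ) : ℂ := deriv (fun ζ => a x ζ) ξ

namespace IsSmoothSymbol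

variable {a : ℝ → ℝ → ℂ}

theorem hasFDerivAt (h : IsSmoothSymbol a) (p : ℝ × ℝ) :
    HasFDerivAt (fun p : ℝ × ℝ => a p.1 p.2) (fderiv ℝ (fun p : ℝ × ℝ => a p.1 p.2) p) p :=
  (ContDiff.differentiable h (by simp) p).hasFDerivAt

/-- Both partial derivatives are the Fréchet derivative in a coordinate direction, so linearity
gives the formula. Every differentiation of a Weyl integrand goes through it. -/
theorem hasDerivAt_comp (h : IsSmoothSymbol a) {u v : ℝ → ℝ} {u' v' t : ℝ}
    (hu : HasDerivAt u u' t) (hv : HasDerivAt v v' t) :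
    HasDerivAt (fun t => a (u t) (v t)) (u' * symDx a (u t) (v t) + v' * symDxi a (u t) (v t)) t := by
  have key : ∀ {u v : ℝ → ℝ} {u' v' t : ℝ}, HasDerivAt u u' t → HasDerivAt v v' t →
      HasDerivAt (fun t => a (u t) (v t))
        (fderiv ℝ (fun p : ℝ × ℝ => a p.1 p.2) (u t, v t) (u', v')) t := by
    intro u v u' v' t hu hv
    exact (h.hasFDerivAt (u t, v t)).comp_hasDerivAt t (hu.prodMk hv)
  have h1 : symDx a (u t) (v t) = fderiv ℝ (fun p : ℝ × ℝ => a p.1 p.2) (u t, v t) (1, 0) :=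
    (key (hasDerivAt_id (u t)) (hasDerivAt_const (u t) (v t))).deriv
  have h2 : symDxi a (u t) (v t) = fderiv ℝ (fun p : ℝ × ℝ => a p.1 p.2) (u t, v t) (0, 1) :=
    (key (hasDerivAt_const (v t) (u t)) (hasDerivAt_id (v t))).deriv
  convert key hu hv using 1
  have : ((u', v') : ℝ × ℝ) = u' • (1, 0) + v' • (0, 1) := by simp
  rw [this, map_add, map_smul, map_smul, h1, h2]
  simp

theorem symDx_eq (h : IsSmoothSymbol a) :
    symDx a = fun x ξ => fderiv ℝ (fun p : ℝ × ℝ => a p.1 p.2) (x, ξ) (1, 0) := by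
  funext x ξ
  exact ((h.hasFDerivAt (x, ξ)).comp_hasDerivAt x
    ((hasDerivAt_id x).prodMk (hasDerivAt_const x ξ))).deriv

theorem symDxi_eq (h : IsSmoothSymbol a) :
    symDxi a = fun x ξ => fderiv ℝ (fun p : ℝ × ℝ => a p.1 p.2) (x, ξ) (0, 1) := by
  funext x ξ
  exact ((h.hasFDerivAt (x, ξ)).comp_hasDerivAt ξ
    ((hasDerivAt_const ξ x).prodMk (hasDerivAt_id ξ))).deriv

theorem contDiff_fderiv (h : IsSmoothSymbol a) :
    ContDiff ℝ ((⊤ : ℕ∞) : WithTop ℕ∞) (fderiv ℝ (fun p : ℝ × ℝ => a p.1 p.2)) :=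
  ContDiff.fderiv_right (m := ((⊤ : ℕ∞) : WithTop ℕ∞)) h (by simp)

theorem dx (h : IsSmoothSymbol a) : IsSmoothSymbol (symDx a) := by
  rw [h.symDx_eq]
  exact h.contDiff_fderiv.clm_apply contDiff_const

theorem dxi (h : IsSmoothSymbol a) : IsSmoothSymbol (symDxi a) := by
  rw [h.symDxi_eq]
  exact h.contDiff_fderiv.clm_apply contDiff_const

/-- Symmetry of second derivatives. It is needed because `mixedDeriv` fixes an order, with the
`x`-derivatives taken first. -/
theorem symDx_symDxi (h : IsSmoothSymbol a) : symDx (symDxi a) = symDxi (symDx a) := by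
  rw [h.dxi.symDx_eq, h.dx.symDxi_eq, h.symDx_eq, h.symDxi_eq]
  funext x ξ
  have hd := (h.contDiff_fderiv.differentiable (by simp) (x, ξ)).hasFDerivAt
  have hs := second_derivative_symmetric (fun p => h.hasFDerivAt p) hd
  have e1 := hd.clm_apply (hasFDerivAt_const ((0, 1) : ℝ × ℝ) (x, ξ))
  have e2 := hd.clm_apply (hasFDerivAt_const ((1, 0) : ℝ × ℝ) (x, ξ))
  have e1' := e1.fderiv
  have e2' := e2.fderiv
  have := hs (1, 0) (0, 1)
  simp only [Prod.mk.eta] at *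
  rw [e1', e2']
  simpa using this

theorem continuous (h : IsSmoothSymbol a) : Continuous (fun p : ℝ × ℝ => a p.1 p.2) :=
  ContDiff.continuous h

theorem slice_left (h : IsSmoothSymbol a) (ξ : ℝ) (n : ℕ) : ContDiff ℝ n (fun x => a x ξ) :=
  (ContDiff.comp h (contDiff_id.prodMk contDiff_const)).of_le (by exact_mod_cast le_top)

theorem slice_right (h : IsSmoothSymbol a) (x : ℝ) (n : ℕ) : ContDiff ℝ n (fun ξ => a x ξ) :=
  (ContDiff.comp h (contDiff_const.prodMk contDiff_id)).of_le (by exact_mod_cast le_top)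

end IsSmoothSymbol

theorem mixedDeriv_zero_zero (a : ℝ → ℝ → ℂ) : mixedDeriv 0 0 a = a := by
  funext x ξ; simp [mixedDeriv]

theorem mixedDeriv_succ_right (j k : ℕ) (a : ℝ → ℝ → ℂ) :
    mixedDeriv j (k + 1) a = mixedDeriv j k (symDx a) := by
  funext x ξ; simp only [mixedDeriv, iteratedDeriv_succ']; rfl

theorem mixedDeriv_succ_left (j k : ℕ) (a : ℝ → ℝ → ℂ) :
    mixedDeriv (j + 1) k a = symDxi (mixedDeriv j k a) := by
  funext x ξ; simp only [mixedDeriv, iteratedDeriv_succ, symDxi]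

/-- A `ξ`-derivative is commuted inwards past all `x`-derivatives; this is what makes `UnifSym`
stable under `symDxi`. -/
theorem mixedDeriv_succ_left' (j k : ℕ) {a : ℝ → ℝ → ℂ} (ha : IsSmoothSymbol a) :
    mixedDeriv (j + 1) k a = mixedDeriv j k (symDxi a) := by
  induction k generalizing a with
  | zero => funext x ξ; simp only [mixedDeriv, iteratedDeriv_succ', iteratedDeriv_zero]; rfl
  | succ k ih => rw [mixedDeriv_succ_right, ih ha.dx, ← ha.symDx_symDxi, ← mixedDeriv_succ_right]

theorem IsSmoothSymbol.mixedDeriv {a : ℝ → ℝ → ℂ} (ha : IsSmoothSymbol a) (j k : ℕ) :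
    IsSmoothSymbol (mixedDeriv j k a) := by
  induction k generalizing a with
  | zero =>
    induction j generalizing a with
    | zero => rwa [mixedDeriv_zero_zero]
    | succ j ih => rw [mixedDeriv_succ_left' _ _ ha]; exact ih ha.dxi
  | succ k ih => rw [mixedDeriv_succ_right]; exact ih ha.dx

/-! ### Uniform families of symbols of polynomial growth -/

/-- The weight `(1 + |x|)^K (1 + |ξ|)^K`. -/
def symWeight (K : ℕ) (x ξ : ℝ) : ℝ := (1 + |x|) ^ K * (1 + |ξ|) ^ K

theorem symWeight_nonneg (K : ℕ) (x ξ : ℝ) : 0 ≤ symWeight K x ξ := by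
  unfold symWeight; positivity

theorem one_le_symWeight (K : ℕ) (x ξ : ℝ) : 1 ≤ symWeight K x ξ := by
  unfold symWeight
  exact one_le_mul_of_one_le_of_one_le (one_le_pow₀ (by linarith [abs_nonneg x]))
    (one_le_pow₀ (by linarith [abs_nonneg ξ]))

theorem symWeight_mono {K L : ℕ} (h : K ≤ L) (x ξ : ℝ) : symWeight K x ξ ≤ symWeight L x ξ := by
  unfold symWeight
  gcongr <;> linarith [abs_nonneg x, abs_nonneg ξ]

/-- A family of symbols of polynomial growth, together with all derivatives, uniformly. -/
structure UnifSym {ι : Type*} (K : ℕ) (F : ι → ℝ → ℝ → ℂ) : Prop where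
  smooth : ∀ i, IsSmoothSymbol (F i)
  bound : ∀ j k : ℕ, ∃ C : ℝ, ∀ i x ξ, ‖mixedDeriv j k (F i) x ξ‖ ≤ C * symWeight K x ξ

theorem mixedDeriv_fun_add {a b : ℝ → ℝ → ℂ} (ha : IsSmoothSymbol a) (hb : IsSmoothSymbol b)
    (j k : ℕ) : mixedDeriv j k (fun x ξ => a x ξ + b x ξ) =
      fun x ξ => mixedDeriv j k a x ξ + mixedDeriv j k b x ξ := by
  funext x ξ
  have e : ∀ ζ, iteratedDeriv k (fun z => a z ζ + b z ζ) x =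
      iteratedDeriv k (fun z => a z ζ) x + iteratedDeriv k (fun z => b z ζ) x := fun ζ =>
    iteratedDeriv_fun_add (ha.slice_left ζ k).contDiffAt (hb.slice_left ζ k).contDiffAt
  have h1 := (ha.mixedDeriv 0 k).slice_right x j
  have h2 := (hb.mixedDeriv 0 k).slice_right x j
  simp only [mixedDeriv, iteratedDeriv_zero] at h1 h2 ⊢
  simp only [e]
  exact iteratedDeriv_fun_add h1.contDiffAt h2.contDiffAt

theorem mixedDeriv_const_mul {a : ℝ → ℝ → ℂ} (ha : IsSmoothSymbol a) (c : ℂ)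
    (j k : ℕ) : mixedDeriv j k (fun x ξ => c * a x ξ) = fun x ξ => c * mixedDeriv j k a x ξ := by
  funext x ξ
  have e : ∀ ζ, iteratedDeriv k (fun z => c * a z ζ) x = c * iteratedDeriv k (fun z => a z ζ) x :=
    fun ζ => iteratedDeriv_const_mul c (ha.slice_left ζ k).contDiffAt
  have h1 := (ha.mixedDeriv 0 k).slice_right x j
  simp only [mixedDeriv, iteratedDeriv_zero] at h1 ⊢
  simp only [e]
  exact iteratedDeriv_const_mul c h1.contDiffAt

theorem iteratedDeriv_comp_mul_add {E : Type*} [NormedAddCommGroup E] [NormedSpace ℝ E]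
    {f : ℝ → E} {n : ℕ} (hf : ContDiff ℝ n f) (c d x : ℝ) :
    iteratedDeriv n (fun z => f (c * z + d)) x = c ^ n • iteratedDeriv n f (c * x + d) := by
  have h1 : ContDiff ℝ n (fun z => f (z + d)) := hf.comp (contDiff_id.add contDiff_const)
  have := iteratedDeriv_comp_const_smul h1 c
  rw [iteratedDeriv_comp_add_const] at this
  exact congrFun this x

theorem mixedDeriv_comp_affine {a : ℝ → ℝ → ℂ} (ha : IsSmoothSymbol a) (α α' β β' : ℝ) (j k : ℕ)
    (x ξ : ℝ) : mixedDeriv j k (fun x ξ => a (α * x + α') (β * ξ + β')) x ξ =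
      ((β ^ j * α ^ k : ℝ) : ℂ) * mixedDeriv j k a (α * x + α') (β * ξ + β') := by
  have e : ∀ ζ, iteratedDeriv k (fun z => a (α * z + α') (β * ζ + β')) x =
      (α ^ k : ℝ) • iteratedDeriv k (fun z => a z (β * ζ + β')) (α * x + α') := fun ζ =>
    iteratedDeriv_comp_mul_add (ha.slice_left (β * ζ + β') k) α α' x
  have h1 := (ha.mixedDeriv 0 k).slice_right (α * x + α') j
  simp only [mixedDeriv, iteratedDeriv_zero] at h1 ⊢
  simp only [e]
  rw [iteratedDeriv_comp_mul_add (f := fun t => (α ^ k : ℝ) • iteratedDeriv k (fun z => a z t)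
    (α * x + α')) (h1.const_smul _) β β' ξ]
  rw [iteratedDeriv_fun_const_smul h1.contDiffAt]
  simp [mul_assoc]

theorem IsSmoothSymbol.comp_affine {a : ℝ → ℝ → ℂ} (ha : IsSmoothSymbol a) (α α' β β' : ℝ) :
    IsSmoothSymbol (fun x ξ => a (α * x + α') (β * ξ + β')) := by
  unfold IsSmoothSymbol at *
  exact ha.comp (f := fun p : ℝ × ℝ => (α * p.1 + α', β * p.2 + β')) (by fun_prop)

namespace UnifSym

variable {ι κ : Type*} {K L : ℕ} {F G : ι → ℝ → ℝ → ℂ}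

theorem bound' (h : UnifSym K F) (j k : ℕ) :
    ∃ C : ℝ, 0 ≤ C ∧ ∀ i x ξ, ‖mixedDeriv j k (F i) x ξ‖ ≤ C * symWeight K x ξ := by
  obtain ⟨C, hC⟩ := h.bound j k
  refine ⟨|C|, abs_nonneg C, fun i x ξ => (hC i x ξ).trans ?_⟩
  exact mul_le_mul_of_nonneg_right (le_abs_self C) (symWeight_nonneg _ _ _)

theorem mono (h : UnifSym K F) (hKL : K ≤ L) : UnifSym L F := by
  refine ⟨h.smooth, fun j k => ?_⟩
  obtain ⟨C, hC0, hC⟩ := h.bound' j k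
  exact ⟨C, fun i x ξ => (hC i x ξ).trans (by gcongr; exact symWeight_mono hKL x ξ)⟩

theorem comp_index (h : UnifSym K F) (f : κ → ι) : UnifSym K (fun k => F (f k)) :=
  ⟨fun k => h.smooth (f k), fun p q => (h.bound p q).imp fun _ hC k => hC (f k)⟩

theorem dx (h : UnifSym K F) : UnifSym K (fun i => symDx (F i)) :=
  ⟨fun i => (h.smooth i).dx, fun j k => (h.bound j (k + 1)).imp fun _ hC i x ξ => by
    rw [← mixedDeriv_succ_right]; exact hC i x ξ⟩

theorem dxi (h : UnifSym K F) : UnifSym K (fun i => symDxi (F i)) :=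
  ⟨fun i => (h.smooth i).dxi, fun j k => (h.bound (j + 1) k).imp fun _ hC i x ξ => by
    rw [← mixedDeriv_succ_left' _ _ (h.smooth i)]; exact hC i x ξ⟩

theorem add (h : UnifSym K F) (h' : UnifSym K G) : UnifSym K (fun i x ξ => F i x ξ + G i x ξ) := by
  refine ⟨fun i => ContDiff.add (h.smooth i) (h'.smooth i), fun j k => ?_⟩
  obtain ⟨C, hC⟩ := h.bound j k
  obtain ⟨D, hD⟩ := h'.bound j k
  refine ⟨C + D, fun i x ξ => ?_⟩
  rw [mixedDeriv_fun_add (h.smooth i) (h'.smooth i), add_mul]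
  exact (norm_add_le _ _).trans (add_le_add (hC i x ξ) (hD i x ξ))

theorem const_mul (h : UnifSym K F) {c : ι → ℂ} {B : ℝ} (hc : ∀ i, ‖c i‖ ≤ B) :
    UnifSym K (fun i x ξ => c i * F i x ξ) := by
  refine ⟨fun i => ContDiff.mul contDiff_const (h.smooth i), fun j k => ?_⟩
  obtain ⟨C, hC0, hC⟩ := h.bound' j k
  refine ⟨B * C, fun i x ξ => ?_⟩
  rw [mixedDeriv_const_mul (h.smooth i), norm_mul, mul_assoc]
  exact mul_le_mul (hc i) (hC i x ξ) (norm_nonneg _) ((norm_nonneg _).trans (hc i))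

theorem zero : UnifSym K (fun (_ : ι) (_ _ : ℝ) => (0 : ℂ)) :=
  ⟨fun _ => contDiff_const, fun j k => ⟨0, fun i x ξ => by simp [mixedDeriv]⟩⟩

theorem sum {α : Type*} (s : Finset α) {f : α → ι → ℝ → ℝ → ℂ} (h : ∀ a ∈ s, UnifSym K (f a)) :
    UnifSym K (fun i x ξ => ∑ a ∈ s, f a i x ξ) := by
  classical
  induction s using Finset.induction_on with
  | empty => simpa using zero
  | insert a s ha ih =>
    simp only [Finset.sum_insert ha]
    exact (h a (by simp)).add (ih fun b hb => h b (by simp [hb]))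

theorem one : UnifSym K (fun (_ : ι) (_ _ : ℝ) => (1 : ℂ)) := by
  refine ⟨fun _ => contDiff_const, fun j k => ⟨1, fun i x ξ => ?_⟩⟩
  rw [one_mul]
  refine le_trans ?_ (one_le_symWeight K x ξ)
  rcases k with - | k <;> rcases j with - | j <;> simp [mixedDeriv, iteratedDeriv_const]

/-- Families obtained by rescalings that do not expand. -/
theorem comp_affine (h : UnifSym K F) {α β α' β' : ι → ℝ} {A : ℝ} (hα : ∀ i, |α i| ≤ 1)
    (hβ : ∀ i, |β i| ≤ 1) (hα' : ∀ i, |α' i| ≤ A) (hβ' : ∀ i, |β' i| ≤ A) :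
    UnifSym K (fun i x ξ => F i (α i * x + α' i) (β i * ξ + β' i)) := by
  refine ⟨fun i => (h.smooth i).comp_affine _ _ _ _, fun j k => ?_⟩
  obtain ⟨C, hC0, hC⟩ := h.bound' j k
  -- One factor per variable, from `1 + |c x + d| ≤ (1 + A)(1 + |x|)` for `|c| ≤ 1`, `|d| ≤ A`; the
  -- chain rule only produces factors of modulus at most 1.
  refine ⟨C * ((1 + A) ^ K * (1 + A) ^ K), fun i x ξ => ?_⟩
  have hA : 0 ≤ A := (abs_nonneg _).trans (hα' i)
  have key : ∀ {c d x : ℝ}, |c| ≤ 1 → |d| ≤ A → 1 + |c * x + d| ≤ (1 + A) * (1 + |x|) := by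
    intro c d x hc hd
    have : |c * x + d| ≤ |c| * |x| + |d| := by rw [← abs_mul]; exact abs_add_le _ _
    nlinarith [abs_nonneg x, mul_le_mul_of_nonneg_right hc (abs_nonneg x)]
  rw [mixedDeriv_comp_affine (h.smooth i), norm_mul]
  have h1 : ‖((β i ^ j * α i ^ k : ℝ) : ℂ)‖ ≤ 1 := by
    rw [Complex.norm_real, Real.norm_eq_abs, abs_mul, abs_pow, abs_pow]
    exact mul_le_one₀ (pow_le_one₀ (abs_nonneg _) (hβ i)) (by positivity)
      (pow_le_one₀ (abs_nonneg _) (hα i))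
  calc _ ≤ 1 * (C * symWeight K (α i * x + α' i) (β i * ξ + β' i)) :=
        mul_le_mul h1 (hC i _ _) (norm_nonneg _) zero_le_one
    _ ≤ C * (((1 + A) * (1 + |x|)) ^ K * ((1 + A) * (1 + |ξ|)) ^ K) := by
        rw [one_mul, symWeight]
        gcongr
        exacts [key (hα i) (hα' i), key (hβ i) (hβ' i)]
    _ = _ := by rw [symWeight, mul_pow, mul_pow]; ring

theorem norm_le (h : UnifSym K F) :
    ∃ C : ℝ, 0 ≤ C ∧ ∀ i x ξ, ‖F i x ξ‖ ≤ C * symWeight K x ξ := by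
  obtain ⟨C, h0, hC⟩ := h.bound' 0 0
  exact ⟨C, h0, fun i x ξ => by simpa [mixedDeriv_zero_zero] using hC i x ξ⟩

end UnifSym

end

noncomputable section

open MeasureTheory

/-! ### Scalar Weyl quantization on the line -/

/-- The oscillating factor `e^{i(x-y)ξ}`. -/
def weylPhase (x ξ y : ℝ) : ℂ := Complex.exp (Complex.I * (((x - y) * ξ : ℝ) : ℂ))

theorem norm_weylPhase (x ξ y : ℝ) : ‖weylPhase x ξ y‖ = 1 := by
  rw [weylPhase, mul_comm, Complex.norm_exp_ofReal_mul_I]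

theorem continuous_weylPhase : Continuous (fun p : (ℝ × ℝ) × ℝ => weylPhase p.1.1 p.1.2 p.2) := by
  unfold weylPhase; fun_prop

theorem hasDerivAt_weylPhase {f g k : ℝ → ℝ} {f' g' k' t : ℝ} (hf : HasDerivAt f f' t)
    (hg : HasDerivAt g g' t) (hk : HasDerivAt k k' t) :
    HasDerivAt (fun t => weylPhase (f t) (g t) (k t))
      (Complex.I * (((f' - k') * g t + (f t - k t) * g' : ℝ) : ℂ) * weylPhase (f t) (g t) (k t))
      t := by
  unfold weylPhase
  have := (((hf.sub hk).mul hg).ofReal_comp.const_mul Complex.I).cexp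
  refine this.congr_deriv ?_
  simp only [Pi.sub_apply, Pi.mul_apply]
  ring

/-- The integrand of `weylInner`. -/
def weylIntegrand (a : ℝ → ℝ → ℂ) (φ : ℝ → ℂ) (x ξ y : ℝ) : ℂ :=
  weylPhase x ξ y * (a ((x + y) / 2) ξ * φ y)

/-- The inner integral of the Weyl quantization with `h = 1`. -/
def weylInner (a : ℝ → ℝ → ℂ) (φ : ℝ → ℂ) (x ξ : ℝ) : ℂ := ∫ y : ℝ, weylIntegrand a φ x ξ y

/-- The Weyl quantization with `h = 1` of a scalar symbol. -/
def weylScalar (a : ℝ → ℝ → ℂ) (φ : ℝ → ℂ) (x : ℝ) : ℂ :=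
  (((2 * Real.pi)⁻¹ : ℝ) : ℂ) * ∫ ξ : ℝ, weylInner a φ x ξ

variable {ι : Type*} {K : ℕ} {F G : ι → ℝ → ℝ → ℂ} {φ ψ : ι → ℝ → ℂ}

theorem one_add_abs_half_le (x y : ℝ) : 1 + |(x + y) / 2| ≤ (1 + |x|) * (1 + |y|) := by
  rw [abs_div, abs_two]
  nlinarith [abs_add_le x y, abs_nonneg x, abs_nonneg y, mul_nonneg (abs_nonneg x) (abs_nonneg y)]

/-- The weight at the midpoint is at most the weight at `x` times `(1 + |y|)^K`, and the decay of
`φ` absorbs the latter with an integrable factor to spare. There is no decay in `ξ` yet: it appears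
only after integration over `y`. -/
theorem norm_weylIntegrand_le (hF : UnifSym K F) (hφ : UnifSchwartz φ) :
    ∃ C : ℝ, 0 ≤ C ∧ ∀ i x ξ y,
      ‖weylIntegrand (F i) (φ i) x ξ y‖ ≤ C * symWeight K x ξ * (1 + y ^ 2)⁻¹ := by
  obtain ⟨C, hC0, hC⟩ := hF.norm_le
  obtain ⟨D, hD0, hD⟩ := hφ.decay K
  refine ⟨C * D, by positivity, fun i x ξ y => ?_⟩
  rw [weylIntegrand, norm_mul, norm_weylPhase, one_mul, norm_mul]
  have h1 : symWeight K ((x + y) / 2) ξ ≤ symWeight K x ξ * (1 + |y|) ^ K := by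
    unfold symWeight
    calc _ ≤ ((1 + |x|) * (1 + |y|)) ^ K * (1 + |ξ|) ^ K := by
          gcongr; exact one_add_abs_half_le x y
      _ = _ := by rw [mul_pow]; ring
  calc _ ≤ C * (symWeight K x ξ * (1 + |y|) ^ K) * ‖φ i y‖ := by
        gcongr; exact (hC i _ _).trans (by gcongr)
    _ = C * symWeight K x ξ * ((1 + |y|) ^ K * ‖φ i y‖) := by ring
    _ ≤ C * symWeight K x ξ * (D * (1 + y ^ 2)⁻¹) := by
        have := symWeight_nonneg K x ξ
        exact mul_le_mul_of_nonneg_left (hD i y) (by positivity)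
    _ = _ := by ring

theorem continuous_weylIntegrand {a : ℝ → ℝ → ℂ} (ha : IsSmoothSymbol a) {φ : ℝ → ℂ}
    (hφ : Continuous φ) :
    Continuous (fun p : (ℝ × ℝ) × ℝ => weylIntegrand a φ p.1.1 p.1.2 p.2) := by
  unfold weylIntegrand
  refine continuous_weylPhase.mul (Continuous.mul ?_ (hφ.comp continuous_snd))
  exact ha.continuous.comp (f := fun p : (ℝ × ℝ) × ℝ => ((p.1.1 + p.2) / 2, p.1.2)) (by fun_prop)

theorem continuous_weylIntegrand_right {a : ℝ → ℝ → ℂ} (ha : IsSmoothSymbol a) {φ : ℝ → ℂ}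
    (hφ : Continuous φ) (x ξ : ℝ) : Continuous (weylIntegrand a φ x ξ) :=
  (continuous_weylIntegrand ha hφ).comp (f := fun y => ((x, ξ), y)) (by fun_prop)

theorem integrable_weylIntegrand (hF : UnifSym K F) (hφ : UnifSchwartz φ) (i : ι) (x ξ : ℝ) :
    Integrable (weylIntegrand (F i) (φ i) x ξ) := by
  obtain ⟨C, hC0, hC⟩ := norm_weylIntegrand_le hF hφ
  refine (integrable_inv_one_add_sq.const_mul (C * symWeight K x ξ)).mono'
    (continuous_weylIntegrand_right (hF.smooth i) (hφ.continuous i) x ξ).aestronglyMeasurable ?_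
  filter_upwards with y using hC i x ξ y

theorem norm_weylInner_le (hF : UnifSym K F) (hφ : UnifSchwartz φ) :
    ∃ C : ℝ, 0 ≤ C ∧ ∀ i x ξ, ‖weylInner (F i) (φ i) x ξ‖ ≤ C * symWeight K x ξ := by
  obtain ⟨C, hC0, hC⟩ := norm_weylIntegrand_le hF hφ
  refine ⟨C * ∫ y : ℝ, (1 + y ^ 2)⁻¹, by positivity, fun i x ξ => ?_⟩
  calc _ ≤ ∫ y : ℝ, C * symWeight K x ξ * (1 + y ^ 2)⁻¹ :=
        norm_integral_le_of_norm_le (integrable_inv_one_add_sq.const_mul _)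
          (by filter_upwards with y using hC i x ξ y)
    _ = _ := by rw [integral_const_mul]; ring

/-- The phase contributes `-iξ`; the midpoint contributes half an `x`-derivative of the symbol, the
source of the factors `1 / 2` below. -/
theorem hasDerivAt_weylIntegrand_right {a : ℝ → ℝ → ℂ} (ha : IsSmoothSymbol a) {φ : ℝ → ℂ}
    (hφ : Differentiable ℝ φ) (x ξ y : ℝ) :
    HasDerivAt (weylIntegrand a φ x ξ)
      (-(Complex.I * (ξ : ℂ)) * weylIntegrand a φ x ξ y +
        ((1 / 2 : ℂ) * weylIntegrand (symDx a) φ x ξ y + weylIntegrand a (deriv φ) x ξ y)) y := by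
  have h1 := hasDerivAt_weylPhase (hasDerivAt_const y x) (hasDerivAt_const y ξ) (hasDerivAt_id y)
  have h2 := ha.hasDerivAt_comp (((hasDerivAt_id y).const_add x).div_const 2) (hasDerivAt_const y ξ)
  have h3 := h1.mul (h2.mul (hφ y).hasDerivAt)
  refine h3.congr_deriv ?_
  simp only [weylIntegrand, id]
  push_cast
  simp only [Pi.mul_apply]
  ring

/-- Integration by parts in the inner integral. -/
theorem mul_weylInner (hF : UnifSym K F) (hφ : UnifSchwartz φ) (i : ι) (x ξ : ℝ) :
    (ξ : ℂ) * weylInner (F i) (φ i) x ξ = -Complex.I * ((1 / 2 : ℂ) *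
      weylInner (symDx (F i)) (φ i) x ξ + weylInner (F i) (deriv (φ i)) x ξ) := by
  have i1 := integrable_weylIntegrand hF hφ i x ξ
  have i2 := integrable_weylIntegrand hF.dx hφ i x ξ
  have i3 := integrable_weylIntegrand hF hφ.deriv i x ξ
  have i4 := (i2.const_mul (1 / 2 : ℂ)).add i3
  have i5 := i1.const_mul (-(Complex.I * (ξ : ℂ)))
  have key := integral_eq_zero_of_hasDerivAt_of_integrable
    (hasDerivAt_weylIntegrand_right (hF.smooth i) (hφ.differentiable i) x ξ) (i5.add i4) i1
  have e : ∫ y : ℝ, (-(Complex.I * (ξ : ℂ)) * weylIntegrand (F i) (φ i) x ξ y +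
        ((1 / 2 : ℂ) * weylIntegrand (symDx (F i)) (φ i) x ξ y +
          weylIntegrand (F i) (deriv (φ i)) x ξ y)) =
      -(Complex.I * (ξ : ℂ)) * weylInner (F i) (φ i) x ξ + ((1 / 2 : ℂ) *
      weylInner (symDx (F i)) (φ i) x ξ + weylInner (F i) (deriv (φ i)) x ξ) := by
    have e1 := integral_add i5 i4
    have e2 := integral_add (i2.const_mul (1 / 2 : ℂ)) i3
    simp only [Pi.add_apply] at e1 e2
    rw [e1, e2, integral_const_mul, integral_const_mul]
    rfl
  rw [e] at key
  linear_combination Complex.I * key + (ξ : ℂ) * weylInner (F i) (φ i) x ξ * Complex.I_mul_I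

/-- Each factor `ξ` is traded for a derivative of the symbol or of the function by `mul_weylInner`.
Both stay in their uniform classes, so the induction runs over all `F` and `φ` at once. -/
theorem pow_mul_norm_weylInner_le (hF : UnifSym K F) (hφ : UnifSchwartz φ) (N : ℕ) :
    ∃ C : ℝ, 0 ≤ C ∧ ∀ i x ξ, |ξ| ^ N * ‖weylInner (F i) (φ i) x ξ‖ ≤ C * symWeight K x ξ := by
  induction N generalizing F φ with
  | zero => simpa using norm_weylInner_le hF hφ
  | succ N ih =>
    obtain ⟨C, hC0, hC⟩ := ih hF.dx hφ
    obtain ⟨D, hD0, hD⟩ := ih hF hφ.deriv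
    refine ⟨C + D, by positivity, fun i x ξ => ?_⟩
    have e : ‖(ξ : ℂ) * weylInner (F i) (φ i) x ξ‖ ≤
        ‖weylInner (symDx (F i)) (φ i) x ξ‖ + ‖weylInner (F i) (deriv (φ i)) x ξ‖ := by
      rw [mul_weylInner hF hφ, norm_mul, norm_neg, Complex.norm_I, one_mul]
      refine (norm_add_le _ _).trans ?_
      gcongr
      rw [norm_mul]
      exact mul_le_of_le_one_left (norm_nonneg _) (by norm_num)
    rw [norm_mul, Complex.norm_real, Real.norm_eq_abs] at e
    calc _ = |ξ| ^ N * (|ξ| * ‖weylInner (F i) (φ i) x ξ‖) := by ring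
      _ ≤ |ξ| ^ N * (‖weylInner (symDx (F i)) (φ i) x ξ‖ +
          ‖weylInner (F i) (deriv (φ i)) x ξ‖) := by gcongr
      _ ≤ _ := by rw [mul_add, add_mul]; exact add_le_add (hC i x ξ) (hD i x ξ)

/-- The inner integral is rapidly decreasing in `ξ`. -/
theorem weylInner_decay (hF : UnifSym K F) (hφ : UnifSchwartz φ) :
    ∃ C : ℝ, 0 ≤ C ∧ ∀ i x ξ,
      (1 + |ξ|) * ‖weylInner (F i) (φ i) x ξ‖ ≤ C * (1 + |x|) ^ K * (1 + ξ ^ 2)⁻¹ := by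
  obtain ⟨C, hC0, hC⟩ := pow_mul_norm_weylInner_le hF hφ 0
  -- `K` powers cancel the growth of the symbol in `ξ`, two produce `(1 + ξ²)⁻¹`, and one pays for
  -- the factor `1 + |ξ|`.
  obtain ⟨D, hD0, hD⟩ := pow_mul_norm_weylInner_le hF hφ (K + 3)
  refine ⟨2 ^ (K + 3) * (C + D), by positivity, fun i x ξ => ?_⟩
  have h1 : 1 + ξ ^ 2 ≤ (1 + |ξ|) ^ 2 := by nlinarith [abs_nonneg ξ, sq_abs ξ]
  have h2 : (1 + |ξ|) ^ (K + 3) ≤ 2 ^ (K + 3) * (1 + |ξ| ^ (K + 3)) := by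
    rcases le_total |ξ| 1 with hy | hy
    · calc (1 + |ξ|) ^ (K + 3) ≤ 2 ^ (K + 3) * 1 := by
            rw [mul_one]; gcongr; linarith
        _ ≤ _ := by gcongr; linarith [pow_nonneg (abs_nonneg ξ) (K + 3)]
    · calc (1 + |ξ|) ^ (K + 3) ≤ (2 * |ξ|) ^ (K + 3) := by gcongr; linarith
        _ ≤ _ := by rw [mul_pow]; gcongr; linarith
  have hC' := hC i x ξ
  rw [pow_zero, one_mul] at hC'
  have h0 : 0 < 1 + |ξ| := by positivity
  rw [← div_eq_mul_inv, le_div_iff₀ (by positivity)]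
  refine le_of_mul_le_mul_right ?_ (pow_pos h0 K)
  calc (1 + |ξ|) * ‖weylInner (F i) (φ i) x ξ‖ * (1 + ξ ^ 2) * (1 + |ξ|) ^ K
      ≤ (1 + |ξ|) * ‖weylInner (F i) (φ i) x ξ‖ * (1 + |ξ|) ^ 2 * (1 + |ξ|) ^ K := by gcongr
    _ = (1 + |ξ|) ^ (K + 3) * ‖weylInner (F i) (φ i) x ξ‖ := by ring
    _ ≤ 2 ^ (K + 3) * (1 + |ξ| ^ (K + 3)) * ‖weylInner (F i) (φ i) x ξ‖ := by gcongr
    _ = 2 ^ (K + 3) * (‖weylInner (F i) (φ i) x ξ‖ + |ξ| ^ (K + 3) *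
          ‖weylInner (F i) (φ i) x ξ‖) := by ring
    _ ≤ 2 ^ (K + 3) * (C * symWeight K x ξ + D * symWeight K x ξ) :=
        mul_le_mul_of_nonneg_left (add_le_add hC' (hD i x ξ)) (by positivity)
    _ = _ := by unfold symWeight; ring

theorem norm_weylInner_le_inv (hF : UnifSym K F) (hφ : UnifSchwartz φ) :
    ∃ C : ℝ, 0 ≤ C ∧ ∀ i x ξ,
      ‖weylInner (F i) (φ i) x ξ‖ ≤ C * (1 + |x|) ^ K * (1 + ξ ^ 2)⁻¹ := by
  obtain ⟨C, hC0, hC⟩ := weylInner_decay hF hφ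
  refine ⟨C, hC0, fun i x ξ => le_trans ?_ (hC i x ξ)⟩
  exact le_mul_of_one_le_left (norm_nonneg _) (by linarith [abs_nonneg ξ])

theorem stronglyMeasurable_weylInner {a : ℝ → ℝ → ℂ} (ha : IsSmoothSymbol a) {φ : ℝ → ℂ}
    (hφ : Continuous φ) : StronglyMeasurable (fun p : ℝ × ℝ => weylInner a φ p.1 p.2) := by
  refine StronglyMeasurable.integral_prod_right (f := fun (p : ℝ × ℝ) y =>
    weylIntegrand a φ p.1 p.2 y) ?_
  exact (continuous_weylIntegrand ha hφ).stronglyMeasurable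

theorem aestronglyMeasurable_weylInner {a : ℝ → ℝ → ℂ} (ha : IsSmoothSymbol a) {φ : ℝ → ℂ}
    (hφ : Continuous φ) (x : ℝ) : AEStronglyMeasurable (weylInner a φ x) :=
  ((stronglyMeasurable_weylInner ha hφ).comp_measurable
    (measurable_prodMk_left (x := x))).aestronglyMeasurable

theorem integrable_weylInner (hF : UnifSym K F) (hφ : UnifSchwartz φ) (i : ι) (x : ℝ) :
    Integrable (weylInner (F i) (φ i) x) := by
  obtain ⟨C, hC0, hC⟩ := norm_weylInner_le_inv hF hφ
  refine (integrable_inv_one_add_sq.const_mul (C * (1 + |x|) ^ K)).mono'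
    (aestronglyMeasurable_weylInner (hF.smooth i) (hφ.continuous i) x) ?_
  filter_upwards with ξ using hC i x ξ

theorem norm_weylScalar_le (hF : UnifSym K F) (hφ : UnifSchwartz φ) :
    ∃ C : ℝ, 0 ≤ C ∧ ∀ i x, ‖weylScalar (F i) (φ i) x‖ ≤ C * (1 + |x|) ^ K := by
  obtain ⟨C, hC0, hC⟩ := norm_weylInner_le_inv hF hφ
  refine ⟨(2 * Real.pi)⁻¹ * (C * ∫ ξ : ℝ, (1 + ξ ^ 2)⁻¹), by positivity, fun i x => ?_⟩
  rw [weylScalar, norm_mul, Complex.norm_real, Real.norm_of_nonneg (by positivity), mul_assoc]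
  gcongr
  calc _ ≤ ∫ ξ : ℝ, C * (1 + |x|) ^ K * (1 + ξ ^ 2)⁻¹ :=
        norm_integral_le_of_norm_le (integrable_inv_one_add_sq.const_mul _)
          (by filter_upwards with ξ using hC i x ξ)
    _ = _ := by rw [integral_const_mul]; ring

theorem hasDerivAt_weylIntegrand_left {a : ℝ → ℝ → ℂ} (ha : IsSmoothSymbol a) (φ : ℝ → ℂ)
    (x ξ y : ℝ) :
    HasDerivAt (fun x => weylIntegrand a φ x ξ y)
      ((Complex.I * (ξ : ℂ)) * weylIntegrand a φ x ξ y +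
        (1 / 2 : ℂ) * weylIntegrand (symDx a) φ x ξ y) x := by
  have h1 := hasDerivAt_weylPhase (hasDerivAt_id x) (hasDerivAt_const x ξ) (hasDerivAt_const x y)
  have h2 := ha.hasDerivAt_comp (((hasDerivAt_id x).add_const y).div_const 2) (hasDerivAt_const x ξ)
  have h3 := h1.mul (h2.mul_const (φ y))
  refine h3.congr_deriv ?_
  simp only [weylIntegrand, id]
  push_cast
  ring

theorem hasDerivAt_weylIntegrand_mid {a : ℝ → ℝ → ℂ} (ha : IsSmoothSymbol a) (φ : ℝ → ℂ)
    (x ξ y : ℝ) :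
    HasDerivAt (fun ξ => weylIntegrand a φ x ξ y)
      (Complex.I * ((x : ℂ) * weylIntegrand a φ x ξ y -
        weylIntegrand a (fun y => (y : ℂ) * φ y) x ξ y) + weylIntegrand (symDxi a) φ x ξ y) ξ := by
  have h1 := hasDerivAt_weylPhase (hasDerivAt_const ξ x) (hasDerivAt_id ξ) (hasDerivAt_const ξ y)
  have h2 := ha.hasDerivAt_comp (hasDerivAt_const ξ ((x + y) / 2)) (hasDerivAt_id ξ)
  have h3 := h1.mul (h2.mul_const (φ y))
  refine h3.congr_deriv ?_
  simp only [weylIntegrand, id]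
  push_cast
  ring

theorem one_add_abs_le_of_mem_ball {x x₀ : ℝ} (h : x ∈ Metric.ball x₀ 1) :
    1 + |x| ≤ 2 + |x₀| := by
  rw [Metric.mem_ball, Real.dist_eq] at h
  have := abs_add_le (x - x₀) x₀
  rw [sub_add_cancel] at this
  linarith

theorem hasDerivAt_weylInner_left (hF : UnifSym K F) (hφ : UnifSchwartz φ) (i : ι) (x ξ : ℝ) :
    HasDerivAt (fun x => weylInner (F i) (φ i) x ξ)
      (weylInner (symDx (F i)) (φ i) x ξ + weylInner (F i) (deriv (φ i)) x ξ) x := by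
  obtain ⟨C, hC0, hC⟩ := norm_weylIntegrand_le hF hφ
  obtain ⟨D, hD0, hD⟩ := norm_weylIntegrand_le hF.dx hφ
  have i1 := (integrable_weylIntegrand hF hφ i x ξ).const_mul (Complex.I * (ξ : ℂ))
  have i2 := (integrable_weylIntegrand hF.dx hφ i x ξ).const_mul (1 / 2 : ℂ)
  have key := (hasDerivAt_integral_of_dominated_loc_of_deriv_le (μ := volume)
    (F := fun x y => weylIntegrand (F i) (φ i) x ξ y)
    (F' := fun x y => (Complex.I * (ξ : ℂ)) * weylIntegrand (F i) (φ i) x ξ y +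
        (1 / 2 : ℂ) * weylIntegrand (symDx (F i)) (φ i) x ξ y)
    (bound := fun y => ((|ξ| * C + D) * ((2 + |x|) ^ K * (1 + |ξ|) ^ K)) * (1 + y ^ 2)⁻¹)
    (Metric.ball_mem_nhds x one_pos)
    (Eventually.of_forall fun z => (integrable_weylIntegrand hF hφ i z ξ).aestronglyMeasurable)
    (integrable_weylIntegrand hF hφ i x ξ) (i1.add i2).aestronglyMeasurable
    (by
      filter_upwards with y z hz
      have hw : symWeight K z ξ ≤ (2 + |x|) ^ K * (1 + |ξ|) ^ K := by
        have := one_add_abs_le_of_mem_ball hz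
        unfold symWeight; gcongr
      refine (norm_add_le _ _).trans ?_
      rw [norm_mul, norm_mul, norm_mul, Complex.norm_I, one_mul, Complex.norm_real,
        Real.norm_eq_abs]
      calc _ ≤ |ξ| * (C * symWeight K z ξ * (1 + y ^ 2)⁻¹) +
            1 * (D * symWeight K z ξ * (1 + y ^ 2)⁻¹) := by
            gcongr
            exacts [hC i z ξ y, by norm_num, hD i z ξ y]
        _ = (|ξ| * C + D) * symWeight K z ξ * (1 + y ^ 2)⁻¹ := by ring
        _ ≤ _ := by gcongr)
    (integrable_inv_one_add_sq.const_mul _)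
    (by filter_upwards with y z _ using hasDerivAt_weylIntegrand_left (hF.smooth i) (φ i) z ξ y)).2
  refine key.congr_deriv ?_
  rw [integral_add i1 i2, integral_const_mul, integral_const_mul]
  -- The factor `iξ` from the phase is integrated by parts. It yields another half of `symDx`,
  -- completing the half from the midpoint to a full derivative.
  have := mul_weylInner hF hφ i x ξ
  simp only [weylInner] at this ⊢
  rw [mul_assoc, this]
  linear_combination (-(1 / 2 * (∫ y : ℝ, weylIntegrand (symDx (F i)) (φ i) x ξ y) +
    ∫ y : ℝ, weylIntegrand (F i) (deriv (φ i)) x ξ y)) * Complex.I_mul_I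

theorem hasDerivAt_weylInner_right (hF : UnifSym K F) (hφ : UnifSchwartz φ) (i : ι) (x ξ : ℝ) :
    HasDerivAt (weylInner (F i) (φ i) x)
      (Complex.I * ((x : ℂ) * weylInner (F i) (φ i) x ξ -
        weylInner (F i) (fun y => (y : ℂ) * φ i y) x ξ) + weylInner (symDxi (F i)) (φ i) x ξ) ξ := by
  obtain ⟨C, hC0, hC⟩ := norm_weylIntegrand_le hF hφ
  obtain ⟨D, hD0, hD⟩ := norm_weylIntegrand_le hF hφ.mul_id
  obtain ⟨E, hE0, hE⟩ := norm_weylIntegrand_le hF.dxi hφ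
  have i1 := (integrable_weylIntegrand hF hφ i x ξ).const_mul (x : ℂ)
  have i2 := integrable_weylIntegrand hF hφ.mul_id i x ξ
  have i3 := integrable_weylIntegrand hF.dxi hφ i x ξ
  have i4 := (i1.sub i2).const_mul Complex.I
  have key := (hasDerivAt_integral_of_dominated_loc_of_deriv_le (μ := volume)
    (F := fun ξ y => weylIntegrand (F i) (φ i) x ξ y)
    (F' := fun ξ y => Complex.I * ((x : ℂ) * weylIntegrand (F i) (φ i) x ξ y -
        weylIntegrand (F i) (fun y => (y : ℂ) * φ i y) x ξ y) +
        weylIntegrand (symDxi (F i)) (φ i) x ξ y)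
    (bound := fun y => ((|x| * C + D + E) * ((1 + |x|) ^ K * (2 + |ξ|) ^ K)) * (1 + y ^ 2)⁻¹)
    (Metric.ball_mem_nhds ξ one_pos)
    (Eventually.of_forall fun z => (integrable_weylIntegrand hF hφ i x z).aestronglyMeasurable)
    (integrable_weylIntegrand hF hφ i x ξ) (i4.add i3).aestronglyMeasurable
    (by
      filter_upwards with y z hz
      have hw : symWeight K x z ≤ (1 + |x|) ^ K * (2 + |ξ|) ^ K := by
        have := one_add_abs_le_of_mem_ball hz
        unfold symWeight; gcongr
      refine (norm_add_le _ _).trans ?_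
      rw [norm_mul, Complex.norm_I, one_mul]
      calc _ ≤ (|x| * (C * symWeight K x z * (1 + y ^ 2)⁻¹) +
            D * symWeight K x z * (1 + y ^ 2)⁻¹) + E * symWeight K x z * (1 + y ^ 2)⁻¹ := by
            gcongr
            · refine (norm_sub_le _ _).trans ?_
              rw [norm_mul, Complex.norm_real, Real.norm_eq_abs]
              gcongr
              exacts [hC i x z y, hD i x z y]
            · exact hE i x z y
        _ = (|x| * C + D + E) * symWeight K x z * (1 + y ^ 2)⁻¹ := by ring
        _ ≤ _ := by gcongr)
    (integrable_inv_one_add_sq.const_mul _)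
    (by filter_upwards with y z _ using hasDerivAt_weylIntegrand_mid (hF.smooth i) (φ i) x z y)).2
  refine key.congr_deriv ?_
  have e := integral_add i4 i3
  have e' := integral_sub i1 i2
  simp only [Pi.sub_apply] at e e'
  rw [e, integral_const_mul, e', integral_const_mul]
  rfl

/-- The commutator of the quantization with the derivative. -/
theorem hasDerivAt_weylScalar (hF : UnifSym K F) (hφ : UnifSchwartz φ) (i : ι) (x : ℝ) :
    HasDerivAt (weylScalar (F i) (φ i))
      (weylScalar (symDx (F i)) (φ i) x + weylScalar (F i) (deriv (φ i)) x) x := by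
  obtain ⟨C, hC0, hC⟩ := norm_weylInner_le_inv hF.dx hφ
  obtain ⟨D, hD0, hD⟩ := norm_weylInner_le_inv hF hφ.deriv
  have i1 := integrable_weylInner hF.dx hφ i x
  have i2 := integrable_weylInner hF hφ.deriv i x
  have key := (hasDerivAt_integral_of_dominated_loc_of_deriv_le (μ := volume)
    (F := fun x ξ => weylInner (F i) (φ i) x ξ)
    (F' := fun x ξ => weylInner (symDx (F i)) (φ i) x ξ + weylInner (F i) (deriv (φ i)) x ξ)
    (bound := fun ξ => ((C + D) * (2 + |x|) ^ K) * (1 + ξ ^ 2)⁻¹)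
    (Metric.ball_mem_nhds x one_pos)
    (Eventually.of_forall fun z => (integrable_weylInner hF hφ i z).aestronglyMeasurable)
    (integrable_weylInner hF hφ i x) (i1.add i2).aestronglyMeasurable
    (by
      filter_upwards with ξ z hz
      refine (norm_add_le _ _).trans ?_
      calc _ ≤ C * (1 + |z|) ^ K * (1 + ξ ^ 2)⁻¹ + D * (1 + |z|) ^ K * (1 + ξ ^ 2)⁻¹ :=
            add_le_add (hC i z ξ) (hD i z ξ)
        _ = (C + D) * (1 + |z|) ^ K * (1 + ξ ^ 2)⁻¹ := by ring
        _ ≤ _ := by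
          have := one_add_abs_le_of_mem_ball hz
          gcongr)
    (integrable_inv_one_add_sq.const_mul _)
    (by filter_upwards with ξ z _ using hasDerivAt_weylInner_left hF hφ i z ξ)).2
  refine (key.const_mul (((2 * Real.pi)⁻¹ : ℝ) : ℂ)).congr_deriv ?_
  rw [integral_add i1 i2, mul_add]
  rfl

/-- The commutator of the quantization with multiplication by the variable. -/
theorem mul_weylScalar (hF : UnifSym K F) (hφ : UnifSchwartz φ) (i : ι) (x : ℝ) :
    (x : ℂ) * weylScalar (F i) (φ i) x = weylScalar (F i) (fun y => (y : ℂ) * φ i y) x +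
      Complex.I * weylScalar (symDxi (F i)) (φ i) x := by
  have i0 := integrable_weylInner hF hφ i x
  have i1 := i0.const_mul (x : ℂ)
  have i2 := integrable_weylInner hF hφ.mul_id i x
  have i3 := integrable_weylInner hF.dxi hφ i x
  have i4 := (i1.sub i2).const_mul Complex.I
  -- The integral over `ξ` of a total `ξ`-derivative vanishes; written out, this is the commutator
  -- relation.
  have key := integral_eq_zero_of_hasDerivAt_of_integrable
    (hasDerivAt_weylInner_right hF hφ i x) (i4.add i3) i0
  have e := integral_add i4 i3
  have e' := integral_sub i1 i2
  simp only [Pi.sub_apply] at e e'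
  rw [e, integral_const_mul, e', integral_const_mul] at key
  simp only [weylScalar]
  linear_combination (-Complex.I * (((2 * Real.pi)⁻¹ : ℝ) : ℂ)) * key +
    (((2 * Real.pi)⁻¹ : ℝ) : ℂ) * ((x : ℂ) * (∫ ξ : ℝ, weylInner (F i) (φ i) x ξ) -
      ∫ ξ : ℝ, weylInner (F i) (fun y => (y : ℂ) * φ i y) x ξ) * Complex.I_mul_I

/-- Moving `x` through the operator costs a factor `y` on the function or a `ξ`-derivative of the
symbol, and both stay in the uniform classes. -/
theorem pow_mul_norm_weylScalar_le (hF : UnifSym K F) (hφ : UnifSchwartz φ) (p : ℕ) :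
    ∃ C : ℝ, 0 ≤ C ∧ ∀ i x, |x| ^ p * ‖weylScalar (F i) (φ i) x‖ ≤ C * (1 + |x|) ^ K := by
  induction p generalizing F φ with
  | zero => simpa using norm_weylScalar_le hF hφ
  | succ p ih =>
    obtain ⟨C, hC0, hC⟩ := ih hF hφ.mul_id
    obtain ⟨D, hD0, hD⟩ := ih hF.dxi hφ
    refine ⟨C + D, by positivity, fun i x => ?_⟩
    have e : ‖(x : ℂ) * weylScalar (F i) (φ i) x‖ ≤
        ‖weylScalar (F i) (fun y => (y : ℂ) * φ i y) x‖ + ‖weylScalar (symDxi (F i)) (φ i) x‖ := by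
      rw [mul_weylScalar hF hφ]
      refine (norm_add_le _ _).trans ?_
      rw [norm_mul, Complex.norm_I, one_mul]
    rw [norm_mul, Complex.norm_real, Real.norm_eq_abs] at e
    calc _ = |x| ^ p * (|x| * ‖weylScalar (F i) (φ i) x‖) := by ring
      _ ≤ |x| ^ p * (‖weylScalar (F i) (fun y => (y : ℂ) * φ i y) x‖ +
          ‖weylScalar (symDxi (F i)) (φ i) x‖) := by gcongr
      _ ≤ _ := by rw [mul_add, add_mul]; exact add_le_add (hC i x) (hD i x)

theorem pow_mul_norm_weylScalar_le_const (hF : UnifSym K F) (hφ : UnifSchwartz φ) (p : ℕ) :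
    ∃ C : ℝ, ∀ i x, |x| ^ p * ‖weylScalar (F i) (φ i) x‖ ≤ C := by
  obtain ⟨C, hC0, hC⟩ := pow_mul_norm_weylScalar_le hF hφ p
  -- The `K` extra powers beat the growth `(1 + |x|) ^ K` where `|x| ≥ 1`.
  obtain ⟨D, hD0, hD⟩ := pow_mul_norm_weylScalar_le hF hφ (p + K)
  refine ⟨2 ^ K * C + 2 ^ K * D, fun i x => ?_⟩
  rcases le_total |x| 1 with hx | hx
  · calc _ ≤ C * (1 + |x|) ^ K := hC i x
      _ ≤ C * 2 ^ K := by gcongr; linarith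
      _ ≤ _ := by nlinarith [show 0 ≤ 2 ^ K * D by positivity]
  · have h0 : 0 < |x| ^ K := by positivity
    have : |x| ^ p * ‖weylScalar (F i) (φ i) x‖ ≤ 2 ^ K * D := by
      refine le_of_mul_le_mul_left ?_ h0
      calc _ = |x| ^ (p + K) * ‖weylScalar (F i) (φ i) x‖ := by ring
        _ ≤ D * (1 + |x|) ^ K := hD i x
        _ ≤ D * (2 * |x|) ^ K := by gcongr; linarith
        _ = _ := by rw [mul_pow]; ring
    linarith [show 0 ≤ 2 ^ K * C by positivity]

theorem differentiable_weylScalar (hF : UnifSym K F) (hφ : UnifSchwartz φ) (i : ι) :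
    Differentiable ℝ (weylScalar (F i) (φ i)) :=
  fun x => (hasDerivAt_weylScalar hF hφ i x).differentiableAt

/-- By the commutator formula a derivative falls on the symbol or on the function, so derivatives of
all orders are finite sums of operators of the same kind. The index type doubles at each step. -/
theorem differentiable_iteratedDeriv_weylScalar (hF : UnifSym K F) (hφ : UnifSchwartz φ) (q : ℕ) :
    ∃ (α : Type) (_ : Fintype α) (G : α → ι → ℝ → ℝ → ℂ) (ψ : α → ι → ℝ → ℂ),
      (∀ m, UnifSym K (G m)) ∧ (∀ m, UnifSchwartz (ψ m)) ∧
      ∀ i x, iteratedDeriv q (weylScalar (F i) (φ i)) x = ∑ m, weylScalar (G m i) (ψ m i) x := by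
  induction q with
  | zero =>
    exact ⟨Unit, inferInstance, fun _ => F, fun _ => φ, fun _ => hF, fun _ => hφ, fun i x => by simp⟩
  | succ q ih =>
    obtain ⟨α, _, G, ψ, hG, hψ, h⟩ := ih
    refine ⟨α ⊕ α, inferInstance, Sum.elim (fun m i => symDx (G m i)) G,
      Sum.elim ψ (fun m i => deriv (ψ m i)), ?_, ?_, fun i x => ?_⟩
    · rintro (m | m)
      exacts [(hG m).dx, hG m]
    · rintro (m | m)
      exacts [hψ m, (hψ m).deriv]
    · have e : iteratedDeriv q (weylScalar (F i) (φ i)) =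
          fun x => ∑ m, weylScalar (G m i) (ψ m i) x := funext (h i)
      rw [iteratedDeriv_succ, e, Fintype.sum_sum_type]
      simp only [Sum.elim_inl, Sum.elim_inr]
      rw [← Finset.sum_add_distrib]
      exact (HasDerivAt.fun_sum fun m _ => hasDerivAt_weylScalar (hG m) (hψ m) i x).deriv

/-- Weyl quantization maps bounded families to bounded families. -/
theorem UnifSchwartz.weylScalar (hF : UnifSym K F) (hφ : UnifSchwartz φ) :
    UnifSchwartz (fun i => weylScalar (F i) (φ i)) := by
  refine ⟨fun i => contDiff_of_differentiable_iteratedDeriv fun q _ => ?_, fun p q => ?_⟩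
  · obtain ⟨α, _, G, ψ, hG, hψ, h⟩ := differentiable_iteratedDeriv_weylScalar hF hφ q
    have e := funext (h i)
    rw [e]
    exact Differentiable.fun_sum fun m _ => differentiable_weylScalar (hG m) (hψ m) i
  · obtain ⟨α, _, G, ψ, hG, hψ, h⟩ := differentiable_iteratedDeriv_weylScalar hF hφ q
    choose C hC using fun m => pow_mul_norm_weylScalar_le_const (hG m) (hψ m) p
    refine ⟨∑ m, C m, fun i x => ?_⟩
    rw [h]
    calc _ ≤ |x| ^ p * ∑ m, ‖_root_.weylScalar (G m i) (ψ m i) x‖ := by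
          gcongr; exact norm_sum_le _ _
      _ ≤ _ := by rw [Finset.mul_sum]; exact Finset.sum_le_sum fun m _ => hC m i x

end

/-! ### Algebra of the scalar quantization: linearity, commutation rules, Fourier inversion -/

noncomputable section

open MeasureTheory

variable {ι : Type*} {K : ℕ} {F G : ι → ℝ → ℝ → ℂ} {φ ψ : ι → ℝ → ℂ}

theorem weylScalar_add_symbol (hF : UnifSym K F) (hG : UnifSym K G) (hφ : UnifSchwartz φ) (i : ι)
    (x : ℝ) : weylScalar (fun x ξ => F i x ξ + G i x ξ) (φ i) x =
      weylScalar (F i) (φ i) x + weylScalar (G i) (φ i) x := by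
  have e : ∀ ξ, weylInner (fun x ξ => F i x ξ + G i x ξ) (φ i) x ξ =
      weylInner (F i) (φ i) x ξ + weylInner (G i) (φ i) x ξ := by
    intro ξ
    simp only [weylInner]
    rw [← integral_add (integrable_weylIntegrand hF hφ i x ξ) (integrable_weylIntegrand hG hφ i x ξ)]
    congr 1; funext y; simp only [weylIntegrand]; ring
  simp only [weylScalar, e]
  rw [integral_add (integrable_weylInner hF hφ i x) (integrable_weylInner hG hφ i x), mul_add]

theorem weylScalar_add_fun (hF : UnifSym K F) (hφ : UnifSchwartz φ) (hψ : UnifSchwartz ψ) (i : ι)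
    (x : ℝ) : weylScalar (F i) (fun y => φ i y + ψ i y) x =
      weylScalar (F i) (φ i) x + weylScalar (F i) (ψ i) x := by
  have e : ∀ ξ, weylInner (F i) (fun y => φ i y + ψ i y) x ξ =
      weylInner (F i) (φ i) x ξ + weylInner (F i) (ψ i) x ξ := by
    intro ξ
    simp only [weylInner]
    rw [← integral_add (integrable_weylIntegrand hF hφ i x ξ) (integrable_weylIntegrand hF hψ i x ξ)]
    congr 1; funext y; simp only [weylIntegrand]; ring
  simp only [weylScalar, e]
  rw [integral_add (integrable_weylInner hF hφ i x) (integrable_weylInner hF hψ i x), mul_add]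

theorem weylScalar_const_mul_symbol (c : ℂ) (a : ℝ → ℝ → ℂ) (φ : ℝ → ℂ) (x : ℝ) :
    weylScalar (fun x ξ => c * a x ξ) φ x = c * weylScalar a φ x := by
  have e : ∀ ξ, weylInner (fun x ξ => c * a x ξ) φ x ξ = c * weylInner a φ x ξ := by
    intro ξ
    simp only [weylInner]
    rw [← integral_const_mul]
    congr 1; funext y; simp only [weylIntegrand]; ring
  simp only [weylScalar, e, integral_const_mul]; ring

theorem weylScalar_const_mul_fun (c : ℂ) (a : ℝ → ℝ → ℂ) (φ : ℝ → ℂ) (x : ℝ) :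
    weylScalar a (fun y => c * φ y) x = c * weylScalar a φ x := by
  have e : ∀ ξ, weylInner a (fun y => c * φ y) x ξ = c * weylInner a φ x ξ := by
    intro ξ
    simp only [weylInner]
    rw [← integral_const_mul]
    congr 1; funext y; simp only [weylIntegrand]; ring
  simp only [weylScalar, e, integral_const_mul]; ring

theorem weylScalar_zero_symbol (φ : ℝ → ℂ) (x : ℝ) : weylScalar (fun _ _ => 0) φ x = 0 := by
  simpa using weylScalar_const_mul_symbol 0 (fun _ _ => 0) φ x

theorem weylScalar_zero_fun (a : ℝ → ℝ → ℂ) (x : ℝ) : weylScalar a (fun _ => 0) x = 0 := by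
  simpa using weylScalar_const_mul_fun 0 a (fun _ => 0) x

theorem weylScalar_sum_symbol {α : Type*} (s : Finset α) {f : α → ι → ℝ → ℝ → ℂ}
    (hf : ∀ b ∈ s, UnifSym K (f b)) (hφ : UnifSchwartz φ) (i : ι) (x : ℝ) :
    weylScalar (fun x ξ => ∑ b ∈ s, f b i x ξ) (φ i) x = ∑ b ∈ s, weylScalar (f b i) (φ i) x := by
  classical
  induction s using Finset.induction_on with
  | empty => simpa using weylScalar_zero_symbol (φ i) x
  | insert b s hb ih =>
    have hs : ∀ b ∈ s, UnifSym K (f b) := fun c hc => hf c (by simp [hc])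
    simp only [Finset.sum_insert hb]
    rw [← ih hs]
    exact weylScalar_add_symbol (F := f b) (hf b (by simp)) (UnifSym.sum s hs) hφ i x

theorem weylScalar_sum_fun {α : Type*} (s : Finset α) {f : α → ι → ℝ → ℂ} (hF : UnifSym K F)
    (hf : ∀ b ∈ s, UnifSchwartz (f b)) (i : ι) (x : ℝ) :
    weylScalar (F i) (fun y => ∑ b ∈ s, f b i y) x = ∑ b ∈ s, weylScalar (F i) (f b i) x := by
  classical
  induction s using Finset.induction_on with
  | empty => simpa using weylScalar_zero_fun (F i) x
  | insert b s hb ih =>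
    have hs : ∀ b ∈ s, UnifSchwartz (f b) := fun c hc => hf c (by simp [hc])
    simp only [Finset.sum_insert hb]
    rw [← ih hs]
    exact weylScalar_add_fun (φ := f b) hF (hf b (by simp)) (UnifSchwartz.sum s hs) i x

/-- The quantization of `x a`. -/
theorem weylScalar_mul_left (hF : UnifSym K F) (hφ : UnifSchwartz φ) (i : ι) (x : ℝ) :
    weylScalar (fun x ξ => (x : ℂ) * F i x ξ) (φ i) x =
      (1 / 2 : ℂ) * ((x : ℂ) * weylScalar (F i) (φ i) x +
        weylScalar (F i) (fun y => (y : ℂ) * φ i y) x) := by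
  have e : ∀ ξ, weylInner (fun x ξ => (x : ℂ) * F i x ξ) (φ i) x ξ =
      (1 / 2 : ℂ) * ((x : ℂ) * weylInner (F i) (φ i) x ξ +
        weylInner (F i) (fun y => (y : ℂ) * φ i y) x ξ) := by
    intro ξ
    simp only [weylInner]
    rw [← integral_const_mul, ← integral_add
      ((integrable_weylIntegrand hF hφ i x ξ).const_mul _)
      (integrable_weylIntegrand hF hφ.mul_id i x ξ), ← integral_const_mul]
    congr 1; funext y; simp only [weylIntegrand]; push_cast; ring
  simp only [weylScalar, e, integral_const_mul]
  rw [integral_add ((integrable_weylInner hF hφ i x).const_mul _)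
    (integrable_weylInner hF hφ.mul_id i x), integral_const_mul]
  ring

/-- The quantization of `ξ a`. -/
theorem weylScalar_mul_right (hF : UnifSym K F) (hφ : UnifSchwartz φ) (i : ι) (x : ℝ) :
    weylScalar (fun x ξ => (ξ : ℂ) * F i x ξ) (φ i) x =
      -Complex.I * ((1 / 2 : ℂ) * weylScalar (symDx (F i)) (φ i) x +
        weylScalar (F i) (deriv (φ i)) x) := by
  have e : ∀ ξ, weylInner (fun x ξ => (ξ : ℂ) * F i x ξ) (φ i) x ξ =
      -Complex.I * ((1 / 2 : ℂ) * weylInner (symDx (F i)) (φ i) x ξ +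
        weylInner (F i) (deriv (φ i)) x ξ) := by
    intro ξ
    rw [← mul_weylInner hF hφ]
    simp only [weylInner]
    rw [← integral_const_mul]
    congr 1; funext y; simp only [weylIntegrand]; ring
  simp only [weylScalar, e, integral_const_mul]
  rw [integral_add ((integrable_weylInner hF.dx hφ i x).const_mul _)
    (integrable_weylInner hF hφ.deriv i x), integral_const_mul]
  ring

/-- The quantization of the symbol `1` is the identity (Fourier inversion). -/
theorem weylScalar_one (hφ : UnifSchwartz φ) (i : ι) (x : ℝ) :
    weylScalar (fun _ _ => 1) (φ i) x = φ i x := by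
  have h1 : UnifSym 0 (fun (_ : ι) (_ _ : ℝ) => (1 : ℂ)) := UnifSym.one
  have hpi : (2 * Real.pi) ≠ 0 := by positivity
  -- For the symbol 1 the inner integral at `x = 0` is the Fourier transform up to the convention
  -- `e^{-2πi y ξ}`; rescaling the frequency by `2π` also accounts for the prefactor of
  -- `weylScalar`.
  have hF : ∀ ξ, FourierTransform.fourier (φ i) ξ =
      weylInner (fun _ _ => 1) (φ i) 0 (2 * Real.pi * ξ) := by
    intro ξ
    rw [Real.fourier_eq']
    simp only [weylInner, weylIntegrand, weylPhase, smul_eq_mul, one_mul]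
    congr 1; funext y; congr 2
    simp only [RCLike.inner_apply, conj_trivial]
    push_cast; ring
  have hG : ∀ ξ, Complex.exp (((2 * Real.pi * (ξ * x) : ℝ) : ℂ) * Complex.I) *
      FourierTransform.fourier (φ i) ξ = weylInner (fun _ _ => 1) (φ i) x (2 * Real.pi * ξ) := by
    intro ξ
    rw [hF]
    simp only [weylInner]
    rw [← integral_const_mul]
    congr 1; funext y
    simp only [weylIntegrand, weylPhase]
    rw [← mul_assoc, ← Complex.exp_add]
    congr 2; push_cast; ring
  have hint : Integrable (FourierTransform.fourier (φ i)) := by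
    have := (integrable_weylInner h1 hφ i 0).comp_mul_left' hpi
    exact this.congr (Eventually.of_forall fun ξ => (hF ξ).symm)
  have key := (hφ.integrable i).fourierInv_fourier_eq hint (v := x) (hφ.continuous i).continuousAt
  rw [Real.fourierInv_eq'] at key
  rw [← key, weylScalar]
  have e : (fun v : ℝ => Complex.exp (((2 * Real.pi * inner ℝ v x : ℝ) : ℂ) * Complex.I) •
      FourierTransform.fourier (φ i) v) =
      fun v => weylInner (fun _ _ => 1) (φ i) x (2 * Real.pi * v) := by
    funext v
    rw [← hG]
    simp only [RCLike.inner_apply, conj_trivial, smul_eq_mul]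
    rw [mul_comm x v]
  rw [e, Measure.integral_comp_mul_left (fun ξ => weylInner (fun _ _ => 1) (φ i) x ξ),
    abs_of_nonneg (by positivity)]
  rw [Complex.real_smul]

/-! ### Adjoints -/

theorem IsSmoothSymbol.conj {a : ℝ → ℝ → ℂ} (ha : IsSmoothSymbol a) :
    IsSmoothSymbol (fun x ξ => (starRingEnd ℂ) (a x ξ)) :=
  (Complex.conjCLE.toContinuousLinearMap.contDiff).comp ha

theorem symDx_conj {a : ℝ → ℝ → ℂ} (ha : IsSmoothSymbol a) :
    symDx (fun x ξ => (starRingEnd ℂ) (a x ξ)) = fun x ξ => (starRingEnd ℂ) (symDx a x ξ) := by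
  funext x ξ
  have h := ha.hasDerivAt_comp (hasDerivAt_id x) (hasDerivAt_const x ξ)
  have := (Complex.conjCLE.toContinuousLinearMap.hasFDerivAt.comp_hasDerivAt x h).deriv
  simpa [symDx, Function.comp_def] using this

theorem symDxi_conj {a : ℝ → ℝ → ℂ} (ha : IsSmoothSymbol a) :
    symDxi (fun x ξ => (starRingEnd ℂ) (a x ξ)) = fun x ξ => (starRingEnd ℂ) (symDxi a x ξ) := by
  funext x ξ
  have h := ha.hasDerivAt_comp (hasDerivAt_const ξ x) (hasDerivAt_id ξ)
  have := (Complex.conjCLE.toContinuousLinearMap.hasFDerivAt.comp_hasDerivAt ξ h).deriv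
  simpa [symDxi, Function.comp_def] using this

theorem mixedDeriv_conj {a : ℝ → ℝ → ℂ} (ha : IsSmoothSymbol a) (j k : ℕ) :
    mixedDeriv j k (fun x ξ => (starRingEnd ℂ) (a x ξ)) =
      fun x ξ => (starRingEnd ℂ) (mixedDeriv j k a x ξ) := by
  induction j with
  | zero =>
    induction k generalizing a with
    | zero => simp [mixedDeriv_zero_zero]
    | succ k ih => rw [mixedDeriv_succ_right, mixedDeriv_succ_right, symDx_conj ha, ih ha.dx]
  | succ j ih => rw [mixedDeriv_succ_left, mixedDeriv_succ_left, ih, symDxi_conj (ha.mixedDeriv j k)]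

theorem UnifSym.conj (h : UnifSym K F) : UnifSym K (fun i x ξ => (starRingEnd ℂ) (F i x ξ)) :=
  ⟨fun i => (h.smooth i).conj, fun j k => (h.bound j k).imp fun C hC i x ξ => by
    rw [mixedDeriv_conj (h.smooth i), RCLike.norm_conj]; exact hC i x ξ⟩

theorem UnifSchwartz.conj (h : UnifSchwartz φ) :
    UnifSchwartz (fun i x => (starRingEnd ℂ) (φ i x)) :=
  h.clm (L := fun _ => Complex.conjCLE.toContinuousLinearMap) (fun _ => le_rfl)

/-- The midpoint is symmetric in `x` and `y`, and conjugation of the phase exchanges them. This is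
why Weyl quantization respects adjoints without lower order corrections. -/
theorem weylIntegrand_conj (a : ℝ → ℝ → ℂ) (φ ψ : ℝ → ℂ) (x ξ y : ℝ) :
    (starRingEnd ℂ) (φ x) * weylIntegrand a ψ x ξ y =
      (starRingEnd ℂ) (weylIntegrand (fun x ξ => (starRingEnd ℂ) (a x ξ)) φ y ξ x) * ψ y := by
  simp only [weylIntegrand, map_mul, Complex.conj_conj]
  have : (starRingEnd ℂ) (weylPhase y ξ x) = weylPhase x ξ y := by
    rw [weylPhase, weylPhase, ← Complex.exp_conj, map_mul, Complex.conj_I, Complex.conj_ofReal]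
    congr 1; push_cast; ring
  rw [this, add_comm y x]; ring

theorem integrable_mul_weylInner (hF : UnifSym K F) (hφ : UnifSchwartz φ) (hψ : UnifSchwartz ψ)
    (i : ι) : Integrable (fun p : ℝ × ℝ => φ i p.1 * weylInner (F i) (ψ i) p.1 p.2)
      (volume.prod volume) := by
  obtain ⟨C, hC0, hC⟩ := norm_weylInner_le_inv hF hψ
  obtain ⟨D, hD0, hD⟩ := hφ.decay K
  refine ((integrable_inv_one_add_sq.mul_prod integrable_inv_one_add_sq).const_mul (C * D)).mono'
    ?_ (Eventually.of_forall fun p => ?_)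
  · exact (((hφ.continuous i).comp continuous_fst).stronglyMeasurable.mul
      (stronglyMeasurable_weylInner (hF.smooth i) (hψ.continuous i))).aestronglyMeasurable
  · rw [norm_mul]
    calc _ ≤ ‖φ i p.1‖ * (C * (1 + |p.1|) ^ K * (1 + p.2 ^ 2)⁻¹) := by gcongr; exact hC i _ _
      _ = C * ((1 + |p.1|) ^ K * ‖φ i p.1‖) * (1 + p.2 ^ 2)⁻¹ := by ring
      _ ≤ C * (D * (1 + p.1 ^ 2)⁻¹) * (1 + p.2 ^ 2)⁻¹ :=
        mul_le_mul_of_nonneg_right (mul_le_mul_of_nonneg_left (hD i _) hC0) (by positivity)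
      _ = _ := by ring

theorem integrable_mul_weylIntegrand (hF : UnifSym K F) (hφ : UnifSchwartz φ)
    (hψ : UnifSchwartz ψ) (i : ι) (ξ : ℝ) :
    Integrable (fun p : ℝ × ℝ => φ i p.1 * weylIntegrand (F i) (ψ i) p.1 ξ p.2)
      (volume.prod volume) := by
  obtain ⟨C, hC0, hC⟩ := norm_weylIntegrand_le hF hψ
  obtain ⟨D, hD0, hD⟩ := hφ.decay K
  refine ((integrable_inv_one_add_sq.mul_prod integrable_inv_one_add_sq).const_mul
    (C * D * (1 + |ξ|) ^ K)).mono' ?_ (Eventually.of_forall fun p => ?_)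
  · refine (((hφ.continuous i).comp continuous_fst).mul
      ((continuous_weylIntegrand (hF.smooth i) (hψ.continuous i)).comp
        (f := fun p : ℝ × ℝ => ((p.1, ξ), p.2)) (by fun_prop))).aestronglyMeasurable
  · rw [norm_mul]
    calc _ ≤ ‖φ i p.1‖ * (C * symWeight K p.1 ξ * (1 + p.2 ^ 2)⁻¹) := by gcongr; exact hC i _ _ _
      _ = C * (1 + |ξ|) ^ K * ((1 + |p.1|) ^ K * ‖φ i p.1‖) * (1 + p.2 ^ 2)⁻¹ := by
        unfold symWeight; ring
      _ ≤ C * (1 + |ξ|) ^ K * (D * (1 + p.1 ^ 2)⁻¹) * (1 + p.2 ^ 2)⁻¹ :=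
        mul_le_mul_of_nonneg_right (mul_le_mul_of_nonneg_left (hD i _) (by positivity))
          (by positivity)
      _ = _ := by ring

/-- The formal adjoint of the quantization of `a` is the quantization of `conj a`. -/
theorem integral_conj_mul_weylScalar (hF : UnifSym K F) (hφ : UnifSchwartz φ)
    (hψ : UnifSchwartz ψ) (i : ι) :
    ∫ x : ℝ, (starRingEnd ℂ) (φ i x) * weylScalar (F i) (ψ i) x =
      ∫ x : ℝ, (starRingEnd ℂ) (weylScalar (fun x ξ => (starRingEnd ℂ) (F i x ξ)) (φ i) x) *
        ψ i x := by
  set c : ℂ := (((2 * Real.pi)⁻¹ : ℝ) : ℂ) with hc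
  have hL := integrable_mul_weylInner hF hφ.conj hψ i
  have hR := (integrable_mul_weylInner hF.conj hψ.conj hφ i)
  have hR' : Integrable (fun p : ℝ × ℝ => (starRingEnd ℂ)
      (weylInner (fun x ξ => (starRingEnd ℂ) (F i x ξ)) (φ i) p.1 p.2) * ψ i p.1)
      (volume.prod volume) := by
    have := (Complex.conjCLE.toContinuousLinearMap).integrable_comp hR
    refine this.congr (Eventually.of_forall fun p => ?_)
    simp [mul_comm]
  have e1 : ∀ x, (starRingEnd ℂ) (φ i x) * weylScalar (F i) (ψ i) x =
      c * ∫ ξ : ℝ, (starRingEnd ℂ) (φ i x) * weylInner (F i) (ψ i) x ξ := fun x => by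
    rw [integral_const_mul, weylScalar]; ring
  have e2 : ∀ x, (starRingEnd ℂ) (weylScalar (fun x ξ => (starRingEnd ℂ) (F i x ξ)) (φ i) x) *
        ψ i x = c * ∫ ξ : ℝ, (starRingEnd ℂ)
      (weylInner (fun x ξ => (starRingEnd ℂ) (F i x ξ)) (φ i) x ξ) * ψ i x := fun x => by
    rw [integral_mul_const, weylScalar, map_mul, ← integral_conj, hc, Complex.conj_ofReal]; ring
  simp only [e1, e2]
  rw [integral_const_mul c, integral_const_mul c]
  -- The triple integral need not converge absolutely, so Fubini is used in stages: `ξ` is pulled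
  -- outermost thanks to the decay of the inner integral, then `x` and `y` are exchanged for fixed
  -- `ξ`.
  have s1 := integral_integral_swap (f := fun x ξ =>
    (starRingEnd ℂ) (φ i x) * weylInner (F i) (ψ i) x ξ) hL
  have s2 := integral_integral_swap (f := fun x ξ => (starRingEnd ℂ)
      (weylInner (fun x ξ => (starRingEnd ℂ) (F i x ξ)) (φ i) x ξ) * ψ i x) hR'
  rw [s1, s2]
  congr 2
  funext ξ
  have e3 : ∀ x, (starRingEnd ℂ) (φ i x) * weylInner (F i) (ψ i) x ξ =
      ∫ y : ℝ, (starRingEnd ℂ) (φ i x) * weylIntegrand (F i) (ψ i) x ξ y := fun x => by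
    rw [integral_const_mul, weylInner]
  have e4 : ∀ y, (starRingEnd ℂ) (weylInner (fun x ξ => (starRingEnd ℂ) (F i x ξ)) (φ i) y ξ) *
      ψ i y = ∫ x : ℝ, (starRingEnd ℂ) (φ i x) * weylIntegrand (F i) (ψ i) x ξ y := fun y => by
    simp only [weylIntegrand_conj]
    rw [integral_mul_const, integral_conj, weylInner]
  simp only [e3, e4]
  exact integral_integral_swap (integrable_mul_weylIntegrand hF hφ.conj hψ i ξ)

/-- Translation covariance. -/
theorem weylScalar_comp_add (a : ℝ → ℝ → ℂ) (φ : ℝ → ℂ) (c x : ℝ) :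
    weylScalar a (fun y => φ (y + c)) x = weylScalar (fun x ξ => a (x - c) ξ) φ (x + c) := by
  simp only [weylScalar, weylInner]
  congr 2; funext ξ
  rw [← integral_add_right_eq_self (fun y => weylIntegrand (fun x ξ => a (x - c) ξ) φ (x + c) ξ y) c]
  congr 1; funext y
  simp only [weylIntegrand, weylPhase]
  congr 2
  · congr 3; ring
  · congr 1; ring

end

noncomputable section

open MeasureTheory

/-! ### Taylor expansion of rescaled symbols -/

theorem symDx_mixedDeriv {a : ℝ → ℝ → ℂ} (ha : IsSmoothSymbol a) (j k : ℕ) :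
    symDx (mixedDeriv j k a) = mixedDeriv j (k + 1) a := by
  induction k generalizing a with
  | zero =>
    induction j generalizing a with
    | zero => rw [mixedDeriv_succ_right, mixedDeriv_zero_zero, mixedDeriv_zero_zero]
    | succ j ih => rw [mixedDeriv_succ_left' _ _ ha, ih ha.dxi, ← mixedDeriv_succ_left' _ _ ha]
  | succ k ih => rw [mixedDeriv_succ_right, ih ha.dx, ← mixedDeriv_succ_right]

theorem mixedDeriv_mixedDeriv {a : ℝ → ℝ → ℂ} (ha : IsSmoothSymbol a) (j k j' k' : ℕ) :
    mixedDeriv j' k' (mixedDeriv j k a) = mixedDeriv (j' + j) (k' + k) a := by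
  induction j' with
  | zero =>
    rw [zero_add]
    induction k' generalizing k with
    | zero => rw [mixedDeriv_zero_zero, zero_add]
    | succ k' ih =>
      rw [mixedDeriv_succ_right, symDx_mixedDeriv ha, ih, show k' + (k + 1) = k' + 1 + k by ring]
  | succ j' ih =>
    rw [mixedDeriv_succ_left, ih, ← mixedDeriv_succ_left, show j' + j + 1 = j' + 1 + j by ring]

theorem symWeight_le_of_abs_le {K : ℕ} {x ξ x' ξ' : ℝ} (hx : |x'| ≤ |x|) (hξ : |ξ'| ≤ |ξ|) :
    symWeight K x' ξ' ≤ symWeight K x ξ := by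
  unfold symWeight; gcongr

/-- Taylor's estimate by induction on the order of vanishing: both partial derivatives vanish to one
order less, and the mean value inequality on the segment from the origin gains `|x| + |ξ|`. The
weight increases along that segment. -/
theorem norm_le_of_mixedDeriv_eq_zero (K N : ℕ) {C : ℝ} (hC0 : 0 ≤ C) {a : ℝ → ℝ → ℂ}
    (ha : IsSmoothSymbol a) (h0 : ∀ j k, j + k < N → mixedDeriv j k a 0 0 = 0)
    (hN : ∀ j k, j + k = N → ∀ x ξ, ‖mixedDeriv j k a x ξ‖ ≤ C * symWeight K x ξ) (x ξ : ℝ) :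
    ‖a x ξ‖ ≤ C * (|x| + |ξ|) ^ N * symWeight K x ξ := by
  induction N generalizing a x ξ with
  | zero => simpa [mixedDeriv_zero_zero] using hN 0 0 rfl x ξ
  | succ N ih =>
    have h1 := ih ha.dx (fun j k hjk => by
        rw [← mixedDeriv_succ_right]; exact h0 _ _ (by omega))
      (fun j k hjk => by rw [← mixedDeriv_succ_right]; exact hN _ _ (by omega))
    have h2 := ih ha.dxi (fun j k hjk => by
        rw [← mixedDeriv_succ_left' _ _ ha]; exact h0 _ _ (by omega))
      (fun j k hjk => by rw [← mixedDeriv_succ_left' _ _ ha]; exact hN _ _ (by omega))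
    have hz : a 0 0 = 0 := by simpa [mixedDeriv_zero_zero] using h0 0 0 (by omega)
    have hd : ∀ t : ℝ, HasDerivAt (fun t => a (t * x) (t * ξ))
        ((x : ℂ) * symDx a (t * x) (t * ξ) + (ξ : ℂ) * symDxi a (t * x) (t * ξ)) t := fun t => by
      simpa using ha.hasDerivAt_comp ((hasDerivAt_id t).mul_const x) ((hasDerivAt_id t).mul_const ξ)
    have key := norm_image_sub_le_of_norm_deriv_le_segment_01'
      (f := fun t => a (t * x) (t * ξ)) (C := C * (|x| + |ξ|) ^ (N + 1) * symWeight K x ξ)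
      (fun t _ => (hd t).hasDerivWithinAt) (fun t ht => by
        have ht' : ∀ z : ℝ, |t * z| ≤ |z| := fun z => by
          rw [abs_mul, abs_of_nonneg ht.1]
          exact mul_le_of_le_one_left (abs_nonneg z) ht.2.le
        have hb : C * (|t * x| + |t * ξ|) ^ N * symWeight K (t * x) (t * ξ) ≤
            C * (|x| + |ξ|) ^ N * symWeight K x ξ :=
          mul_le_mul (mul_le_mul_of_nonneg_left (pow_le_pow_left₀ (by positivity)
            (add_le_add (ht' x) (ht' ξ)) N) hC0) (symWeight_le_of_abs_le (ht' x) (ht' ξ))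
            (symWeight_nonneg _ _ _) (by positivity)
        refine (norm_add_le _ _).trans ?_
        rw [norm_mul, norm_mul, Complex.norm_real, Complex.norm_real, Real.norm_eq_abs,
          Real.norm_eq_abs]
        calc _ ≤ |x| * (C * (|x| + |ξ|) ^ N * symWeight K x ξ) +
              |ξ| * (C * (|x| + |ξ|) ^ N * symWeight K x ξ) := by
              gcongr
              exacts [(h1 _ _).trans hb, (h2 _ _).trans hb]
          _ = _ := by ring)
    simpa [hz] using key

/-- The monomial `c x^k ξ^j`. -/
def monoSym (j k : ℕ) (x ξ : ℝ) : ℂ := (x : ℂ) ^ k * (ξ : ℂ) ^ j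

theorem iteratedDeriv_ofReal_pow (m k : ℕ) (x : ℝ) :
    iteratedDeriv k (fun x : ℝ => (x : ℂ) ^ m) x = (m.descFactorial k : ℂ) * (x : ℂ) ^ (m - k) := by
  induction k generalizing x with
  | zero => simp
  | succ k ih =>
    have hd : HasDerivAt (fun x : ℝ => (m.descFactorial k : ℂ) * (x : ℂ) ^ (m - k))
        ((m.descFactorial k : ℂ) * (((m - k : ℕ) : ℂ) * (x : ℂ) ^ (m - k - 1))) x := by
      have := ((hasDerivAt_pow (m - k) (x : ℂ)).comp_ofReal).const_mul (m.descFactorial k : ℂ)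
      exact this
    rw [iteratedDeriv_succ, show iteratedDeriv k (fun x : ℝ => (x : ℂ) ^ m) = _ from funext ih,
      hd.deriv, Nat.descFactorial_succ, Nat.sub_sub]
    push_cast; ring

theorem isSmoothSymbol_monoSym (j k : ℕ) : IsSmoothSymbol (monoSym j k) := by
  unfold IsSmoothSymbol monoSym
  have h : ContDiff ℝ ((⊤ : ℕ∞) : WithTop ℕ∞) (fun x : ℝ => (x : ℂ)) := Complex.ofRealCLM.contDiff
  exact ((h.comp contDiff_fst).pow k).mul ((h.comp contDiff_snd).pow j)

theorem mixedDeriv_monoSym (n m j k : ℕ) (x ξ : ℝ) :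
    mixedDeriv j k (monoSym n m) x ξ =
      (m.descFactorial k : ℂ) * (x : ℂ) ^ (m - k) *
        ((n.descFactorial j : ℂ) * (ξ : ℂ) ^ (n - j)) := by
  have h : ∀ m : ℕ, ContDiff ℝ k (fun x : ℝ => (x : ℂ) ^ m) := fun m =>
    (Complex.ofRealCLM.contDiff).pow m
  have h' : ∀ m : ℕ, ContDiff ℝ j (fun x : ℝ => (x : ℂ) ^ m) := fun m =>
    (Complex.ofRealCLM.contDiff).pow m
  have e : ∀ ζ : ℝ, iteratedDeriv k (fun z => monoSym n m z ζ) x =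
      ((m.descFactorial k : ℂ) * (x : ℂ) ^ (m - k)) * (ζ : ℂ) ^ n := by
    intro ζ
    have : (fun z => monoSym n m z ζ) = fun z : ℝ => (ζ : ℂ) ^ n * (z : ℂ) ^ m := by
      funext z; simp [monoSym, mul_comm]
    rw [this, iteratedDeriv_const_mul _ (h m).contDiffAt, iteratedDeriv_ofReal_pow, mul_comm]
  simp only [mixedDeriv, e]
  rw [iteratedDeriv_const_mul _ (h' n).contDiffAt, iteratedDeriv_ofReal_pow]

theorem mixedDeriv_monoSym_zero (n m j k : ℕ) :
    mixedDeriv j k (monoSym n m) 0 0 = if n = j ∧ m = k then (k.factorial * j.factorial : ℂ) else 0 := by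
  have : ∀ m k : ℕ, (m.descFactorial k : ℂ) * ((0 : ℝ) : ℂ) ^ (m - k) =
      if m = k then (k.factorial : ℂ) else 0 := by
    intro m k
    rcases lt_trichotomy m k with h | h | h
    · rw [Nat.descFactorial_of_lt h, if_neg h.ne]; simp
    · subst h; simp [Nat.descFactorial_self]
    · rw [if_neg h.ne', Complex.ofReal_zero, zero_pow (by omega), mul_zero]
  rw [mixedDeriv_monoSym, this, this]
  by_cases h1 : m = k <;> by_cases h2 : n = j <;> simp [h1, h2]

theorem unifSym_monoSym {ι : Type*} {K n m : ℕ} (hn : n ≤ K) (hm : m ≤ K) :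
    UnifSym K (fun _ : ι => monoSym n m) := by
  refine ⟨fun _ => isSmoothSymbol_monoSym n m, fun j k => ?_⟩
  refine ⟨m.descFactorial k * n.descFactorial j, fun _ x ξ => ?_⟩
  rw [mixedDeriv_monoSym]
  simp only [norm_mul, norm_pow, Complex.norm_natCast, Complex.norm_real, Real.norm_eq_abs]
  have key : ∀ {n j : ℕ} (x : ℝ), n ≤ K → |x| ^ (n - j) ≤ (1 + |x|) ^ K := fun {n j} x hn =>
    calc |x| ^ (n - j) ≤ (1 + |x|) ^ (n - j) := by gcongr; linarith
      _ ≤ _ := pow_le_pow_right₀ (by linarith [abs_nonneg x]) (by omega)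
  calc _ ≤ (m.descFactorial k : ℝ) * (1 + |x|) ^ K * (n.descFactorial j * (1 + |ξ|) ^ K) := by
        gcongr
        exacts [key x hm, key ξ hn]
    _ = _ := by unfold symWeight; ring

theorem mixedDeriv_sum {α : Type*} (s : Finset α) {f : α → ℝ → ℝ → ℂ}
    (hf : ∀ b ∈ s, IsSmoothSymbol (f b)) (j k : ℕ) (x ξ : ℝ) :
    mixedDeriv j k (fun x ξ => ∑ b ∈ s, f b x ξ) x ξ = ∑ b ∈ s, mixedDeriv j k (f b) x ξ := by
  classical
  induction s using Finset.induction_on with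
  | empty => simp [mixedDeriv]
  | insert b s hb ih =>
    have hs : ∀ b ∈ s, IsSmoothSymbol (f b) := fun c hc => hf c (by simp [hc])
    have hsm : IsSmoothSymbol (fun x ξ => ∑ b ∈ s, f b x ξ) := by
      unfold IsSmoothSymbol; exact ContDiff.sum hs
    simp only [Finset.sum_insert hb]
    rw [mixedDeriv_fun_add (hf b (by simp)) hsm, ← ih hs]

/-- The homogeneous part of degree `i` of the Taylor expansion at `(0, ξ₀)`. -/
def taylorHom (a : ℝ → ℝ → ℂ) (ξ₀ : ℝ) (i : ℕ) (y η : ℝ) : ℂ :=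
  ∑ q ∈ Finset.HasAntidiagonal.antidiagonal i,
    (mixedDeriv q.1 q.2 a 0 ξ₀ / (q.2.factorial * q.1.factorial)) * monoSym q.1 q.2 y η

theorem isSmoothSymbol_taylorHom (a : ℝ → ℝ → ℂ) (ξ₀ : ℝ) (i : ℕ) :
    IsSmoothSymbol (taylorHom a ξ₀ i) := by
  unfold IsSmoothSymbol taylorHom
  exact ContDiff.sum fun q _ => contDiff_const.mul (isSmoothSymbol_monoSym q.1 q.2)

theorem unifSym_taylorHom {ι : Type*} (a : ℝ → ℝ → ℂ) (ξ₀ : ℝ) {i K : ℕ} (hi : i ≤ K) :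
    UnifSym K (fun _ : ι => taylorHom a ξ₀ i) := by
  have h : ∀ q ∈ Finset.HasAntidiagonal.antidiagonal i, UnifSym K
      ((fun (q : ℕ × ℕ) (_ : ι) (y η : ℝ) => (mixedDeriv q.1 q.2 a 0 ξ₀ /
        (q.2.factorial * q.1.factorial)) * monoSym q.1 q.2 y η) q) := fun q hq => by
    have := Finset.HasAntidiagonal.mem_antidiagonal.1 hq
    exact (unifSym_monoSym (n := q.1) (m := q.2) (by omega) (by omega)).const_mul
      (c := fun _ => mixedDeriv q.1 q.2 a 0 ξ₀ / (q.2.factorial * q.1.factorial)) (fun _ => le_rfl)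
  exact UnifSym.sum _ h

theorem taylorHom_smul (a : ℝ → ℝ → ℂ) (ξ₀ : ℝ) (i : ℕ) (t y η : ℝ) :
    taylorHom a ξ₀ i (t * y) (t * η) = (t : ℂ) ^ i * taylorHom a ξ₀ i y η := by
  unfold taylorHom
  rw [Finset.mul_sum]
  refine Finset.sum_congr rfl fun q hq => ?_
  rw [← Finset.HasAntidiagonal.mem_antidiagonal.1 hq, monoSym, monoSym]
  push_cast; ring

theorem mixedDeriv_taylorHom (a : ℝ → ℝ → ℂ) (ξ₀ : ℝ) (i j k : ℕ) (x ξ : ℝ) :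
    mixedDeriv j k (taylorHom a ξ₀ i) x ξ = ∑ q ∈ Finset.HasAntidiagonal.antidiagonal i,
    (mixedDeriv q.1 q.2 a 0 ξ₀ / (q.2.factorial * q.1.factorial)) *
      mixedDeriv j k (monoSym q.1 q.2) x ξ := by
  unfold taylorHom
  have h : ∀ q ∈ Finset.HasAntidiagonal.antidiagonal i, IsSmoothSymbol
      ((fun (q : ℕ × ℕ) (y η : ℝ) => (mixedDeriv q.1 q.2 a 0 ξ₀ /
        (q.2.factorial * q.1.factorial)) * monoSym q.1 q.2 y η) q) := fun q _ =>
    contDiff_const.mul (isSmoothSymbol_monoSym q.1 q.2)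
  rw [mixedDeriv_sum _ h]
  refine Finset.sum_congr rfl fun q _ => ?_
  rw [mixedDeriv_const_mul (isSmoothSymbol_monoSym _ _)]

/-- The monomials are dual to the derivatives at the origin. Hence subtracting the parts of degree
less than `N` kills all derivatives of order less than `N` there and alters no others. -/
theorem mixedDeriv_taylorHom_zero (a : ℝ → ℝ → ℂ) (ξ₀ : ℝ) (i j k : ℕ) :
    mixedDeriv j k (taylorHom a ξ₀ i) 0 0 = if j + k = i then mixedDeriv j k a 0 ξ₀ else 0 := by
  rw [mixedDeriv_taylorHom]
  simp only [mixedDeriv_monoSym_zero]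
  split_ifs with h
  · rw [Finset.sum_eq_single (j, k)]
    · have h1 : (k.factorial : ℂ) ≠ 0 := by exact_mod_cast k.factorial_ne_zero
      have h2 : (j.factorial : ℂ) ≠ 0 := by exact_mod_cast j.factorial_ne_zero
      simp only [and_self, if_true]
      field_simp
    · rintro ⟨n, m⟩ _ hne
      rw [if_neg, mul_zero]
      rintro ⟨rfl, rfl⟩; exact hne rfl
    · intro hn; exact absurd (Finset.HasAntidiagonal.mem_antidiagonal.2 h) hn
  · refine Finset.sum_eq_zero fun q hq => ?_
    have := Finset.HasAntidiagonal.mem_antidiagonal.1 hq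
    rw [if_neg, mul_zero]
    rintro ⟨h1, h2⟩; omega

theorem mixedDeriv_taylorHom_of_lt (a : ℝ → ℝ → ℂ) (ξ₀ : ℝ) {i j k : ℕ} (h : i < j + k) (x ξ : ℝ) :
    mixedDeriv j k (taylorHom a ξ₀ i) x ξ = 0 := by
  rw [mixedDeriv_taylorHom]
  refine Finset.sum_eq_zero fun q hq => ?_
  have := Finset.HasAntidiagonal.mem_antidiagonal.1 hq
  rw [mixedDeriv_monoSym]
  rcases lt_or_ge q.2 k with h1 | h1
  · rw [Nat.descFactorial_of_lt h1]; simp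
  · rw [Nat.descFactorial_of_lt (show q.1 < j by omega)]; simp

/-! ### Rescaling by `√h` and uniform Taylor remainders -/

/-- The index set of the semiclassical parameter. -/
abbrev HIdx : Type := Set.Ioo (0 : ℝ) 1

theorem HIdx.sqrt_pos (h : HIdx) : 0 < Real.sqrt h := Real.sqrt_pos.2 h.2.1

theorem HIdx.sqrt_le_one (h : HIdx) : Real.sqrt h ≤ 1 := Real.sqrt_le_one.2 h.2.2.le

theorem HIdx.abs_sqrt_le_one (h : HIdx) : |Real.sqrt h| ≤ 1 := by
  rw [abs_of_pos h.sqrt_pos]; exact h.sqrt_le_one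

/-- The rescaling `a(√h y, √h η + ξ₀)`. -/
def rescale (ξ₀ : ℝ) (a : ℝ → ℝ → ℂ) (h : ℝ) (y η : ℝ) : ℂ :=
  a (Real.sqrt h * y) (Real.sqrt h * η + ξ₀)

theorem UnifSym.rescale {K : ℕ} {F : HIdx → ℝ → ℝ → ℂ} (hF : UnifSym K F) (ξ₀ : ℝ) :
    UnifSym K (fun h => rescale ξ₀ (F h) h) := by
  have := hF.comp_affine (α := fun h => Real.sqrt h) (β := fun h => Real.sqrt h)
    (α' := fun _ => 0) (β' := fun _ => ξ₀) (A := |ξ₀|) HIdx.abs_sqrt_le_one HIdx.abs_sqrt_le_one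
    (by simp) (by simp)
  simp only [add_zero] at this
  exact this

/-- Taylor expansion of a rescaled symbol, with a remainder that is bounded as a symbol. -/
theorem unifSym_taylor_remainder {K : ℕ} {a : ℝ → ℝ → ℂ} (ha : UnifSym K (fun _ : Unit => a))
    (ξ₀ : ℝ) (N : ℕ) :
    UnifSym (K + N) (fun (h : HIdx) y η => (((Real.sqrt h) ^ N)⁻¹ : ℂ) *
      (rescale ξ₀ a h y η - ∑ i ∈ Finset.range N, (Real.sqrt h : ℂ) ^ i * taylorHom a ξ₀ i y η)) := by
  have hs : IsSmoothSymbol a := ha.smooth ()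
  have hb := ha.comp_affine (α := fun _ => 1) (β := fun _ => 1) (α' := fun _ => 0)
    (β' := fun _ => ξ₀) (A := |ξ₀|) (by simp) (by simp) (by simp) (by simp)
  simp only [one_mul, add_zero] at hb
  set b : ℝ → ℝ → ℂ := fun x ξ => a x (ξ + ξ₀) with hbdef
  have hbs : IsSmoothSymbol b := hb.smooth ()
  have hbd : ∀ j k, mixedDeriv j k b 0 0 = mixedDeriv j k a 0 ξ₀ := by
    intro j k
    have := mixedDeriv_comp_affine hs 1 0 1 ξ₀ j k 0 0
    simpa [hbdef] using this
  set p : ℝ → ℝ → ℂ := fun x ξ => ∑ i ∈ Finset.range N, taylorHom a ξ₀ i x ξ with hp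
  have hps : IsSmoothSymbol p := by
    unfold IsSmoothSymbol; exact ContDiff.sum fun i _ => isSmoothSymbol_taylorHom a ξ₀ i
  -- The remainder is estimated before rescaling; homogeneity of the Taylor parts turns their powers
  -- of `√h` into evaluation of `R` at the rescaled point.
  set R : ℝ → ℝ → ℂ := fun x ξ => b x ξ + (-1) * p x ξ with hR
  have hnp : IsSmoothSymbol (fun x ξ => (-1) * p x ξ) := by
    unfold IsSmoothSymbol; exact contDiff_const.mul hps
  have hRs : IsSmoothSymbol R := hbs.add hnp
  have hRd : ∀ j k x ξ, mixedDeriv j k R x ξ = mixedDeriv j k b x ξ - mixedDeriv j k p x ξ := by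
    intro j k x ξ
    rw [hR, mixedDeriv_fun_add hbs hnp, mixedDeriv_const_mul hps]
    ring
  have hpd : ∀ j k x ξ, mixedDeriv j k p x ξ =
      ∑ i ∈ Finset.range N, mixedDeriv j k (taylorHom a ξ₀ i) x ξ := fun j k x ξ => by
    rw [hp, mixedDeriv_sum _ fun i _ => isSmoothSymbol_taylorHom a ξ₀ i]
  have hR0 : ∀ j k, j + k < N → mixedDeriv j k R 0 0 = 0 := by
    intro j k hjk
    rw [hRd, hbd, hpd]
    simp only [mixedDeriv_taylorHom_zero]
    rw [Finset.sum_ite_eq]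
    simp [hjk]
  have hRN : ∀ j k, N ≤ j + k → ∀ x ξ, mixedDeriv j k R x ξ = mixedDeriv j k b x ξ := by
    intro j k hjk x ξ
    rw [hRd, hpd, Finset.sum_eq_zero, sub_zero]
    intro i hi
    exact mixedDeriv_taylorHom_of_lt a ξ₀ (by have := Finset.mem_range.1 hi; omega) x ξ
  choose C hC0 hC using hb.bound'
  -- A derivative of order `j + k` of `R` still vanishes to order `N - (j + k)`, and from total
  -- order `N` on the derivatives of `R` are those of `b`. For `j + k > N` the truncated exponent is
  -- 0 and only boundedness by the weight is claimed.
  have hRb : ∀ j k, ∃ D : ℝ, 0 ≤ D ∧ ∀ x ξ, ‖mixedDeriv j k R x ξ‖ ≤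
      D * (|x| + |ξ|) ^ (N - (j + k)) * symWeight K x ξ := by
    intro j k
    refine ⟨∑ q ∈ Finset.HasAntidiagonal.antidiagonal (N - (j + k)), C (q.1 + j) (q.2 + k),
      Finset.sum_nonneg fun q _ => hC0 _ _, fun x ξ => ?_⟩
    refine norm_le_of_mixedDeriv_eq_zero K (N - (j + k))
      (Finset.sum_nonneg fun q _ => hC0 _ _) (hRs.mixedDeriv j k) (fun j' k' hjk => ?_)
      (fun j' k' hjk x ξ => ?_) x ξ
    · rw [mixedDeriv_mixedDeriv hRs]; exact hR0 _ _ (by omega)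
    · rw [mixedDeriv_mixedDeriv hRs, hRN _ _ (by omega)]
      refine (hC (j' + j) (k' + k) () x ξ).trans (mul_le_mul_of_nonneg_right ?_
        (symWeight_nonneg _ _ _))
      exact Finset.single_le_sum (f := fun q : ℕ × ℕ => C (q.1 + j) (q.2 + k))
        (fun q _ => hC0 _ _)
        ((Finset.HasAntidiagonal.mem_antidiagonal (a := (j', k'))).2 hjk)
  have hfam : (fun (h : HIdx) y η => (((Real.sqrt h) ^ N)⁻¹ : ℂ) *
      (rescale ξ₀ a h y η - ∑ i ∈ Finset.range N, (Real.sqrt h : ℂ) ^ i * taylorHom a ξ₀ i y η)) =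
      fun (h : HIdx) y η => (((Real.sqrt h) ^ N)⁻¹ : ℂ) *
        R (Real.sqrt h * y + 0) (Real.sqrt h * η + 0) := by
    funext h y η
    simp only [hR, hbdef, hp, rescale, add_zero, taylorHom_smul]
    ring
  rw [hfam]
  refine ⟨fun h => contDiff_const.mul (hRs.comp_affine _ _ _ _), fun j k => ?_⟩
  obtain ⟨D, hD0, hD⟩ := hRb j k
  refine ⟨D, fun h y η => ?_⟩
  have hpos := h.sqrt_pos
  have h1 := h.sqrt_le_one
  rw [mixedDeriv_const_mul (hRs.comp_affine _ _ _ _)]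
  simp only []
  rw [mixedDeriv_comp_affine hRs]
  set ε := Real.sqrt h
  rw [norm_mul, norm_mul, norm_inv, norm_pow, Complex.norm_real, Complex.norm_real,
    Real.norm_of_nonneg hpos.le, Real.norm_of_nonneg (by positivity), add_zero, add_zero]
  have hw : symWeight K (ε * y) (ε * η) ≤ symWeight K y η := by
    refine symWeight_le_of_abs_le ?_ ?_ <;> rw [abs_mul, abs_of_pos hpos] <;>
      exact mul_le_of_le_one_left (abs_nonneg _) h1
  -- The chain rule gives `ε ^ (j + k)` and the vanishing of the remainder gives `ε ^ (N - (j +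
  -- k))`; together they compensate the division by `ε ^ N`.
  have hmul : (ε ^ N)⁻¹ * (ε ^ j * ε ^ k) * ε ^ (N - (j + k)) ≤ 1 := by
    rw [← pow_add, mul_assoc, ← pow_add, inv_mul_le_one₀ (by positivity)]
    exact pow_le_pow_of_le_one hpos.le h1 (by omega)
  have hsum : (|y| + |η|) ^ (N - (j + k)) ≤ (1 + |y|) ^ N * (1 + |η|) ^ N := by
    have hle : |y| + |η| ≤ (1 + |y|) * (1 + |η|) := by
      nlinarith [abs_nonneg y, abs_nonneg η, mul_nonneg (abs_nonneg y) (abs_nonneg η)]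
    have hone : 1 ≤ (1 + |y|) * (1 + |η|) := by
      nlinarith [abs_nonneg y, abs_nonneg η, mul_nonneg (abs_nonneg y) (abs_nonneg η)]
    rw [← mul_pow]
    exact (pow_le_pow_left₀ (by positivity) hle _).trans (pow_le_pow_right₀ hone (by omega))
  have hy : |ε * y| + |ε * η| = ε * (|y| + |η|) := by
    rw [abs_mul, abs_mul, abs_of_pos hpos]; ring
  calc (ε ^ N)⁻¹ * (ε ^ j * ε ^ k * ‖mixedDeriv j k R (ε * y) (ε * η)‖)
      ≤ (ε ^ N)⁻¹ * (ε ^ j * ε ^ k * (D * (|ε * y| + |ε * η|) ^ (N - (j + k)) *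
          symWeight K (ε * y) (ε * η))) := by gcongr; exact hD _ _
    _ = ((ε ^ N)⁻¹ * (ε ^ j * ε ^ k) * ε ^ (N - (j + k))) *
          (D * (|y| + |η|) ^ (N - (j + k)) * symWeight K (ε * y) (ε * η)) := by
        rw [hy, mul_pow]; ring
    _ ≤ 1 * (D * ((1 + |y|) ^ N * (1 + |η|) ^ N) * symWeight K y η) := by
        have := symWeight_nonneg K (ε * y) (ε * η)
        gcongr
    _ = _ := by unfold symWeight; ring

/-- Uniqueness of asymptotic expansions in powers of `ε`. -/
theorem eq_zero_of_sum_isBigO (N : ℕ) {c : ℕ → ℂ}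
    (h : (fun ε : ℝ => ∑ i ∈ Finset.range N, (ε : ℂ) ^ i * c i) =O[𝓝[>] 0] (fun ε : ℝ => ε ^ N)) :
    ∀ i < N, c i = 0 := by
  induction N generalizing c with
  | zero => intro i hi; omega
  | succ N ih =>
    have e : ∀ ε : ℝ, ∑ i ∈ Finset.range (N + 1), (ε : ℂ) ^ i * c i =
        (ε : ℂ) * (∑ i ∈ Finset.range N, (ε : ℂ) ^ i * c (i + 1)) + c 0 := fun ε => by
      rw [Finset.sum_range_succ', Finset.mul_sum]
      simp only [pow_succ, pow_zero, one_mul]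
      congr 1
      exact Finset.sum_congr rfl fun i _ => by ring
    simp only [e] at h
    have t1 : Tendsto (fun ε : ℝ => ε ^ (N + 1)) (𝓝[>] 0) (𝓝 0) := by
      have : Continuous (fun ε : ℝ => ε ^ (N + 1)) := by fun_prop
      simpa using (this.tendsto 0).mono_left nhdsWithin_le_nhds
    have t2 := h.trans_tendsto t1
    have t3 : Tendsto (fun ε : ℝ => (ε : ℂ) * (∑ i ∈ Finset.range N, (ε : ℂ) ^ i * c (i + 1)) + c 0)
        (𝓝[>] 0) (𝓝 (c 0)) := by
      have : Continuous (fun ε : ℝ =>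
        (ε : ℂ) * (∑ i ∈ Finset.range N, (ε : ℂ) ^ i * c (i + 1)) + c 0) := by fun_prop
      simpa using (this.tendsto 0).mono_left nhdsWithin_le_nhds
    -- The sum tends to its constant term and, by the bound, to 0. One factor `ε` is then divided
    -- out for the induction.
    have hc0 : c 0 = 0 := tendsto_nhds_unique t3 t2
    have h' : (fun ε : ℝ => ∑ i ∈ Finset.range N, (ε : ℂ) ^ i * c (i + 1)) =O[𝓝[>] 0]
        (fun ε : ℝ => ε ^ N) := by
      obtain ⟨C, hC⟩ := h.bound
      refine IsBigO.of_bound C ?_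
      filter_upwards [hC, self_mem_nhdsWithin] with ε hε hpos
      have hpos : 0 < ε := hpos
      rw [hc0, add_zero, norm_mul, Complex.norm_real, pow_succ, norm_mul] at hε
      have : 0 < ‖ε‖ := by simpa using hpos.ne'
      refine le_of_mul_le_mul_left ?_ this
      linarith
    intro i hi
    rcases i with - | i
    · exact hc0
    · exact ih h' i (by omega)

end

noncomputable section

open MeasureTheory

/-! ### Weyl quantization of matrix symbols -/

variable {ι : Type*} {K : ℕ} {A B : ι → ℝ → ℝ → Mat2} {φ ψ : ι → ℝ → C2}

theorem UnifSchwartz.coord (h : UnifSchwartz φ) (r : Fin 2) : UnifSchwartz (fun i y => φ i y r) :=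
  h.clm (L := fun _ => (EuclideanSpace.proj (𝕜 := ℂ) r).restrictScalars ℝ) (fun _ => le_rfl)

theorem unifSchwartz_of_coord (h : ∀ r, UnifSchwartz (fun i y => φ i y r)) : UnifSchwartz φ := by
  have key : ∀ r, UnifSchwartz (fun i y => (φ i y r) • EuclideanSpace.single r (1 : ℂ)) := fun r =>
    (h r).clm (L := fun _ => ((ContinuousLinearMap.id ℂ ℂ).smulRight
      (EuclideanSpace.single r (1 : ℂ))).restrictScalars ℝ) (fun _ => le_rfl)
  have hs := UnifSchwartz.sum (Finset.univ : Finset (Fin 2))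
    (f := fun r i y => (φ i y r) • EuclideanSpace.single r (1 : ℂ)) (fun r _ => key r)
  convert hs using 1
  funext i y
  ext s
  fin_cases s <;> simp [Fin.sum_univ_two]

theorem SchwartzMap.unifSchwartz {E : Type*} [NormedAddCommGroup E] [NormedSpace ℝ E] (κ : Type*)
    (f : SchwartzMap ℝ E) : UnifSchwartz (fun _ : κ => f) := by
  refine ⟨fun _ => f.smooth ⊤, fun p q => ?_⟩
  obtain ⟨C, _, hC⟩ := f.decay p q
  refine ⟨C, fun _ y => ?_⟩
  simpa [norm_iteratedFDeriv_eq_norm_iteratedDeriv] using hC y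

/-- Families of matrix symbols. -/
def UnifSymMat (K : ℕ) (A : ι → ℝ → ℝ → Mat2) : Prop :=
  ∀ r s : Fin 2, UnifSym K (fun i x ξ => A i x ξ r s)

theorem UnifSymMat.conjTranspose (hA : UnifSymMat K A) :
    UnifSymMat K (fun i x ξ => (A i x ξ).conjTranspose) := fun r s => (hA s r).conj

/-- The Weyl quantization with `h = 1` of a matrix symbol, in terms of scalar symbols. -/
def weylVec (A : ℝ → ℝ → Mat2) (φ : ℝ → C2) (x : ℝ) : C2 :=
  WithLp.toLp 2 (fun r => ∑ s, weylScalar (fun x ξ => A x ξ r s) (fun y => φ y s) x)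

theorem weylVec_apply (A : ℝ → ℝ → Mat2) (φ : ℝ → C2) (x : ℝ) (r : Fin 2) :
    weylVec A φ x r = ∑ s, weylScalar (fun x ξ => A x ξ r s) (fun y => φ y s) x := rfl

theorem UnifSchwartz.weylVec (hA : UnifSymMat K A) (hφ : UnifSchwartz φ) :
    UnifSchwartz (fun i => weylVec (A i) (φ i)) :=
  unifSchwartz_of_coord fun r => UnifSchwartz.sum Finset.univ
    (f := fun s i => _root_.weylScalar (fun x ξ => A i x ξ r s) (fun y => φ i y s))
    fun s _ => UnifSchwartz.weylScalar (hA r s) (hφ.coord s)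

/-- Substituting `ξ = hη` moves `h` from the phase into the symbol and cancels the `h⁻¹` of the
prefactor, so that only scalar quantization with `h = 1` has to be studied. -/
theorem weyl_eq_weylVec {h : ℝ} (hh : 0 < h)
    (hA : UnifSymMat K (fun i x ξ => A i x (h * ξ))) (hφ : UnifSchwartz φ) (i : ι) :
    weyl h (A i) (φ i) = weylVec (fun x ξ => A i x (h * ξ)) (φ i) := by
  funext x
  set a : Fin 2 → Fin 2 → ℝ → ℝ → ℂ := fun r s x ξ => A i x (h * ξ) r s with ha
  have hint : ∀ r s ξ, Integrable (weylIntegrand (a r s) (fun y => φ i y s) x ξ) := fun r s ξ =>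
    integrable_weylIntegrand (hA r s) (hφ.coord s) i x ξ
  have hint2 : ∀ r s, Integrable (weylInner (a r s) (fun y => φ i y s) x) := fun r s =>
    integrable_weylInner (hA r s) (hφ.coord s) i x
  set g : ℝ → C2 := fun η => WithLp.toLp 2 (fun r => ∑ s, weylInner (a r s) (fun y => φ i y s) x η)
    with hg
  have e1 : ∀ ξ, ∫ y : ℝ, Complex.exp (Complex.I * (((x - y) * ξ / h : ℝ) : ℂ)) •
      matAct (A i ((x + y) / 2) ξ) (φ i y) = g (h⁻¹ * ξ) := by
    intro ξ
    have e : ∀ y, Complex.exp (Complex.I * (((x - y) * ξ / h : ℝ) : ℂ)) •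
      matAct (A i ((x + y) / 2) ξ) (φ i y) = WithLp.toLp 2 (fun r => ∑ s,
        weylIntegrand (a r s) (fun y => φ i y s) x (h⁻¹ * ξ) y) := by
      intro y
      ext r
      simp only [matAct, PiLp.smul_apply, Matrix.mulVec, dotProduct, smul_eq_mul, Finset.mul_sum,
        weylIntegrand, weylPhase, ha]
      refine Finset.sum_congr rfl fun s _ => ?_
      rw [mul_inv_cancel_left₀ hh.ne', show (x - y) * ξ / h = (x - y) * (h⁻¹ * ξ) by
        field_simp]
    simp only [e]
    ext r
    rw [eval_integral_piLp (f := fun y => WithLp.toLp 2 (fun r => ∑ s,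
        weylIntegrand (a r s) (fun y => φ i y s) x (h⁻¹ * ξ) y))
      fun r => integrable_finsetSum Finset.univ fun s _ => hint r s (h⁻¹ * ξ)]
    simp only [hg]
    exact integral_finsetSum _ fun s _ => hint r s _
  simp only [weyl, e1]
  rw [Measure.integral_comp_mul_left g, inv_inv, abs_of_pos hh]
  ext r
  rw [PiLp.smul_apply, PiLp.smul_apply,
    eval_integral_piLp (f := g) fun r => integrable_finsetSum Finset.univ fun s _ => hint2 r s]
  have e2 : ∫ η, (g η).ofLp r = ∑ s, ∫ η, weylInner (a r s) (fun y => φ i y s) x η := by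
    simp only [hg]
    exact integral_finsetSum _ fun s _ => hint2 r s
  rw [e2, weylVec_apply]
  simp only [weylScalar, smul_eq_mul, Complex.real_smul, ← Finset.mul_sum]
  rw [← mul_assoc]
  congr 1
  rw [← Complex.ofReal_mul]
  congr 1
  field_simp

theorem weyl_one_eq_weylVec (hA : UnifSymMat K A) (hφ : UnifSchwartz φ) (i : ι) :
    weyl 1 (A i) (φ i) = weylVec (A i) (φ i) := by
  have := weyl_eq_weylVec (h := 1) one_pos (A := A) (by simpa using hA) hφ i
  simpa using this

theorem integrable_conj_mul {κ : Type*} {f g : κ → ℝ → ℂ} (hf : UnifSchwartz f)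
    (hg : UnifSchwartz g) (i : κ) : Integrable (fun x => (starRingEnd ℂ) (f i x) * g i x) := by
  obtain ⟨C, hC0, hC⟩ := hf.decay 0
  obtain ⟨D, hD0, hD⟩ := hg.decay 0
  refine (integrable_inv_one_add_sq.const_mul (C * D)).mono' ?_ (Eventually.of_forall fun x => ?_)
  · exact ((hf.conj.continuous i).mul (hg.continuous i)).aestronglyMeasurable
  · have h1 := hC i x
    have h2 := hD i x
    rw [pow_zero, one_mul] at h1 h2
    have h3 : (1 + x ^ 2)⁻¹ ≤ 1 := inv_le_one_of_one_le₀ (by nlinarith [sq_nonneg x])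
    rw [norm_mul, RCLike.norm_conj]
    calc _ ≤ (C * 1) * (D * (1 + x ^ 2)⁻¹) := by
          gcongr
          exact h1.trans (by gcongr)
      _ = _ := by ring

theorem inner_C2 (u w : C2) : inner ℂ u w = ∑ r, (starRingEnd ℂ) (u r) * w r := by
  rw [PiLp.inner_apply]
  simp only [RCLike.inner_apply]
  exact Finset.sum_congr rfl fun r _ => mul_comm _ _

/-- The formal adjoint of the quantization of a matrix symbol. -/
theorem integral_inner_weylVec (hA : UnifSymMat K A) (hφ : UnifSchwartz φ) (hψ : UnifSchwartz ψ)
    (i : ι) : ∫ x : ℝ, inner ℂ (φ i x) (weylVec (A i) (ψ i) x) =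
      ∫ x : ℝ, inner ℂ (weylVec (fun x ξ => (A i x ξ).conjTranspose) (φ i) x) (ψ i x) := by
  have hW : ∀ r s, UnifSchwartz (fun i => weylScalar (fun x ξ => A i x ξ r s) (fun y => ψ i y s)) :=
    fun r s => UnifSchwartz.weylScalar (hA r s) (hψ.coord s)
  have hW' : ∀ r s, UnifSchwartz (fun i => weylScalar
      (fun x ξ => (A i x ξ).conjTranspose s r) (fun y => φ i y r)) :=
    fun r s => UnifSchwartz.weylScalar (hA.conjTranspose s r) (hφ.coord r)
  simp only [inner_C2, weylVec_apply, map_sum, Finset.mul_sum, Finset.sum_mul]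
  rw [integral_finsetSum _ fun r _ => integrable_finsetSum _ fun s _ =>
    integrable_conj_mul (hφ.coord r) (hW r s) i,
    integral_finsetSum _ fun r _ => integrable_finsetSum _ fun s _ =>
    integrable_conj_mul (hW' s r) (hψ.coord r) i]
  have e1 : ∀ r, ∫ x : ℝ, ∑ s, (starRingEnd ℂ) (φ i x r) *
      weylScalar (fun x ξ => A i x ξ r s) (fun y => ψ i y s) x = ∑ s, ∫ x : ℝ,
      (starRingEnd ℂ) (φ i x r) * weylScalar (fun x ξ => A i x ξ r s) (fun y => ψ i y s) x :=
    fun r => integral_finsetSum _ fun s _ => integrable_conj_mul (hφ.coord r) (hW r s) i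
  have e2 : ∀ r, ∫ x : ℝ, ∑ s, (starRingEnd ℂ) (weylScalar
      (fun x ξ => (A i x ξ).conjTranspose r s) (fun y => φ i y s) x) * ψ i x r = ∑ s, ∫ x : ℝ,
      (starRingEnd ℂ) (weylScalar
      (fun x ξ => (A i x ξ).conjTranspose r s) (fun y => φ i y s) x) * ψ i x r :=
    fun r => integral_finsetSum _ fun s _ => integrable_conj_mul (hW' s r) (hψ.coord r) i
  simp only [e1, e2]
  rw [Finset.sum_comm]
  refine Finset.sum_congr rfl fun s _ => Finset.sum_congr rfl fun r _ => ?_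
  exact integral_conj_mul_weylScalar (hA r s) (hφ.coord r) (hψ.coord s) i

/-! ### Covariance under translations and wave packet transforms -/

theorem weylVec_comp_add (A : ℝ → ℝ → Mat2) (φ : ℝ → C2) (c x : ℝ) :
    weylVec A (fun y => φ (y + c)) x = weylVec (fun x ξ => A (x - c) ξ) φ (x + c) := by
  ext r
  simp only [weylVec_apply]
  exact Finset.sum_congr rfl fun s _ =>
    weylScalar_comp_add (fun x ξ => A x ξ r s) (fun y => φ y s) c x

/-- The wave packet `c e^{iξ₀x/h} w(x/√h)`, where `s = √h`. -/
def wavePacket (ξ₀ s : ℝ) (c : ℂ) (w : ℝ → C2) (x : ℝ) : C2 :=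
  (c * Complex.exp (Complex.I * ((ξ₀ * x / s ^ 2 : ℝ) : ℂ))) • w (x * s⁻¹)

/-- Exact covariance under the affine symplectic map `(y, η) ↦ (s y, η/s + ξ₀/s²)`: modulation and
dilation of the function become translation and dilation of the symbol. With `s² = h` the rescaled
symbol of the normal form appears. -/
theorem weylScalar_wavePacket (a : ℝ → ℝ → ℂ) (ξ₀ : ℝ) {s : ℝ} (hs : 0 < s) (c : ℂ) (w : ℝ → ℂ)
    (x : ℝ) : weylScalar (fun x ξ => a x (s ^ 2 * ξ))
      (fun y => c * Complex.exp (Complex.I * ((ξ₀ * y / s ^ 2 : ℝ) : ℂ)) * w (y * s⁻¹)) x =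
      c * Complex.exp (Complex.I * ((ξ₀ * x / s ^ 2 : ℝ) : ℂ)) *
        weylScalar (fun y η => a (s * y) (s * η + ξ₀)) w (x * s⁻¹) := by
  set d : ℂ := c * Complex.exp (Complex.I * ((ξ₀ * x / s ^ 2 : ℝ) : ℂ)) with hd
  -- The shifted frequency absorbs the modulation. The Jacobian `s` of `y = s z` will cancel the
  -- Jacobian `s⁻¹` of the frequency.
  have e : ∀ η, weylInner (fun x ξ => a x (s ^ 2 * ξ))
      (fun y => c * Complex.exp (Complex.I * ((ξ₀ * y / s ^ 2 : ℝ) : ℂ)) * w (y * s⁻¹)) x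
        (s⁻¹ * η + ξ₀ / s ^ 2) =
      (s : ℂ) * (d * weylInner (fun y η => a (s * y) (s * η + ξ₀)) w (x * s⁻¹) η) := by
    intro η
    simp only [weylInner]
    rw [← integral_const_mul]
    have := Measure.integral_comp_mul_left (fun z => d * weylIntegrand
      (fun y η => a (s * y) (s * η + ξ₀)) w (x * s⁻¹) η z) s⁻¹
    rw [inv_inv, abs_of_pos hs, Complex.real_smul] at this
    rw [← this]
    congr 1; funext y
    simp only [weylIntegrand, weylPhase, hd]
    have h1 : s ^ 2 * (s⁻¹ * η + ξ₀ / s ^ 2) = s * η + ξ₀ := by field_simp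
    have h2 : s * ((x * s⁻¹ + s⁻¹ * y) / 2) = (x + y) / 2 := by field_simp
    rw [h1, h2]
    have h3 : Complex.exp (Complex.I * (((x - y) * (s⁻¹ * η + ξ₀ / s ^ 2) : ℝ) : ℂ)) *
        Complex.exp (Complex.I * ((ξ₀ * y / s ^ 2 : ℝ) : ℂ)) =
        Complex.exp (Complex.I * ((ξ₀ * x / s ^ 2 : ℝ) : ℂ)) *
          Complex.exp (Complex.I * (((x * s⁻¹ - s⁻¹ * y) * η : ℝ) : ℂ)) := by
      rw [← Complex.exp_add, ← Complex.exp_add, ← mul_add, ← mul_add, ← Complex.ofReal_add,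
        ← Complex.ofReal_add]
      congr 3
      field_simp; ring
    rw [mul_comm y s⁻¹]
    linear_combination (c * a ((x + y) / 2) (s * η + ξ₀) * w (s⁻¹ * y)) * h3
  simp only [weylScalar]
  rw [← integral_add_right_eq_self (fun ξ => weylInner (fun x ξ => a x (s ^ 2 * ξ))
      (fun y => c * Complex.exp (Complex.I * ((ξ₀ * y / s ^ 2 : ℝ) : ℂ)) * w (y * s⁻¹)) x ξ)
      (ξ₀ / s ^ 2)]
  have e' := Measure.integral_comp_mul_left (fun ξ => weylInner (fun x ξ => a x (s ^ 2 * ξ))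
      (fun y => c * Complex.exp (Complex.I * ((ξ₀ * y / s ^ 2 : ℝ) : ℂ)) * w (y * s⁻¹)) x
        (ξ + ξ₀ / s ^ 2)) s⁻¹
  rw [inv_inv, abs_of_pos hs, Complex.real_smul] at e'
  have hs' : (s : ℂ) ≠ 0 := by exact_mod_cast hs.ne'
  simp only [e, integral_const_mul] at e'
  have e'' := mul_left_cancel₀ hs' e'
  rw [← e'']
  ring

theorem weylVec_wavePacket (A : ℝ → ℝ → Mat2) (ξ₀ : ℝ) {s : ℝ} (hs : 0 < s) (c : ℂ) (w : ℝ → C2) :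
    weylVec (fun x ξ => A x (s ^ 2 * ξ)) (wavePacket ξ₀ s c w) =
      wavePacket ξ₀ s c (weylVec (fun y η => A (s * y) (s * η + ξ₀)) w) := by
  funext x
  ext r
  simp only [weylVec_apply, wavePacket, PiLp.smul_apply, smul_eq_mul, Finset.mul_sum]
  exact Finset.sum_congr rfl fun t _ =>
    weylScalar_wavePacket (fun x ξ => A x ξ r t) ξ₀ hs c (fun y => w y t) x

end

noncomputable section

open MeasureTheory

/-! ### Polynomials times a Gaussian -/

/-- `p(y) e^{-ω y²/2}`. -/
def polyGauss (ω : ℝ) (p : ℂ[X]) (y : ℝ) : ℂ :=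
  ((Real.exp (-(ω * y ^ 2 / 2)) : ℝ) : ℂ) * p.eval (y : ℂ)

/-- The derivative on amplitudes: `(p e^{-ω y²/2})' = (p' - ω y p) e^{-ω y²/2}`. -/
def gaussDeriv (ω : ℝ) : ℂ[X] →ₗ[ℂ] ℂ[X] :=
  Polynomial.derivative - LinearMap.mulLeft ℂ (Polynomial.C (ω : ℂ) * Polynomial.X)

theorem gaussDeriv_apply (ω : ℝ) (p : ℂ[X]) : gaussDeriv ω p =
    Polynomial.derivative p - Polynomial.C (ω : ℂ) * Polynomial.X * p := rfl

theorem hasDerivAt_polyGauss (ω : ℝ) (p : ℂ[X]) (y : ℝ) :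
    HasDerivAt (polyGauss ω p) (polyGauss ω (gaussDeriv ω p) y) y := by
  have h1 : HasDerivAt (fun y : ℝ => Real.exp (-(ω * y ^ 2 / 2)))
      (Real.exp (-(ω * y ^ 2 / 2)) * (-(ω * y))) y := by
    have := ((((hasDerivAt_pow 2 y).const_mul ω).div_const 2).neg).exp
    refine this.congr_deriv ?_
    simp; ring
  have h2 := h1.ofReal_comp.mul (p.hasDerivAt (y : ℂ)).comp_ofReal
  refine h2.congr_deriv ?_
  rw [polyGauss, gaussDeriv_apply]
  simp only [Polynomial.eval_sub, Polynomial.eval_mul, Polynomial.eval_C, Polynomial.eval_X]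
  push_cast
  ring

theorem deriv_polyGauss (ω : ℝ) (p : ℂ[X]) :
    deriv (polyGauss ω p) = polyGauss ω (gaussDeriv ω p) :=
  funext fun y => (hasDerivAt_polyGauss ω p y).deriv

theorem polyGauss_add (ω : ℝ) (p q : ℂ[X]) (y : ℝ) :
    polyGauss ω (p + q) y = polyGauss ω p y + polyGauss ω q y := by
  simp [polyGauss, mul_add]

theorem polyGauss_smul (ω : ℝ) (c : ℂ) (p : ℂ[X]) (y : ℝ) :
    polyGauss ω (c • p) y = c * polyGauss ω p y := by
  simp [polyGauss]; ring

theorem polyGauss_X_mul (ω : ℝ) (p : ℂ[X]) (y : ℝ) :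
    polyGauss ω (Polynomial.X * p) y = (y : ℂ) * polyGauss ω p y := by
  simp [polyGauss]; ring

theorem exists_norm_polyGauss_le {ω : ℝ} (hω : 0 < ω) (p : ℂ[X]) :
    ∃ C : ℝ, ∀ y : ℝ, ‖polyGauss ω p y‖ ≤ C := by
  induction p using Polynomial.induction_on' with
  | add p q hp hq =>
    obtain ⟨C, hC⟩ := hp
    obtain ⟨D, hD⟩ := hq
    refine ⟨C + D, fun y => ?_⟩
    rw [polyGauss_add]
    exact (norm_add_le _ _).trans (add_le_add (hC y) (hD y))
  | monomial n a =>
    refine ⟨‖a‖ * (1 + n.factorial * (2 / ω) ^ n), fun y => ?_⟩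
    rw [polyGauss, Polynomial.eval_monomial, norm_mul, norm_mul, norm_pow, Complex.norm_real,
      Complex.norm_real, Real.norm_of_nonneg (Real.exp_nonneg _), Real.norm_eq_abs]
    have hx : 0 ≤ ω * y ^ 2 / 2 := by positivity
    -- A single term of the exponential series bounds `|y|^(2n)` by a multiple of the inverse
    -- Gaussian.
    have h1 := Real.pow_div_factorial_le_exp (ω * y ^ 2 / 2) hx n
    have h2 : |y| ^ n ≤ 1 + (2 / ω) ^ n * (ω * y ^ 2 / 2) ^ n := by
      rw [← mul_pow, show 2 / ω * (ω * y ^ 2 / 2) = |y| ^ 2 by rw [sq_abs]; field_simp, ← pow_mul]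
      rcases le_total |y| 1 with h | h
      · have := pow_le_one₀ (n := n) (abs_nonneg y) h
        have : 0 ≤ |y| ^ (2 * n) := by positivity
        linarith
      · have := pow_le_pow_right₀ h (show n ≤ 2 * n by omega)
        linarith
    have h3 : (ω * y ^ 2 / 2) ^ n ≤ n.factorial * Real.exp (ω * y ^ 2 / 2) := by
      rwa [div_le_iff₀' (by positivity)] at h1
    have h4 : Real.exp (-(ω * y ^ 2 / 2)) * Real.exp (ω * y ^ 2 / 2) = 1 := by
      rw [← Real.exp_add]; simp
    have h5 : Real.exp (-(ω * y ^ 2 / 2)) ≤ 1 := Real.exp_le_one_iff.2 (by linarith)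
    calc _ = ‖a‖ * (Real.exp (-(ω * y ^ 2 / 2)) * |y| ^ n) := by ring
      _ ≤ ‖a‖ * (Real.exp (-(ω * y ^ 2 / 2)) *
          (1 + (2 / ω) ^ n * (n.factorial * Real.exp (ω * y ^ 2 / 2)))) := by
          gcongr; exact h2.trans (by gcongr)
      _ = ‖a‖ * (Real.exp (-(ω * y ^ 2 / 2)) + n.factorial * (2 / ω) ^ n *
          (Real.exp (-(ω * y ^ 2 / 2)) * Real.exp (ω * y ^ 2 / 2))) := by ring
      _ ≤ _ := by rw [h4, mul_one]; gcongr

/-- Derivatives and powers of `y` act on the polynomial factor alone, so each seminorm reduces to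
the boundedness of another polynomial times the Gaussian. -/
theorem unifSchwartz_polyGauss (ι : Type*) {ω : ℝ} (hω : 0 < ω) (p : ℂ[X]) :
    UnifSchwartz (fun _ : ι => polyGauss ω p) := by
  obtain ⟨h1, h2⟩ := contDiff_of_hasDerivAt_seq
    (f := fun n => polyGauss ω ((gaussDeriv ω)^[n] p)) (fun n y => by
      simp only [Function.iterate_succ_apply']
      exact hasDerivAt_polyGauss ω _ y)
  refine ⟨fun _ => h1, fun m q => ?_⟩
  obtain ⟨C, hC⟩ := exists_norm_polyGauss_le hω (Polynomial.X ^ m * (gaussDeriv ω)^[q] p)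
  refine ⟨C, fun _ y => ?_⟩
  have := hC y
  have e : polyGauss ω (Polynomial.X ^ m * (gaussDeriv ω)^[q] p) y =
      (y : ℂ) ^ m * polyGauss ω ((gaussDeriv ω)^[q] p) y := by
    simp [polyGauss]; ring
  rw [e, norm_mul, norm_pow, Complex.norm_real, Real.norm_eq_abs] at this
  have e2 := congrFun (h2 q) y
  simp only [Function.iterate_zero, id] at e2
  rw [e2]
  exact this

/-- The operator on amplitudes given by the quantization of the monomial `x^k ξ^j`. -/
def monoOp (ω : ℝ) (j : ℕ) : ℕ → ℂ[X] →ₗ[ℂ] ℂ[X]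
  | 0 => ((-Complex.I) • gaussDeriv ω) ^ j
  | k + 1 => (1 / 2 : ℂ) • (LinearMap.mulLeft ℂ Polynomial.X ∘ₗ monoOp ω j k +
      monoOp ω j k ∘ₗ LinearMap.mulLeft ℂ Polynomial.X)

theorem symDx_monoSym_zero (j : ℕ) : symDx (monoSym j 0) = fun _ _ => 0 := by
  funext x ξ; simp [symDx, monoSym]

/-- Starting from Fourier inversion for the symbol 1, each factor `ξ` adds `-i d/dx`, without
correction since `ξ^j` does not depend on `x`; each factor `x` then adds a symmetrized
multiplication. -/
theorem weylScalar_monoSym {ω : ℝ} (hω : 0 < ω) (j k : ℕ) (p : ℂ[X]) (x : ℝ) :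
    weylScalar (monoSym j k) (polyGauss ω p) x = polyGauss ω (monoOp ω j k p) x := by
  induction k generalizing p with
  | zero =>
    induction j generalizing p with
    | zero =>
      have : monoSym 0 0 = fun _ _ => 1 := by funext x ξ; simp [monoSym]
      rw [this, weylScalar_one (unifSchwartz_polyGauss Unit hω p) ()]
      simp [monoOp]
    | succ j ih =>
      have e : monoSym (j + 1) 0 = fun (x ξ : ℝ) => (ξ : ℂ) * monoSym j 0 x ξ := by
        funext x ξ; simp only [monoSym]; ring
      rw [e, weylScalar_mul_right (unifSym_monoSym (ι := Unit) (K := j) le_rfl (Nat.zero_le _))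
        (unifSchwartz_polyGauss Unit hω p) (), symDx_monoSym_zero, weylScalar_zero_symbol,
        deriv_polyGauss, ih]
      simp only [monoOp, pow_succ, mul_zero, zero_add]
      rw [Module.End.mul_apply, LinearMap.smul_apply, map_smul, polyGauss_smul]
  | succ k ih =>
    have e : monoSym j (k + 1) = fun (x ξ : ℝ) => (x : ℂ) * monoSym j k x ξ := by
      funext x ξ; simp only [monoSym]; ring
    have e2 : (fun y : ℝ => (y : ℂ) * polyGauss ω p y) = polyGauss ω (Polynomial.X * p) := by
      funext y; rw [polyGauss_X_mul]
    rw [e, weylScalar_mul_left (unifSym_monoSym (ι := Unit) (K := j + k) (by omega) (by omega))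
      (unifSchwartz_polyGauss Unit hω p) (), ih, e2, ih]
    simp only [monoOp, LinearMap.smul_apply, LinearMap.add_apply, LinearMap.comp_apply,
      LinearMap.mulLeft_apply]
    rw [polyGauss_smul, polyGauss_add, polyGauss_X_mul]

/-! ### Action of polynomial symbols on polynomial amplitudes -/

/-- Polynomial symbols. -/
def polySymbols : Submodule ℂ (ℝ → ℝ → ℂ) :=
  Submodule.span ℂ (Set.range fun q : ℕ × ℕ => monoSym q.1 q.2)

theorem monoSym_mem_polySymbols (j k : ℕ) : monoSym j k ∈ polySymbols :=
  Submodule.subset_span ⟨(j, k), rfl⟩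

theorem taylorHom_mem_polySymbols (a : ℝ → ℝ → ℂ) (ξ₀ : ℝ) (i : ℕ) :
    taylorHom a ξ₀ i ∈ polySymbols := by
  have : taylorHom a ξ₀ i = ∑ q ∈ Finset.HasAntidiagonal.antidiagonal i,
      (mixedDeriv q.1 q.2 a 0 ξ₀ / (q.2.factorial * q.1.factorial)) • monoSym q.1 q.2 := by
    funext y η
    simp [taylorHom, Finset.sum_apply]
  rw [this]
  exact Submodule.sum_mem _ fun q _ => Submodule.smul_mem _ _ (monoSym_mem_polySymbols _ _)

theorem exists_unifSym_of_mem_polySymbols (ι : Type*) {a : ℝ → ℝ → ℂ} (ha : a ∈ polySymbols) :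
    ∃ K, UnifSym K (fun _ : ι => a) := by
  induction ha using Submodule.span_induction with
  | mem a h =>
    obtain ⟨q, rfl⟩ := h
    exact ⟨q.1 + q.2, unifSym_monoSym (by omega) (by omega)⟩
  | zero => exact ⟨0, UnifSym.zero⟩
  | add a b _ _ ha hb =>
    obtain ⟨K, hK⟩ := ha
    obtain ⟨L, hL⟩ := hb
    exact ⟨K + L, (hK.mono (by omega)).add (hL.mono (by omega))⟩
  | smul c a _ ha =>
    obtain ⟨K, hK⟩ := ha
    exact ⟨K, hK.const_mul (c := fun _ => c) fun _ => le_rfl⟩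

/-- The Gaussian is preserved and only the amplitude changes; this turns the search for quasimodes
into linear algebra on polynomials. -/
theorem exists_amplitude_op {ω : ℝ} (hω : 0 < ω) {a : ℝ → ℝ → ℂ} (ha : a ∈ polySymbols) :
    ∃ Q : ℂ[X] →ₗ[ℂ] ℂ[X], ∀ p x, weylScalar a (polyGauss ω p) x = polyGauss ω (Q p) x := by
  induction ha using Submodule.span_induction with
  | mem a h =>
    obtain ⟨q, rfl⟩ := h
    exact ⟨monoOp ω q.1 q.2, weylScalar_monoSym hω _ _⟩
  | zero => exact ⟨0, fun p x => by
      have := weylScalar_zero_symbol (polyGauss ω p) x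
      rw [LinearMap.zero_apply]
      refine this.trans ?_
      simp [polyGauss]⟩
  | add a b ha' hb' ha hb =>
    obtain ⟨Q, hQ⟩ := ha
    obtain ⟨R, hR⟩ := hb
    obtain ⟨K, hK⟩ := exists_unifSym_of_mem_polySymbols Unit ha'
    obtain ⟨L, hL⟩ := exists_unifSym_of_mem_polySymbols Unit hb'
    refine ⟨Q + R, fun p x => ?_⟩
    have := weylScalar_add_symbol (hK.mono (Nat.le_add_right K L)) (hL.mono (Nat.le_add_left L K))
      (unifSchwartz_polyGauss Unit hω p) () x
    rw [LinearMap.add_apply, polyGauss_add, ← hQ, ← hR]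
    exact this
  | smul c a _ ha =>
    obtain ⟨Q, hQ⟩ := ha
    refine ⟨c • Q, fun p x => ?_⟩
    rw [LinearMap.smul_apply, polyGauss_smul, ← hQ]
    exact weylScalar_const_mul_symbol c a _ x

/-- `q(y) e^{-ω y²/2}` for a pair `q` of polynomials. -/
def polyGaussVec (ω : ℝ) (q : Fin 2 → ℂ[X]) (y : ℝ) : C2 :=
  WithLp.toLp 2 (fun r => polyGauss ω (q r) y)

theorem polyGaussVec_eq (ω : ℝ) (q : Fin 2 → ℂ[X]) (y : ℝ) :
    polyGaussVec ω q y = ((Real.exp (-(ω * y ^ 2 / 2)) : ℝ) : ℂ) • polyVec q y := rfl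

theorem polyGaussVec_add (ω : ℝ) (p q : Fin 2 → ℂ[X]) (y : ℝ) :
    polyGaussVec ω (p + q) y = polyGaussVec ω p y + polyGaussVec ω q y := by
  ext r; simp [polyGaussVec, polyGauss_add]

theorem polyGaussVec_smul (ω : ℝ) (c : ℂ) (p : Fin 2 → ℂ[X]) (y : ℝ) :
    polyGaussVec ω (c • p) y = c • polyGaussVec ω p y := by
  ext r; simp [polyGaussVec, polyGauss_smul]

/-- `polyGaussVec` as a linear map. -/
def polyGaussLin (ω : ℝ) : (Fin 2 → ℂ[X]) →ₗ[ℂ] (ℝ → C2) where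
  toFun := polyGaussVec ω
  map_add' p q := funext fun y => polyGaussVec_add ω p q y
  map_smul' c p := funext fun y => polyGaussVec_smul ω c p y

theorem unifSchwartz_polyGaussVec (ι : Type*) {ω : ℝ} (hω : 0 < ω) (q : Fin 2 → ℂ[X]) :
    UnifSchwartz (fun _ : ι => polyGaussVec ω q) :=
  unifSchwartz_of_coord fun r => unifSchwartz_polyGauss ι hω (q r)

theorem exists_amplitude_op_mat {ω : ℝ} (hω : 0 < ω) {A : ℝ → ℝ → Mat2}
    (hA : ∀ r s, (fun x ξ => A x ξ r s) ∈ polySymbols) :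
    ∃ H : (Fin 2 → ℂ[X]) →ₗ[ℂ] (Fin 2 → ℂ[X]), ∀ q,
      weylVec A (polyGaussVec ω q) = polyGaussVec ω (H q) := by
  choose Q hQ using fun r s => exists_amplitude_op hω (hA r s)
  refine ⟨LinearMap.pi fun r => ∑ s, Q r s ∘ₗ LinearMap.proj s, fun q => ?_⟩
  funext x
  ext r
  rw [weylVec_apply]
  have e : ∀ s : Fin 2, (fun y => (polyGaussVec ω q y).ofLp s) = polyGauss ω (q s) := fun s => rfl
  simp only [e, hQ]
  simp [polyGaussVec, Fin.sum_univ_two, polyGauss_add]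

end

noncomputable section

/-! ### Formal perturbation theory of eigenvalues -/

section FormalPerturbation

variable {V ι : Type*} [AddCommGroup V] [Module ℂ V]

/-- The coefficient of order `n` of `(H - λ) v` for formal series `H = ∑ ε^p H_p`,
`λ = ∑ ε^p λ_p`, `v = ∑ ε^q v_q`. -/
def formalRes (H : ℕ → V →ₗ[ℂ] V) (lam : ℕ → ℝ) (v : ℕ → V) (n : ℕ) : V :=
  ∑ p ∈ Finset.range (n + 1), (H p (v (n - p)) - (lam p : ℂ) • v (n - p))

/-- The series `ε^t v`. -/
def formalShift (t : ℕ) (v : ℕ → V) (n : ℕ) : V := if t ≤ n then v (n - t) else 0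

theorem formalRes_add (H : ℕ → V →ₗ[ℂ] V) (lam : ℕ → ℝ) (v w : ℕ → V) (n : ℕ) :
    formalRes H lam (fun i => v i + w i) n = formalRes H lam v n + formalRes H lam w n := by
  unfold formalRes
  rw [← Finset.sum_add_distrib]
  refine Finset.sum_congr rfl fun p _ => ?_
  rw [map_add, smul_add]; abel

theorem formalRes_sum {α : Type*} (s : Finset α) (c : α → ℂ) (H : ℕ → V →ₗ[ℂ] V) (lam : ℕ → ℝ)
    (v : α → ℕ → V) (n : ℕ) :
    formalRes H lam (fun i => ∑ k ∈ s, c k • v k i) n = ∑ k ∈ s, c k • formalRes H lam (v k) n := by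
  unfold formalRes
  simp only [map_sum, map_smul, Finset.smul_sum]
  rw [Finset.sum_comm]
  refine Finset.sum_congr rfl fun p _ => ?_
  rw [← Finset.sum_sub_distrib]
  refine Finset.sum_congr rfl fun k _ => ?_
  rw [smul_sub, smul_comm]

theorem formalRes_smul (c : ℂ) (H : ℕ → V →ₗ[ℂ] V) (lam : ℕ → ℝ) (v : ℕ → V) (n : ℕ) :
    formalRes H lam (fun i => c • v i) n = c • formalRes H lam v n := by
  simpa using formalRes_sum {()} (fun _ => c) H lam (fun _ => v) n

theorem formalRes_shift (t : ℕ) (H : ℕ → V →ₗ[ℂ] V) (lam : ℕ → ℝ) (v : ℕ → V) (n : ℕ) :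
    formalRes H lam (formalShift t v) n = if t ≤ n then formalRes H lam v (n - t) else 0 := by
  unfold formalRes formalShift
  split_ifs with h
  · symm
    refine Finset.sum_subset_zero_on_sdiff (Finset.range_subset_range.2 (by omega))
      (fun p hp => ?_) (fun p hp => ?_)
    · simp only [Finset.mem_sdiff, Finset.mem_range] at hp
      rw [if_neg (by omega)]; simp
    · have := Finset.mem_range.1 hp
      rw [if_pos (by omega), show n - p - t = n - t - p by omega]
  · refine Finset.sum_eq_zero fun p _ => ?_
    rw [if_neg (by omega)]; simp

/-- Used to test a series against a formal eigenvalue that agrees with its own only up to some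
order. -/
theorem formalRes_change (H : ℕ → V →ₗ[ℂ] V) (lam lam' : ℕ → ℝ) (v : ℕ → V) (n : ℕ) :
    formalRes H lam' v n = formalRes H lam v n +
      ∑ p ∈ Finset.range (n + 1), ((lam p - lam' p : ℝ) : ℂ) • v (n - p) := by
  unfold formalRes
  rw [← Finset.sum_add_distrib]
  refine Finset.sum_congr rfl fun p _ => ?_
  push_cast
  rw [sub_smul]; abel

/-- Symmetry of the first non-vanishing residuals of two formal eigenvectors. -/
theorem formalRes_symm {B : V →ₗ⋆[ℂ] V →ₗ[ℂ] ℂ} {H : ℕ → V →ₗ[ℂ] V}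
    (hH : ∀ p x y, B (H p x) y = B x (H p y)) (lam : ℕ → ℝ) {v w : ℕ → V} {r : ℕ}
    (hv : ∀ n ≤ r, formalRes H lam v n = 0) (hw : ∀ n ≤ r, formalRes H lam w n = 0) :
    B (v 0) (formalRes H lam w (r + 1)) = B (formalRes H lam v (r + 1)) (w 0) := by
  -- The two sums are the coefficients of order `r + 1` of `⟨v, (H - λ) w⟩` and `⟨(H - λ) v, w⟩`,
  -- equal because `H` is symmetric and `λ` is real. The vanishing residuals leave one term in each.
  have h1 : ∑ a ∈ Finset.range (r + 2), B (v a) (formalRes H lam w (r + 1 - a)) =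
      B (v 0) (formalRes H lam w (r + 1)) := by
    rw [Finset.sum_range_succ', Finset.sum_eq_zero, zero_add, Nat.sub_zero]
    intro a _
    rw [hw _ (by omega), map_zero]
  have h2 : ∑ a ∈ Finset.range (r + 2), B (formalRes H lam v (r + 1 - a)) (w a) =
      B (formalRes H lam v (r + 1)) (w 0) := by
    rw [Finset.sum_range_succ', Finset.sum_eq_zero, zero_add, Nat.sub_zero]
    intro a _
    rw [hv _ (by omega), map_zero, LinearMap.zero_apply]
  rw [← h1, ← h2]
  simp only [formalRes, map_sum, LinearMap.sum_apply, Finset.sum_sigma']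
  -- The terms are indexed by `a + p + b = r + 1` with `b` implicit; the bijection exchanges `a` and
  -- `b`.
  refine Finset.sum_nbij' (fun x => ⟨r + 1 - x.1 - x.2, x.2⟩) (fun x => ⟨r + 1 - x.1 - x.2, x.2⟩)
    ?_ ?_ ?_ ?_ ?_
  · rintro ⟨a, p⟩ hx
    simp only [Finset.mem_sigma, Finset.mem_range] at hx ⊢
    omega
  · rintro ⟨a, p⟩ hx
    simp only [Finset.mem_sigma, Finset.mem_range] at hx ⊢
    omega
  · rintro ⟨a, p⟩ hx
    simp only [Finset.mem_sigma, Finset.mem_range] at hx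
    simp only [Sigma.mk.injEq, heq_eq_eq, and_true]
    omega
  · rintro ⟨a, p⟩ hx
    simp only [Finset.mem_sigma, Finset.mem_range] at hx
    simp only [Sigma.mk.injEq, heq_eq_eq, and_true]
    omega
  · rintro ⟨a, p⟩ hx
    simp only [Finset.mem_sigma, Finset.mem_range] at hx
    have : r + 1 - (r + 1 - a - p) - p = a := by omega
    simp only [this, map_sub, map_smul, LinearMap.sub_apply, LinearMap.map_smulₛₗ,
      LinearMap.smul_apply, hH, Complex.conj_ofReal]

/-! ### Degenerate perturbation theory, order by order -/

/-- A complete system of formal eigenvectors up to order `r`. -/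
structure FormalEigensystem (B : V →ₗ⋆[ℂ] V →ₗ[ℂ] ℂ) (H : ℕ → V →ₗ[ℂ] V) (b : ι → V) (e : ι → ℝ)
    (r : ℕ) (v : ι → ℕ → V) (lam : ι → ℕ → ℝ) : Prop where
  lam_zero : ∀ l, lam l 0 = e l
  trunc : ∀ l i, r < i → lam l i = 0
  ortho : ∀ k l, k ≠ l → B (v k 0) (v l 0) = 0
  normal : ∀ k, B (v k 0) (v k 0) = 1
  span : ∀ x, x ∈ Submodule.span ℂ (Set.range fun l => v l 0)
  level : ∀ l, v l 0 ∈ Submodule.span ℂ (b '' {k | e k = e l})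
  eqn : ∀ l n, n ≤ r → formalRes H (lam l) (v l) n = 0

namespace FormalEigensystem

variable {B : V →ₗ⋆[ℂ] V →ₗ[ℂ] ℂ} {H : ℕ → V →ₗ[ℂ] V} {b : ι → V} {e : ι → ℝ} {r : ℕ}
  {v : ι → ℕ → V} {lam : ι → ℕ → ℝ}

theorem base (ho : ∀ k l, k ≠ l → B (b k) (b l) = 0) (hn : ∀ k, B (b k) (b k) = 1)
    (hs : ∀ x, x ∈ Submodule.span ℂ (Set.range b)) (h0 : ∀ l, H 0 (b l) = (e l : ℂ) • b l) :
    FormalEigensystem B H b e 0 (fun l i => if i = 0 then b l else 0)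
      (fun l i => if i = 0 then e l else 0) where
  lam_zero l := by simp
  trunc l i hi := by rw [if_neg (by omega)]
  ortho k l hkl := by simpa using ho k l hkl
  normal k := by simpa using hn k
  span x := by simpa using hs x
  level l := by
    simp only [if_true]
    exact Submodule.subset_span ⟨l, rfl, rfl⟩
  eqn l n hn := by
    obtain rfl : n = 0 := by omega
    simp [formalRes, h0]

/-- The leading vectors span algebraically, so the expansion is finite, and orthonormality
identifies its coefficients. No completeness or convergence enters. -/
theorem exists_expansion (h : FormalEigensystem B H b e r v lam) (x : V) :
    ∃ s : Finset ι, x = ∑ k ∈ s, B (v k 0) x • v k 0 ∧ ∀ k, k ∉ s → B (v k 0) x = 0 := by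
  classical
  obtain ⟨c, hc⟩ := Finsupp.mem_span_range_iff_exists_finsupp.1 (h.span x)
  have key : ∀ k, B (v k 0) x = c k := by
    intro k
    rw [← hc, Finsupp.sum, map_sum]
    simp only [map_smul, smul_eq_mul]
    by_cases hk : k ∈ c.support
    · rw [Finset.sum_eq_single_of_mem k hk, h.normal, mul_one]
      intro l _ hl
      rw [h.ortho k l hl.symm, mul_zero]
    · rw [Finsupp.notMem_support_iff.1 hk]
      refine Finset.sum_eq_zero fun l hl => ?_
      rw [h.ortho k l (by rintro rfl; exact hk hl), mul_zero]
  refine ⟨c.support, ?_, fun k hk => by rw [key, Finsupp.notMem_support_iff.1 hk]⟩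
  simp only [key]
  exact hc.symm

/-- Rotation of the eigenvectors with the same formal eigenvalue so that their residuals become
diagonal. -/
theorem exists_diagonal (h : FormalEigensystem B H b e r v lam)
    (hB : ∀ x y, (starRingEnd ℂ) (B x y) = B y x) (hH : ∀ p x y, B (H p x) y = B x (H p y))
    (hfin : ∀ l, {k | e k = e l}.Finite) :
    ∃ w : ι → ℕ → V, FormalEigensystem B H b e r w lam ∧
      (∀ k l, lam k = lam l → k ≠ l →
        B (w k 0) (formalRes H (lam l) (w l) (r + 1)) = 0) ∧
      ∃ m : ι → ℝ, ∀ l, B (w l 0) (formalRes H (lam l) (w l) (r + 1)) = (m l : ℂ) := by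
  classical
  -- Indices are grouped by their entire truncated formal eigenvalue: the equations already solved
  -- are linear for a common `λ`, hence survive any rotation inside a group.
  let S : Setoid ι := Setoid.comap lam ⊥
  have hS : ∀ {k l : ι}, (Quotient.mk S k = Quotient.mk S l) ↔ lam k = lam l := by
    intro k l; exact Quotient.eq
  let κ : Quotient S → Type _ := fun c => {k : ι // Quotient.mk S k = c}
  have hκ : ∀ c, Finite (κ c) := by
    intro c
    induction c using Quotient.inductionOn with
    | h l =>
      -- A group lies inside one level of the leading operator.
      have hl : {k | Quotient.mk S k = Quotient.mk S l}.Finite := by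
        refine (hfin l).subset fun k hk => ?_
        have := congrFun (hS.1 hk) 0
        rwa [h.lam_zero, h.lam_zero] at this
      exact hl.to_subtype
  let _ : ∀ c, Fintype (κ c) := fun c => Fintype.ofFinite (κ c)
  let ρ : ι → V := fun l => formalRes H (lam l) (v l) (r + 1)
  -- The matrix of first uncancelled residuals inside a group. It is Hermitian by `formalRes_symm`;
  -- its eigenvalues will be the eigenvalue coefficients of order `r + 1`.
  let G : ∀ c, Matrix (κ c) (κ c) ℂ := fun c => Matrix.of fun x y => B (v x.1 0) (ρ y.1)
  have hG : ∀ c, (G c).IsHermitian := by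
    intro c
    ext x y
    have hxy : lam y.1 = lam x.1 := hS.1 (y.2.trans x.2.symm)
    simp only [Matrix.conjTranspose_apply, G, Matrix.of_apply, ρ]
    rw [← starRingEnd_apply, hB]
    have := formalRes_symm hH (lam x.1) (v := v x.1) (w := v y.1) (h.eqn x.1)
      (fun n hn => by rw [← hxy]; exact h.eqn y.1 n hn)
    rw [← this, hxy]
  let u : ∀ c, κ c → κ c → ℂ := fun c z x => (hG c).eigenvectorBasis z x
  have huo : ∀ c (z z' : κ c), ∑ x, (starRingEnd ℂ) (u c z x) * u c z' x = if z = z' then 1 else 0 := by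
    intro c z z'
    have := (orthonormal_iff_ite.1 (hG c).eigenvectorBasis.orthonormal) z z'
    rw [PiLp.inner_apply] at this
    simp only [RCLike.inner_apply] at this
    rw [← this]
    exact Finset.sum_congr rfl fun x _ => mul_comm _ _
  have hue : ∀ c (z x : κ c), ∑ y, G c x y * u c z y = ((hG c).eigenvalues z : ℂ) * u c z x := by
    intro c z x
    have := congrFun ((hG c).mulVec_eigenvectorBasis z) x
    simpa [Matrix.mulVec, dotProduct] using this
  -- Completeness of the eigenbasis, needed to recover the old leading vectors from the rotated ones
  -- and so to keep the spanning property.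
  have huc : ∀ c (x y : κ c), ∑ z, (starRingEnd ℂ) (u c z x) * u c z y = if x = y then 1 else 0 := by
    intro c x y
    have := congrArg (fun w : EuclideanSpace ℂ (κ c) => w y)
      ((hG c).eigenvectorBasis.sum_repr' (EuclideanSpace.single x (1 : ℂ)))
    simp only [EuclideanSpace.inner_single_right, one_mul] at this
    simpa [u, Pi.single_apply, eq_comm] using this
  let w₀ : ∀ c, κ c → ℕ → V := fun c z i => ∑ x, u c z x • v x.1 i
  let w : ι → ℕ → V := fun l => w₀ (Quotient.mk S l) ⟨l, rfl⟩
  have hw : ∀ c (z : κ c), w z.1 = w₀ c z := by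
    rintro c ⟨l, rfl⟩; rfl
  have hres : ∀ c (z : κ c) (lam' : ℕ → ℝ) n, formalRes H lam' (w₀ c z) n =
      ∑ x, u c z x • formalRes H lam' (v x.1) n := fun c z lam' n =>
    formalRes_sum Finset.univ (u c z) H lam' (fun x : κ c => v x.1) n
  have hBw : ∀ c c' (z : κ c) (z' : κ c'), B (w₀ c z 0) (w₀ c' z' 0) =
      ∑ x, ∑ y, (starRingEnd ℂ) (u c z x) * (u c' z' y * B (v x.1 0) (v y.1 0)) := by
    intro c c' z z'
    simp only [w₀, map_sum, LinearMap.sum_apply, LinearMap.map_smulₛₗ, LinearMap.smul_apply,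
      map_smul, smul_eq_mul, Finset.mul_sum]
    rw [Finset.sum_comm]
    exact Finset.sum_congr rfl fun x _ => Finset.sum_congr rfl fun y _ => by ring
  have hBv : ∀ c (x y : κ c), B (v x.1 0) (v y.1 0) = if x = y then 1 else 0 := by
    intro c x y
    split_ifs with hxy
    · rw [hxy]; exact h.normal _
    · exact h.ortho _ _ fun he => hxy (Subtype.ext he)
  have hBw' : ∀ c (z z' : κ c), B (w₀ c z 0) (w₀ c z' 0) = if z = z' then 1 else 0 := by
    intro c z z'
    rw [hBw, ← huo c z z']
    refine Finset.sum_congr rfl fun x _ => ?_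
    rw [Finset.sum_eq_single x]
    · rw [hBv, if_pos rfl, mul_one]
    · intro y _ hy
      rw [hBv, if_neg hy.symm, mul_zero, mul_zero]
    · simp
  have hBr : ∀ c (z z' : κ c), B (w z.1 0) (formalRes H (lam z'.1) (w z'.1) (r + 1)) =
      if z = z' then ((hG c).eigenvalues z' : ℂ) else 0 := by
    intro c z z'
    have e1 : formalRes H (lam z'.1) (w z'.1) (r + 1) = ∑ y, u c z' y • ρ y.1 := by
      rw [hw, hres]
      refine Finset.sum_congr rfl fun y _ => ?_
      rw [hS.1 (z'.2.trans y.2.symm)]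
    rw [e1, hw]
    have e2 : B (w₀ c z 0) (∑ y, u c z' y • ρ y.1) =
        ∑ x, (starRingEnd ℂ) (u c z x) * ∑ y, G c x y * u c z' y := by
      simp only [w₀, map_sum, LinearMap.sum_apply, LinearMap.map_smulₛₗ, LinearMap.smul_apply,
        map_smul, smul_eq_mul, Finset.mul_sum, G, Matrix.of_apply]
      rw [Finset.sum_comm]
      refine Finset.sum_congr rfl fun x _ => Finset.sum_congr rfl fun y _ => ?_
      ring
    rw [e2]
    simp only [hue]
    have e3 : ∀ x, (starRingEnd ℂ) (u c z x) * (((hG c).eigenvalues z' : ℂ) * u c z' x) =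
        ((hG c).eigenvalues z' : ℂ) * ((starRingEnd ℂ) (u c z x) * u c z' x) := fun x => by ring
    simp only [e3]
    rw [← Finset.mul_sum, huo]
    split_ifs <;> simp
  refine ⟨w, ⟨h.lam_zero, h.trunc, ?_, ?_, ?_, ?_, ?_⟩, ?_, ?_⟩
  · intro k l hkl
    by_cases hc : lam k = lam l
    · have := hBw' (Quotient.mk S l) ⟨k, hS.2 hc⟩ ⟨l, rfl⟩
      rw [← hw, ← hw, if_neg (fun he => hkl (congrArg Subtype.val he))] at this
      exact this
    · refine (hBw _ _ _ _).trans (Finset.sum_eq_zero fun x _ => Finset.sum_eq_zero fun y _ => ?_)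
      rw [h.ortho x.1 y.1, mul_zero, mul_zero]
      intro he
      apply hc
      rw [← hS.1 x.2, ← hS.1 y.2, he]
  · intro k
    have := hBw' (Quotient.mk S k) ⟨k, rfl⟩ ⟨k, rfl⟩
    rwa [if_pos rfl] at this
  · intro x
    refine Submodule.span_le.2 ?_ (h.span x)
    rintro _ ⟨l, rfl⟩
    have e1 : v l 0 = ∑ z : κ (Quotient.mk S l),
        (starRingEnd ℂ) (u (Quotient.mk S l) z ⟨l, rfl⟩) • w z.1 0 := by
      simp only [hw, w₀, Finset.smul_sum, smul_smul]
      rw [Finset.sum_comm]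
      simp only [← Finset.sum_smul, huc]
      rw [Finset.sum_eq_single (⟨l, rfl⟩ : κ (Quotient.mk S l))]
      · rw [if_pos rfl, one_smul]
      · intro y _ hy
        rw [if_neg hy.symm, zero_smul]
      · simp
    simp only [SetLike.mem_coe]
    rw [e1]
    exact Submodule.sum_mem _ fun z _ => Submodule.smul_mem _ _ (Submodule.subset_span ⟨z.1, rfl⟩)
  · intro l
    refine Submodule.sum_mem _ fun x _ => Submodule.smul_mem _ _ ?_
    have := congrFun (hS.1 x.2) 0
    rw [h.lam_zero, h.lam_zero] at this
    have hl := h.level x.1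
    rwa [this] at hl
  · intro l n hn
    refine (hres _ _ _ _).trans (Finset.sum_eq_zero fun x _ => ?_)
    rw [← hS.1 x.2, h.eqn x.1 n hn, smul_zero]
  · intro k l hkl hne
    have := hBr (Quotient.mk S l) ⟨k, hS.2 hkl⟩ ⟨l, rfl⟩
    rwa [if_neg (fun he => hne (congrArg Subtype.val he))] at this
  · refine ⟨fun l => (hG (Quotient.mk S l)).eigenvalues ⟨l, rfl⟩, fun l => ?_⟩
    have := hBr (Quotient.mk S l) ⟨l, rfl⟩ ⟨l, rfl⟩
    rwa [if_pos rfl] at this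

/-- After diagonalization the residual at order `r + 1` is expanded in the leading vectors. Its
component along `v l 0` is absorbed into the eigenvalue, and components along the rest of the group
vanish. A component along `v k 0` with a different formal eigenvalue is cancelled by a multiple of
the `k`-th series, delayed so that the first gap between the eigenvalues acts exactly at order `r +
1`. Thus degeneracies that split only at a higher order are covered. -/
theorem exists_succ (h : FormalEigensystem B H b e r v lam)
    (hB : ∀ x y, (starRingEnd ℂ) (B x y) = B y x) (hH : ∀ p x y, B (H p x) y = B x (H p y))
    (hfin : ∀ l, {k | e k = e l}.Finite) :
    ∃ (w : ι → ℕ → V) (lam' : ι → ℕ → ℝ), FormalEigensystem B H b e (r + 1) w lam' := by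
  classical
  obtain ⟨v, h, hoff, m, hm⟩ := h.exists_diagonal hB hH hfin
  choose s hs hs0 using fun l => h.exists_expansion (formalRes H (lam l) (v l) (r + 1))
  -- The first order at which two formal eigenvalues separate; it is at most `r` because both
  -- sequences vanish beyond `r`.
  have hdiff : ∀ k l, lam k ≠ lam l → ∃ i, i ≤ r ∧ lam k i ≠ lam l i ∧ ∀ p < i, lam k p = lam l p := by
    intro k l hkl
    have hex : ∃ i, lam k i ≠ lam l i := Function.ne_iff.1 hkl
    refine ⟨Nat.find hex, ?_, Nat.find_spec hex, fun p hp => not_not.1 (Nat.find_min hex hp)⟩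
    by_contra hlt
    exact Nat.find_spec hex (by rw [h.trunc _ _ (by omega), h.trunc _ _ (by omega)])
  choose! d hdr hdne hdlt using hdiff
  let g : ι → ι → ℂ := fun k l => B (v k 0) (formalRes H (lam l) (v l) (r + 1))
  -- Chosen so that `c` times the gap at order `d` cancels the component `g k l`.
  let c : ι → ι → ℂ := fun k l => -g k l / ((lam k (d k l) - lam l (d k l) : ℝ) : ℂ)
  let s' : ι → Finset ι := fun l => (s l).filter fun k => lam k ≠ lam l
  -- With the gap at order `d`, the delay `r + 1 - d` makes the correction contribute first at order
  -- `r + 1`. Since `d ≤ r` the delay is positive and the leading vectors do not change.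
  let w : ι → ℕ → V := fun l i =>
    v l i + ∑ k ∈ s' l, c k l • formalShift (r + 1 - d k l) (v k) i
  let lam' : ι → ℕ → ℝ := fun l i => lam l i + if i = r + 1 then m l else 0
  have hw0 : ∀ l, w l 0 = v l 0 := by
    intro l
    simp only [w]
    rw [Finset.sum_eq_zero, add_zero]
    intro k hk
    have := hdr k l (Finset.mem_filter.1 hk).2
    rw [formalShift, if_neg (by omega), smul_zero]
  -- Tested against the eigenvalue of `l`, the `k`-th series has up to order `r` the residual `(λ_k
  -- - λ_l) v_k`, whose lowest term sits at order `d`.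
  have hshift : ∀ k l, lam k ≠ lam l → ∀ n ≤ r + 1,
      formalRes H (lam l) (formalShift (r + 1 - d k l) (v k)) n =
        if n = r + 1 then ((lam k (d k l) - lam l (d k l) : ℝ) : ℂ) • v k 0 else 0 := by
    intro k l hkl n hn
    have h1 := hdr k l hkl
    rw [formalRes_shift]
    split_ifs with h2 h3 h3
    · subst h3
      rw [show r + 1 - (r + 1 - d k l) = d k l by omega, formalRes_change H (lam k),
        h.eqn k _ h1, zero_add, Finset.sum_range_succ, Finset.sum_eq_zero, zero_add, Nat.sub_self]
      intro p hp
      rw [hdlt k l hkl p (Finset.mem_range.1 hp), sub_self]; simp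
    · rw [formalRes_change H (lam k), h.eqn k _ (by omega), zero_add]
      refine Finset.sum_eq_zero fun p hp => ?_
      have := Finset.mem_range.1 hp
      rw [hdlt k l hkl p (by omega), sub_self]; simp
    · omega
    · rfl
  refine ⟨w, lam', ⟨fun l => ?_, fun l i hi => ?_, ?_, ?_, ?_, ?_, fun l n hn => ?_⟩⟩
  · simp [lam', h.lam_zero]
  · simp only [lam']
    rw [h.trunc l i (by omega), if_neg (by omega), add_zero]
  · simpa only [hw0] using h.ortho
  · simpa only [hw0] using h.normal
  · simpa only [hw0] using h.span
  · simpa only [hw0] using h.level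
  · have e1 : formalRes H (lam l) (w l) n = formalRes H (lam l) (v l) n +
        ∑ k ∈ s' l, c k l • formalRes H (lam l) (formalShift (r + 1 - d k l) (v k)) n := by
      simp only [w]
      rw [formalRes_add, formalRes_sum]
    have e2 : ∑ p ∈ Finset.range (n + 1), ((lam l p - lam' l p : ℝ) : ℂ) • w l (n - p) =
        if n = r + 1 then -((m l : ℂ) • v l 0) else 0 := by
      simp only [lam', sub_add_cancel_left]
      rw [Finset.sum_range_succ, Finset.sum_eq_zero, zero_add, Nat.sub_self, hw0]
      · split_ifs <;> simp
      · intro p hp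
        have := Finset.mem_range.1 hp
        rw [if_neg (by omega)]; simp
    rw [formalRes_change H (lam l), e1, e2]
    have e3 : ∑ k ∈ s' l, c k l • formalRes H (lam l) (formalShift (r + 1 - d k l) (v k)) n =
        if n = r + 1 then ∑ k ∈ s' l, -(g k l • v k 0) else 0 := by
      split_ifs with hnr
      · refine Finset.sum_congr rfl fun k hk => ?_
        have hkl := (Finset.mem_filter.1 hk).2
        rw [hshift k l hkl n hn, if_pos hnr, smul_smul, ← neg_smul]
        congr 1
        have : ((lam k (d k l) - lam l (d k l) : ℝ) : ℂ) ≠ 0 := by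
          exact_mod_cast sub_ne_zero.2 (hdne k l hkl)
        simp only [c]
        field_simp
      · refine Finset.sum_eq_zero fun k hk => ?_
        rw [hshift k l (Finset.mem_filter.1 hk).2 n hn, if_neg hnr, smul_zero]
    rw [e3]
    split_ifs with hnr
    · subst hnr
      -- Inside the group of `l` the rotation has left only the diagonal component.
      have e4 : ∑ k ∈ (s l).filter (fun k => ¬ lam k ≠ lam l), g k l • v k 0 = (m l : ℂ) • v l 0 := by
        by_cases hl : l ∈ s l
        · rw [Finset.sum_eq_single_of_mem l (by simp [hl])]
          · simp only [g, hm]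
          · intro k hk hkl
            have := (Finset.mem_filter.1 hk).2
            simp only [g]
            rw [hoff k l (not_not.1 this) hkl, zero_smul]
        · have : (m l : ℂ) = 0 := by rw [← hm]; exact hs0 l l hl
          rw [this, zero_smul]
          refine Finset.sum_eq_zero fun k hk => ?_
          have hk' := Finset.mem_filter.1 hk
          simp only [g]
          rw [hoff k l (not_not.1 hk'.2) (by rintro rfl; exact hl hk'.1), zero_smul]
      have e5 := Finset.sum_filter_add_sum_filter_not (s l) (fun k => lam k ≠ lam l)
        (fun k => g k l • v k 0)
      rw [e4] at e5
      rw [Finset.sum_neg_distrib]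
      nth_rewrite 1 [hs l]
      rw [← e5]
      abel
    · rw [h.eqn l n (by omega)]; simp

/-- The recursion may change leading vectors. On a simple level it can only introduce a phase, which
is removed at the end; for `r = 0` no step of the recursion is taken and the given basis itself
serves. -/
theorem exists_system (hB : ∀ x y, (starRingEnd ℂ) (B x y) = B y x)
    (hH : ∀ p x y, B (H p x) y = B x (H p y)) (hfin : ∀ l, {k | e k = e l}.Finite)
    (ho : ∀ k l, k ≠ l → B (b k) (b l) = 0) (hn : ∀ k, B (b k) (b k) = 1)
    (hs : ∀ x, x ∈ Submodule.span ℂ (Set.range b)) (h0 : ∀ l, H 0 (b l) = (e l : ℂ) • b l) (r : ℕ) :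
    ∃ (v : ι → ℕ → V) (lam : ι → ℕ → ℝ), FormalEigensystem B H b e r v lam ∧
      ∀ l, (r = 0 ∨ ∀ k, k ≠ l → e k ≠ e l) → v l 0 = b l := by
  classical
  rcases Nat.eq_zero_or_pos r with rfl | hr
  · exact ⟨_, _, base ho hn hs h0, fun l _ => by simp⟩
  have hex : ∃ (v : ι → ℕ → V) (lam : ι → ℕ → ℝ), FormalEigensystem B H b e r v lam := by
    clear hr
    induction r with
    | zero => exact ⟨_, _, base ho hn hs h0⟩
    | succ r ih =>
      obtain ⟨v, lam, h⟩ := ih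
      exact h.exists_succ hB hH hfin
  obtain ⟨v, lam, h⟩ := hex
  have hphase : ∀ l, ∃ c : ℂ, (starRingEnd ℂ) c * c = 1 ∧
      ((∀ k, k ≠ l → e k ≠ e l) → c • v l 0 = b l) := by
    intro l
    by_cases hl : ∀ k, k ≠ l → e k ≠ e l
    · have hset : {k | e k = e l} = {l} := by
        ext k
        simp only [Set.mem_ofPred_eq, Set.mem_singleton_iff]
        exact ⟨fun hk => by_contra fun hne => hl k hne hk, fun hk => by rw [hk]⟩
      have hv := h.level l
      rw [hset, Set.image_singleton, Submodule.mem_span_singleton] at hv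
      obtain ⟨a, ha⟩ := hv
      have h1 := h.normal l
      simp only [← ha, LinearMap.map_smulₛₗ, LinearMap.smul_apply, map_smul, hn, smul_eq_mul,
        mul_one] at h1
      rw [mul_comm] at h1
      refine ⟨(starRingEnd ℂ) a, by rw [Complex.conj_conj, mul_comm]; exact h1, fun _ => ?_⟩
      rw [← ha, smul_smul, h1, one_smul]
    · exact ⟨1, by simp, fun h => absurd h hl⟩
  choose c hc hcb using hphase
  have hc0 : ∀ l, c l ≠ 0 := fun l hl => by simpa [hl] using hc l
  refine ⟨fun l i => c l • v l i, lam, ⟨h.lam_zero, h.trunc, ?_, ?_, ?_, ?_, ?_⟩, ?_⟩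
  · intro k l hkl
    simp [h.ortho k l hkl]
  · intro k
    simp only [LinearMap.map_smulₛₗ, LinearMap.smul_apply, map_smul, smul_eq_mul, h.normal, mul_one]
    rw [mul_comm]; exact hc k
  · intro x
    refine Submodule.span_le.2 ?_ (h.span x)
    rintro _ ⟨l, rfl⟩
    have : v l 0 = (c l)⁻¹ • (c l • v l 0) := by rw [smul_smul, inv_mul_cancel₀ (hc0 l), one_smul]
    simp only [SetLike.mem_coe]
    rw [this]
    exact Submodule.smul_mem _ _ (Submodule.subset_span ⟨l, rfl⟩)
  · intro l
    exact Submodule.smul_mem _ _ (h.level l)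
  · intro l n hn
    rw [formalRes_smul, h.eqn l n hn, smul_zero]
  · rintro l (h' | h')
    · omega
    · exact hcb l h'

end FormalEigensystem

end FormalPerturbation

end

noncomputable section

open MeasureTheory

/-! ### Hermite functions -/

theorem hasDerivAt_conj_mul_polyGauss {ω : ℝ} (p q : ℂ[X]) (y : ℝ) :
    HasDerivAt (fun y => (starRingEnd ℂ) (polyGauss ω p y) * polyGauss ω q y)
      ((starRingEnd ℂ) (polyGauss ω (gaussDeriv ω p) y) * polyGauss ω q y +
        (starRingEnd ℂ) (polyGauss ω p y) * polyGauss ω (gaussDeriv ω q) y) y := by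
  have h1 := (Complex.conjCLE.toContinuousLinearMap.hasFDerivAt.comp_hasDerivAt y
    (hasDerivAt_polyGauss ω p y))
  exact h1.mul (hasDerivAt_polyGauss ω q y)

/-- The inner product of amplitudes in `L²(e^{-ω y²} dy)`. -/
def ampInner (ω : ℝ) (p q : ℂ[X]) : ℂ :=
  ∫ y : ℝ, (starRingEnd ℂ) (polyGauss ω p y) * polyGauss ω q y

section

variable {ω : ℝ}

theorem integrable_ampInner (hω : 0 < ω) (p q : ℂ[X]) :
    Integrable (fun y => (starRingEnd ℂ) (polyGauss ω p y) * polyGauss ω q y) :=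
  integrable_conj_mul (unifSchwartz_polyGauss Unit hω p) (unifSchwartz_polyGauss Unit hω q) ()

theorem ampInner_conj (p q : ℂ[X]) : (starRingEnd ℂ) (ampInner ω p q) = ampInner ω q p := by
  unfold ampInner
  rw [← integral_conj]
  congr 1; funext y
  rw [map_mul, Complex.conj_conj, mul_comm]

theorem ampInner_add_right (hω : 0 < ω) (p q r : ℂ[X]) :
    ampInner ω p (q + r) = ampInner ω p q + ampInner ω p r := by
  unfold ampInner
  rw [← integral_add (integrable_ampInner hω p q) (integrable_ampInner hω p r)]
  congr 1; funext y
  rw [polyGauss_add]; ring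

theorem ampInner_smul_right (c : ℂ) (p q : ℂ[X]) :
    ampInner ω p (c • q) = c * ampInner ω p q := by
  unfold ampInner
  rw [← integral_const_mul]
  congr 1; funext y
  rw [polyGauss_smul]; ring

theorem ampInner_add_left (hω : 0 < ω) (p q r : ℂ[X]) :
    ampInner ω (p + q) r = ampInner ω p r + ampInner ω q r := by
  rw [← ampInner_conj, ampInner_add_right hω, map_add, ampInner_conj, ampInner_conj]

theorem ampInner_smul_left (c : ℂ) (p q : ℂ[X]) :
    ampInner ω (c • p) q = (starRingEnd ℂ) c * ampInner ω p q := by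
  rw [← ampInner_conj, ampInner_smul_right, map_mul, ampInner_conj]

theorem ampInner_X_mul (p q : ℂ[X]) :
    ampInner ω (Polynomial.X * p) q = ampInner ω p (Polynomial.X * q) := by
  unfold ampInner
  congr 1; funext y
  rw [polyGauss_X_mul, polyGauss_X_mul, map_mul, Complex.conj_ofReal]; ring

theorem ampInner_gaussDeriv (hω : 0 < ω) (p q : ℂ[X]) :
    ampInner ω (gaussDeriv ω p) q + ampInner ω p (gaussDeriv ω q) = 0 := by
  unfold ampInner
  have h1 := integrable_ampInner hω (gaussDeriv ω p) q
  have h2 := integrable_ampInner hω p (gaussDeriv ω q)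
  rw [← integral_add h1 h2]
  exact integral_eq_zero_of_hasDerivAt_of_integrable
    (hasDerivAt_conj_mul_polyGauss p q) (h1.add h2) (integrable_ampInner hω p q)

theorem derivative_hermite_succ (n : ℕ) : Polynomial.derivative (Polynomial.hermite (n + 1)) =
    ((n + 1 : ℕ) : ℤ[X]) * Polynomial.hermite n := by
  induction n with
  | zero => simp
  | succ n ih =>
    rw [Polynomial.hermite_succ (n + 1), map_sub, Polynomial.derivative_mul, ih,
      Polynomial.derivative_mul, Polynomial.derivative_X, Polynomial.derivative_natCast]
    have := Polynomial.hermite_succ n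
    push_cast
    linear_combination (-(n : ℤ[X]) - 1) * this

/-- `He_n(√(2ω) y)`. -/
def hermiteScaled (ω : ℝ) (n : ℕ) : ℂ[X] :=
  ((Polynomial.hermite n).map (Int.castRingHom ℂ)).comp
    (Polynomial.C ((Real.sqrt (2 * ω) : ℝ) : ℂ) * Polynomial.X)

theorem derivative_hermiteScaled_zero : Polynomial.derivative (hermiteScaled ω 0) = 0 := by
  simp [hermiteScaled]

theorem derivative_hermiteScaled_succ (n : ℕ) : Polynomial.derivative (hermiteScaled ω (n + 1)) =
    (((Real.sqrt (2 * ω) : ℝ) : ℂ) * ((n + 1 : ℕ) : ℂ)) • hermiteScaled ω n := by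
  rw [hermiteScaled, Polynomial.derivative_comp, Polynomial.derivative_map,
    derivative_hermite_succ, Polynomial.smul_eq_C_mul]
  simp [hermiteScaled]
  ring

theorem hermiteScaled_succ (hω : 0 < ω) (n : ℕ) :
    ((Real.sqrt (2 * ω) : ℝ) : ℂ) • hermiteScaled ω (n + 1) =
      (2 * ω : ℂ) • (Polynomial.X * hermiteScaled ω n) -
        Polynomial.derivative (hermiteScaled ω n) := by
  have hs : ((Real.sqrt (2 * ω) : ℝ) : ℂ) * ((Real.sqrt (2 * ω) : ℝ) : ℂ) = 2 * ω := by
    rw [← Complex.ofReal_mul, Real.mul_self_sqrt (by positivity)]; push_cast; ring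
  have e : hermiteScaled ω (n + 1) =
      Polynomial.C ((Real.sqrt (2 * ω) : ℝ) : ℂ) * Polynomial.X * hermiteScaled ω n -
      (((Polynomial.hermite n).derivative).map (Int.castRingHom ℂ)).comp
        (Polynomial.C ((Real.sqrt (2 * ω) : ℝ) : ℂ) * Polynomial.X) := by
    rw [hermiteScaled, Polynomial.hermite_succ]
    simp [hermiteScaled]
  have e2 : Polynomial.derivative (hermiteScaled ω n) =
      Polynomial.C ((Real.sqrt (2 * ω) : ℝ) : ℂ) *
      (((Polynomial.hermite n).derivative).map (Int.castRingHom ℂ)).comp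
        (Polynomial.C ((Real.sqrt (2 * ω) : ℝ) : ℂ) * Polynomial.X) := by
    rw [hermiteScaled, Polynomial.derivative_comp, Polynomial.derivative_map]
    simp
  rw [e, e2, Polynomial.smul_eq_C_mul, Polynomial.smul_eq_C_mul, ← hs, Polynomial.C_mul]
  ring

/-- Skew-symmetry of `d/dy` on the full functions, with the Gaussian factors worked out: lowering
and raising operators are mutually adjoint. -/
theorem ampInner_derivative (hω : 0 < ω) (p q : ℂ[X]) :
    ampInner ω p (Polynomial.derivative q) =
      ampInner ω ((2 * ω : ℂ) • (Polynomial.X * p) - Polynomial.derivative p) q := by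
  have h := ampInner_gaussDeriv hω p q
  have e1 : gaussDeriv ω p = Polynomial.derivative p + (-(ω : ℂ)) • (Polynomial.X * p) := by
    rw [gaussDeriv_apply, Polynomial.smul_eq_C_mul, Polynomial.C_neg]; ring
  have e2 : gaussDeriv ω q = Polynomial.derivative q + (-(ω : ℂ)) • (Polynomial.X * q) := by
    rw [gaussDeriv_apply, Polynomial.smul_eq_C_mul, Polynomial.C_neg]; ring
  have e3 : (2 * ω : ℂ) • (Polynomial.X * p) - Polynomial.derivative p =
      (2 * ω : ℂ) • (Polynomial.X * p) + (-1 : ℂ) • Polynomial.derivative p := by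
    rw [neg_one_smul, sub_eq_add_neg]
  rw [e1, e2, ampInner_add_left hω, ampInner_add_right hω, ampInner_smul_left, ampInner_smul_right,
    ampInner_X_mul, map_neg, Complex.conj_ofReal] at h
  rw [e3, ampInner_add_left hω, ampInner_smul_left, ampInner_smul_left, ampInner_X_mul]
  have : (starRingEnd ℂ) (2 * (ω : ℂ)) = 2 * ω := by
    rw [map_mul, Complex.conj_ofReal, map_ofNat]
  rw [this]
  simp only [map_neg, map_one]
  linear_combination h

/-- A raising operator on the left becomes a derivative on the right and lowers the index there.
Iteration ends in the Gaussian integral or in the derivative of a constant. -/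
theorem ampInner_hermiteScaled (hω : 0 < ω) (n m : ℕ) :
    ampInner ω (hermiteScaled ω n) (hermiteScaled ω m) =
      if n = m then (n.factorial : ℂ) * ((Real.sqrt (Real.pi / ω) : ℝ) : ℂ) else 0 := by
  have hs : ((Real.sqrt (2 * ω) : ℝ) : ℂ) ≠ 0 := by
    exact_mod_cast (Real.sqrt_pos.2 (by positivity : 0 < 2 * ω)).ne'
  have step : ∀ n q, ((Real.sqrt (2 * ω) : ℝ) : ℂ) * ampInner ω (hermiteScaled ω (n + 1)) q =
      ampInner ω (hermiteScaled ω n) (Polynomial.derivative q) := by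
    intro n q
    rw [ampInner_derivative hω, ← hermiteScaled_succ hω, ampInner_smul_left, Complex.conj_ofReal]
  have hz : ∀ n, ampInner ω (hermiteScaled ω (n + 1)) (hermiteScaled ω 0) = 0 := by
    intro n
    have := step n (hermiteScaled ω 0)
    rw [derivative_hermiteScaled_zero] at this
    have h0 : ampInner ω (hermiteScaled ω n) 0 = 0 := by simp [ampInner, polyGauss]
    rw [h0] at this
    exact (mul_eq_zero.1 this).resolve_left hs
  induction n generalizing m with
  | zero =>
    rcases m with - | m
    · rw [if_pos rfl]
      have : (fun y : ℝ => (starRingEnd ℂ) (polyGauss ω (hermiteScaled ω 0) y) *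
          polyGauss ω (hermiteScaled ω 0) y) = fun y : ℝ => ((Real.exp (-ω * y ^ 2) : ℝ) : ℂ) := by
        funext y
        simp only [polyGauss, hermiteScaled, Polynomial.hermite_zero, map_one, Polynomial.map_one,
          Polynomial.one_comp, Polynomial.eval_one, mul_one, Complex.conj_ofReal]
        rw [← Complex.ofReal_mul, ← Real.exp_add]
        congr 2; ring
      rw [ampInner, this]
      have h2 := integral_ofReal (𝕜 := ℂ) (f := fun y : ℝ => Real.exp (-ω * y ^ 2)) (μ := volume)
      refine h2.trans ?_
      rw [integral_gaussian]
      simp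
    · rw [if_neg (by omega), ← ampInner_conj, hz, map_zero]
  | succ n ih =>
    rcases m with - | m
    · rw [if_neg (by omega), hz]
    · have := step n (hermiteScaled ω (m + 1))
      rw [derivative_hermiteScaled_succ, ampInner_smul_right, ih, mul_assoc] at this
      rw [mul_left_cancel₀ hs this]
      by_cases h : n = m
      · subst h
        rw [if_pos rfl, if_pos rfl, Nat.factorial_succ]; push_cast; ring
      · rw [if_neg h, if_neg (by omega), mul_zero]

/-- The normalizing factor of the Hermite amplitudes. -/
def hermiteFactor (ω : ℝ) (n : ℕ) : ℝ :=
  (Real.sqrt (2 ^ n * (n.factorial : ℝ)))⁻¹ * (ω / Real.pi) ^ ((1 : ℝ) / 4) * Real.sqrt 2 ^ n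

theorem hermiteFactor_pos (hω : 0 < ω) (n : ℕ) : 0 < hermiteFactor ω n := by
  unfold hermiteFactor; positivity

/-- The Hermite amplitude as a polynomial. -/
def hermitePoly (ω : ℝ) (n : ℕ) : ℂ[X] := (hermiteFactor ω n : ℂ) • hermiteScaled ω n

theorem eval_hermitePoly (n : ℕ) (y : ℝ) :
    (hermitePoly ω n).eval (y : ℂ) = ((hermiteAmp ω n y : ℝ) : ℂ) := by
  have key : ∀ t : ℝ, ((Polynomial.hermite n).map (Int.castRingHom ℂ)).eval (t : ℂ) =
      ((Polynomial.aeval t (Polynomial.hermite n) : ℝ) : ℂ) := by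
    intro t
    rw [Polynomial.eval_map, Polynomial.aeval_def]
    have h := Polynomial.hom_eval₂ (Polynomial.hermite n) (algebraMap ℤ ℝ) Complex.ofRealHom t
    rw [RingHom.ext_int (Complex.ofRealHom.comp (algebraMap ℤ ℝ)) (Int.castRingHom ℂ)] at h
    exact h.symm
  rw [hermitePoly, Polynomial.eval_smul, hermiteScaled, Polynomial.eval_comp, Polynomial.eval_mul,
    Polynomial.eval_C, Polynomial.eval_X, ← Complex.ofReal_mul, key, smul_eq_mul,
    ← Complex.ofReal_mul, hermiteAmp, hermiteH, hermiteFactor,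
    Real.sqrt_mul (by norm_num : (0 : ℝ) ≤ 2) ω, mul_assoc (Real.sqrt 2)]
  congr 1
  ring

theorem ampInner_hermitePoly (hω : 0 < ω) (n m : ℕ) :
    ampInner ω (hermitePoly ω n) (hermitePoly ω m) = if n = m then 1 else 0 := by
  rw [hermitePoly, hermitePoly, ampInner_smul_left, ampInner_smul_right,
    ampInner_hermiteScaled hω, Complex.conj_ofReal]
  split_ifs with h
  · subst h
    rw [← mul_assoc, ← Complex.ofReal_mul]
    have h1 : hermiteFactor ω n * hermiteFactor ω n * ((n.factorial : ℝ) *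
        Real.sqrt (Real.pi / ω)) = 1 := by
      have e1 : (Real.sqrt (2 ^ n * (n.factorial : ℝ)))⁻¹ * (Real.sqrt (2 ^ n * (n.factorial : ℝ)))⁻¹
          = (2 ^ n * (n.factorial : ℝ))⁻¹ := by
        rw [← mul_inv, Real.mul_self_sqrt (by positivity)]
      have e2 : (ω / Real.pi) ^ ((1 : ℝ) / 4) * (ω / Real.pi) ^ ((1 : ℝ) / 4) =
          Real.sqrt (ω / Real.pi) := by
        rw [← Real.rpow_add (by positivity), Real.sqrt_eq_rpow]; norm_num
      have e3 : Real.sqrt 2 ^ n * Real.sqrt 2 ^ n = 2 ^ n := by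
        rw [← mul_pow, Real.mul_self_sqrt (by norm_num)]
      have e4 : Real.sqrt (ω / Real.pi) * Real.sqrt (Real.pi / ω) = 1 := by
        rw [← Real.sqrt_mul (by positivity), div_mul_div_comm, mul_comm ω, div_self (by positivity),
          Real.sqrt_one]
      have hf : (n.factorial : ℝ) ≠ 0 := by exact_mod_cast n.factorial_ne_zero
      calc _ = ((Real.sqrt (2 ^ n * (n.factorial : ℝ)))⁻¹ *
            (Real.sqrt (2 ^ n * (n.factorial : ℝ)))⁻¹) *
            ((ω / Real.pi) ^ ((1 : ℝ) / 4) * (ω / Real.pi) ^ ((1 : ℝ) / 4)) *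
            (Real.sqrt 2 ^ n * Real.sqrt 2 ^ n) * (n.factorial * Real.sqrt (Real.pi / ω)) := by
            unfold hermiteFactor; ring
        _ = (2 ^ n * (n.factorial : ℝ))⁻¹ * (2 ^ n * n.factorial) *
            (Real.sqrt (ω / Real.pi) * Real.sqrt (Real.pi / ω)) := by rw [e1, e2, e3]; ring
        _ = 1 := by rw [e4, inv_mul_cancel₀ (by positivity), mul_one]
    exact_mod_cast h1
  · simp

/-- The Hermite amplitudes are eigenvectors of the harmonic oscillator. -/
theorem oscillator_hermitePoly (hω : 0 < ω) (n : ℕ) :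
    monoOp ω 2 0 (hermitePoly ω n) + ((ω : ℂ) ^ 2) • monoOp ω 0 2 (hermitePoly ω n) =
      (((2 * (n : ℝ) + 1) * ω : ℝ) : ℂ) • hermitePoly ω n := by
  have e1 : ∀ p, monoOp ω 2 0 p = -(gaussDeriv ω (gaussDeriv ω p)) := by
    intro p
    simp only [monoOp, pow_two, Module.End.mul_apply, LinearMap.smul_apply, map_smul, smul_smul]
    simp
  have e2 : ∀ p, monoOp ω 0 2 p = Polynomial.X * (Polynomial.X * p) := by
    intro p
    simp only [monoOp, pow_zero, LinearMap.smul_apply, LinearMap.add_apply, LinearMap.comp_apply,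
      Module.End.one_apply, LinearMap.mulLeft_apply]
    simp only [mul_add, mul_smul_comm]
    module
  have h : monoOp ω 2 0 (hermiteScaled ω n) + ((ω : ℂ) ^ 2) • monoOp ω 0 2 (hermiteScaled ω n) =
      (((2 * (n : ℝ) + 1) * ω : ℝ) : ℂ) • hermiteScaled ω n := by
    -- Hermite's differential equation in the scaled variable, from one lowering and one raising
    -- step.
    have hde : Polynomial.derivative (Polynomial.derivative (hermiteScaled ω n)) =
        (2 * ω : ℂ) • (Polynomial.X * Polynomial.derivative (hermiteScaled ω n)) -
          (2 * ω * n : ℂ) • hermiteScaled ω n := by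
      rcases n with - | n
      · rw [derivative_hermiteScaled_zero]; simp
      · have h1 := hermiteScaled_succ hω n
        have hs : ((Real.sqrt (2 * ω) : ℝ) : ℂ) * ((Real.sqrt (2 * ω) : ℝ) : ℂ) = 2 * ω := by
          rw [← Complex.ofReal_mul, Real.mul_self_sqrt (by positivity)]; push_cast; ring
        rw [derivative_hermiteScaled_succ, Polynomial.derivative_smul,
          show Polynomial.derivative (hermiteScaled ω n) =
          (2 * ω : ℂ) • (Polynomial.X * hermiteScaled ω n) -
            ((Real.sqrt (2 * ω) : ℝ) : ℂ) • hermiteScaled ω (n + 1) by rw [h1]; abel, ← hs]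
        simp only [Polynomial.smul_eq_C_mul, Polynomial.C_mul]
        ring
    rw [e1, e2]
    simp only [gaussDeriv_apply, map_sub, Polynomial.derivative_mul, Polynomial.derivative_C,
      Polynomial.derivative_X, hde, Polynomial.smul_eq_C_mul]
    push_cast
    simp only [Polynomial.C_mul, Polynomial.C_add, Polynomial.C_pow, Polynomial.C_1]
    have : (Polynomial.C (2 : ℂ) : ℂ[X]) = 2 := rfl
    rw [this]
    ring
  rw [hermitePoly, map_smul, map_smul, smul_comm _ (hermiteFactor ω n : ℂ), ← smul_add, h,
    smul_comm]

/-- The span contains 1 and is stable under multiplication by `X`, by the three-term recurrence.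
This algebraic spanning is all that the formal construction asks for. -/
theorem mem_span_hermitePoly (hω : 0 < ω) (p : ℂ[X]) :
    p ∈ Submodule.span ℂ (Set.range (hermitePoly ω)) := by
  set S := Submodule.span ℂ (Set.range (hermitePoly ω)) with hS
  have ha : ∀ n, hermiteScaled ω n ∈ S := by
    intro n
    have h0 : (hermiteFactor ω n : ℂ) ≠ 0 := by exact_mod_cast (hermiteFactor_pos hω n).ne'
    have : hermiteScaled ω n = (hermiteFactor ω n : ℂ)⁻¹ • hermitePoly ω n := by
      rw [hermitePoly, smul_smul, inv_mul_cancel₀ h0, one_smul]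
    rw [this]
    exact S.smul_mem _ (Submodule.subset_span ⟨n, rfl⟩)
  have hd : ∀ n, Polynomial.derivative (hermiteScaled ω n) ∈ S := by
    rintro (- | n)
    · rw [derivative_hermiteScaled_zero]; exact S.zero_mem
    · rw [derivative_hermiteScaled_succ]; exact S.smul_mem _ (ha n)
  have hX : ∀ q ∈ S, Polynomial.X * q ∈ S := by
    intro q hq
    induction hq using Submodule.span_induction with
    | mem q h =>
      obtain ⟨n, rfl⟩ := h
      have h0 : (2 * ω : ℂ) ≠ 0 := by
        simp only [ne_eq, mul_eq_zero, OfNat.ofNat_ne_zero, false_or]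
        exact_mod_cast hω.ne'
      have h1 : (2 * ω : ℂ) • (Polynomial.X * hermiteScaled ω n) =
          ((Real.sqrt (2 * ω) : ℝ) : ℂ) • hermiteScaled ω (n + 1) +
            Polynomial.derivative (hermiteScaled ω n) := by
        rw [hermiteScaled_succ hω]; abel
      have h2 : Polynomial.X * hermitePoly ω n = ((hermiteFactor ω n : ℂ) * (2 * ω : ℂ)⁻¹) •
          ((2 * ω : ℂ) • (Polynomial.X * hermiteScaled ω n)) := by
        rw [smul_smul, mul_assoc, inv_mul_cancel₀ h0, mul_one, hermitePoly, mul_smul_comm]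
      rw [h2, h1]
      exact S.smul_mem _ (S.add_mem (S.smul_mem _ (ha _)) (hd _))
    | zero => rw [mul_zero]; exact S.zero_mem
    | add a b _ _ h1 h2 => rw [mul_add]; exact S.add_mem h1 h2
    | smul c a _ h => rw [mul_smul_comm]; exact S.smul_mem _ h
  have h1 : (1 : ℂ[X]) ∈ S := by
    have := ha 0
    simpa [hermiteScaled] using this
  have hpow : ∀ n : ℕ, (Polynomial.X : ℂ[X]) ^ n ∈ S := by
    intro n
    induction n with
    | zero => simpa using h1
    | succ n ih => rw [pow_succ']; exact hX _ ih
  induction p using Polynomial.induction_on' with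
  | add p q hp hq => exact S.add_mem hp hq
  | monomial n a =>
    rw [← Polynomial.C_mul_X_pow_eq_monomial, ← Polynomial.smul_eq_C_mul]
    exact S.smul_mem _ (hpow n)

/-- The inner product of pairs of amplitudes, as a sesquilinear form. -/
def ampForm (hω : 0 < ω) : (Fin 2 → ℂ[X]) →ₗ⋆[ℂ] (Fin 2 → ℂ[X]) →ₗ[ℂ] ℂ :=
  LinearMap.mk₂'ₛₗ (starRingEnd ℂ) (RingHom.id ℂ)
    (fun p q => ∑ r, ampInner ω (p r) (q r))
    (fun p p' q => by simp only [Pi.add_apply, ampInner_add_left hω, Finset.sum_add_distrib])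
    (fun c p q => by simp only [Pi.smul_apply, ampInner_smul_left, ← Finset.mul_sum, smul_eq_mul])
    (fun p q q' => by simp only [Pi.add_apply, ampInner_add_right hω, Finset.sum_add_distrib])
    (fun c p q => by
      simp only [Pi.smul_apply, ampInner_smul_right, ← Finset.mul_sum, smul_eq_mul,
        RingHom.id_apply])

theorem ampForm_apply (hω : 0 < ω) (p q : Fin 2 → ℂ[X]) :
    ampForm hω p q = ∑ r, ampInner ω (p r) (q r) := rfl

theorem ampForm_conj (hω : 0 < ω) (p q : Fin 2 → ℂ[X]) :
    (starRingEnd ℂ) (ampForm hω p q) = ampForm hω q p := by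
  simp only [ampForm_apply, map_sum, ampInner_conj]

theorem ampForm_eq_integral (hω : 0 < ω) (p q : Fin 2 → ℂ[X]) :
    ampForm hω p q = ∫ y : ℝ, inner ℂ (polyGaussVec ω p y) (polyGaussVec ω q y) := by
  simp only [inner_C2]
  rw [ampForm_apply]
  exact (integral_finsetSum Finset.univ fun r _ => integrable_ampInner hω (p r) (q r)).symm

theorem gaussInner_polyVec (hω : 0 < ω) (p q : Fin 2 → ℂ[X]) :
    gaussInner ω (polyVec p) (polyVec q) = ampForm hω p q := by
  rw [ampForm_eq_integral, gaussInner]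
  congr 1; funext y
  rw [polyGaussVec_eq, polyGaussVec_eq, inner_smul_left, inner_smul_right, Complex.conj_ofReal,
    ← mul_assoc, ← Complex.ofReal_mul, ← Real.exp_add]
  congr 3; ring

/-- The oscillator amplitudes as pairs of polynomials. -/
def oscPoly (ω : ℝ) (l : Fin 2 × ℕ) : Fin 2 → ℂ[X] := Pi.single l.1 (hermitePoly ω l.2)

theorem polyVec_oscPoly (l : Fin 2 × ℕ) :
    polyVec (oscPoly ω l) = oscAmp ω l.1 l.2 := by
  funext y
  ext r
  simp only [polyVec, oscPoly, oscAmp, EuclideanSpace.single, Pi.single_apply]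
  by_cases h : r = l.1
  · subst h; simp [eval_hermitePoly]
  · simp [h]

theorem ampForm_oscPoly (hω : 0 < ω) (k l : Fin 2 × ℕ) :
    ampForm hω (oscPoly ω k) (oscPoly ω l) = if k = l then 1 else 0 := by
  obtain ⟨i, n⟩ := k
  obtain ⟨j, m⟩ := l
  have hz : ∀ p, ampInner ω 0 p = 0 := fun p => by simp [ampInner, polyGauss]
  have hz' : ∀ p, ampInner ω p 0 = 0 := fun p => by simp [ampInner, polyGauss]
  rw [ampForm_apply, Finset.sum_eq_single i]
  · by_cases hij : i = j
    · subst hij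
      simp [oscPoly, ampInner_hermitePoly hω]
    · simp [oscPoly, hij, hz']
  · intro r _ hr
    simp [oscPoly, Pi.single_apply, hr, hz]
  · simp

theorem mem_span_oscPoly (hω : 0 < ω) (q : Fin 2 → ℂ[X]) :
    q ∈ Submodule.span ℂ (Set.range (oscPoly ω)) := by
  have h : q = ∑ j, LinearMap.single ℂ (fun _ : Fin 2 => ℂ[X]) j (q j) := by
    simp [Fin.sum_univ_two]
    ext r; fin_cases r <;> simp
  rw [h]
  refine Submodule.sum_mem _ fun j _ => ?_
  have := Submodule.mem_map_of_mem (f := LinearMap.single ℂ (fun _ : Fin 2 => ℂ[X]) j)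
    (mem_span_hermitePoly hω (q j))
  rw [Submodule.map_span] at this
  refine Submodule.span_mono ?_ this
  rintro _ ⟨_, ⟨n, rfl⟩, rfl⟩
  exact ⟨(j, n), rfl⟩

/-- As `ω > 0`, each of the two oscillators attains a given energy at most once. -/
theorem finite_level (hω : 0 < ω) (μ : Fin 2 → ℝ) (l : Fin 2 × ℕ) :
    {k : Fin 2 × ℕ | oscEnergy ω μ k.1 k.2 = oscEnergy ω μ l.1 l.2}.Finite := by
  refine Set.Finite.of_finite_image (f := Prod.fst) (Set.toFinite _) ?_
  rintro ⟨i, n⟩ hn ⟨j, m⟩ hm hij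
  have hij : i = j := hij
  subst hij
  have h : oscEnergy ω μ i n = oscEnergy ω μ i m := Eq.trans hn (Eq.symm hm)
  unfold oscEnergy at h
  have h2 : (2 * (n : ℝ) + 1) * ω = (2 * (m : ℝ) + 1) * ω := by linarith
  have h3 := mul_right_cancel₀ hω.ne' h2
  have : (n : ℝ) = m := by linarith
  rw [Nat.cast_inj.1 this]

end

end

noncomputable section

open MeasureTheory

/-! ### Expansion of the rescaled symbol -/

section SymbolExpansion

variable {P : ℝ → ℝ → ℝ → Mat2} {Pk : ℕ → ℝ → ℝ → Mat2}

theorem IsS1.unifSym {A : ℝ → ℝ → Mat2} (hA : IsS1 A) (ι : Type*) (K : ℕ) :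
    UnifSymMat K (fun _ : ι => A) := by
  intro r s
  obtain ⟨h1, h2⟩ := hA r s
  refine ⟨fun _ => h1, fun j k => ?_⟩
  obtain ⟨C, hC⟩ := h2 j k
  refine ⟨|C|, fun _ x ξ => (hC x ξ).trans ((le_abs_self C).trans ?_)⟩
  exact le_mul_of_one_le_right (abs_nonneg C) (one_le_symWeight K x ξ)

theorem IsKN.unifSym {A : ℝ → ℝ → Mat2} {m : ℤ} {K : ℕ} (hA : IsKN m A) (hm : m ≤ K) (ι : Type*) :
    UnifSymMat K (fun _ : ι => A) := by
  intro r s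
  obtain ⟨h1, h2⟩ := hA r s
  refine ⟨fun _ => h1, fun j k => ?_⟩
  obtain ⟨C, hC⟩ := h2 j k
  refine ⟨|C|, fun _ x ξ => (hC x ξ).trans ?_⟩
  have h3 : (1 + |ξ|) ^ (m - (j : ℤ)) ≤ symWeight K x ξ := by
    calc (1 + |ξ|) ^ (m - (j : ℤ)) ≤ (1 + |ξ|) ^ (K : ℤ) :=
          zpow_le_zpow_right₀ (by linarith [abs_nonneg ξ]) (by omega)
      _ = 1 * (1 + |ξ|) ^ K := by rw [zpow_natCast, one_mul]
      _ ≤ _ := by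
        unfold symWeight
        gcongr
        exact one_le_pow₀ (by linarith [abs_nonneg x])
  exact mul_le_mul (le_abs_self C) h3 (by positivity) (abs_nonneg C)

namespace HasSymbolExpansion

/-- The weight exponent 2 accommodates both alternatives for the symbol classes, since `2 - k ≤ 2`;
they need not be distinguished again. -/
theorem coeff (hP : HasSymbolExpansion P Pk) (ι : Type*) (k : ℕ) :
    UnifSymMat 2 (fun _ : ι => Pk k) := by
  rcases hP.classes with h | h
  · exact (h k).unifSym ι 2
  · exact (h k).unifSym (by push_cast; omega) ι

/-- The expansion hypothesis controls remainders only after at least two terms, hence `2 ≤ M`. -/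
theorem remainder_unif (hP : HasSymbolExpansion P Pk) {M : ℕ} (hM : 2 ≤ M) (r s : Fin 2) :
    UnifSym 2 (fun (h : HIdx) x ξ => (((h : ℝ) : ℂ) ^ M)⁻¹ *
      (P h x ξ r s - ∑ k ∈ Finset.range M, ((h : ℝ) : ℂ) ^ k * Pk k x ξ r s)) := by
  obtain ⟨N, rfl⟩ : ∃ N, M = N + 1 := ⟨M - 1, by omega⟩
  obtain ⟨h1, h2⟩ := hP.remainder N (by omega) r s
  have e : ∀ (h : ℝ), (fun x ξ => (P h x ξ - ∑ k ∈ Finset.range (N + 1), ((h : ℂ) ^ k) • Pk k x ξ) r s)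
      = fun x ξ => P h x ξ r s - ∑ k ∈ Finset.range (N + 1), (h : ℂ) ^ k * Pk k x ξ r s := by
    intro h; funext x ξ
    simp [Matrix.sum_apply]
  simp only [e] at h1 h2
  refine ⟨fun h => contDiff_const.mul (h1 h h.2), fun j k => ?_⟩
  obtain ⟨C, hC⟩ := h2 j k
  refine ⟨|C|, fun h x ξ => ?_⟩
  have hp : (0 : ℝ) < h := h.2.1
  rw [mixedDeriv_const_mul (h1 h h.2), norm_mul, norm_inv, norm_pow, Complex.norm_real,
    Real.norm_of_nonneg hp.le]
  calc _ ≤ ((h : ℝ) ^ (N + 1))⁻¹ * (C * (h : ℝ) ^ (N + 1)) := by gcongr; exact hC h h.2 x ξ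
    _ = C := by field_simp
    _ ≤ |C| * 1 := by rw [mul_one]; exact le_abs_self C
    _ ≤ _ := by gcongr; exact one_le_symWeight 2 x ξ

theorem norm_pow_le_one (h : HIdx) (k : ℕ) : ‖((h : ℝ) : ℂ) ^ k‖ ≤ 1 := by
  rw [norm_pow, Complex.norm_real, Real.norm_of_nonneg h.2.1.le]
  exact pow_le_one₀ h.2.1.le h.2.2.le

theorem unifSymMat (hP : HasSymbolExpansion P Pk) : UnifSymMat 2 (fun h : HIdx => P h) := by
  intro r s
  have h1 := (hP.remainder_unif le_rfl r s).const_mul (c := fun h : HIdx => ((h : ℝ) : ℂ) ^ 2)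
    (fun h => norm_pow_le_one h 2)
  have h2 := UnifSym.sum (Finset.range 2) (f := fun k (h : HIdx) x ξ =>
    ((h : ℝ) : ℂ) ^ k * Pk k x ξ r s) (fun k _ => (hP.coeff HIdx k r s).const_mul
      (c := fun h : HIdx => ((h : ℝ) : ℂ) ^ k) (fun h => norm_pow_le_one h k))
  have h3 := h1.add h2
  convert h3 using 1
  funext h x ξ
  have hp : ((h : ℝ) : ℂ) ≠ 0 := by exact_mod_cast h.2.1.ne'
  rw [mul_inv_cancel_left₀ (pow_ne_zero 2 hp)]
  ring

theorem unifSymMat_normalForm (hP : HasSymbolExpansion P Pk) (ξ₀ : ℝ) :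
    UnifSymMat 2 (fun h : HIdx => normalForm P ξ₀ h) := fun r s =>
  (hP.unifSymMat r s).rescale ξ₀

end HasSymbolExpansion

/-! ### Expansion of the rescaled symbol in powers of `h^{1/2}` -/

/-- The coefficient of `h^{i/2}` in the expansion of the rescaled symbol. -/
def normalCoeff (Pk : ℕ → ℝ → ℝ → Mat2) (ξ₀ : ℝ) (i : ℕ) (y η : ℝ) : Mat2 :=
  Matrix.of fun r s => ∑ k ∈ Finset.range (i + 1),
    if 2 * k ≤ i then taylorHom (fun x ξ => Pk k x ξ r s) ξ₀ (i - 2 * k) y η else 0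

theorem normalCoeff_mem_polySymbols (Pk : ℕ → ℝ → ℝ → Mat2) (ξ₀ : ℝ) (i : ℕ) (r s : Fin 2) :
    (fun y η => normalCoeff Pk ξ₀ i y η r s) ∈ polySymbols := by
  have : (fun y η => normalCoeff Pk ξ₀ i y η r s) = ∑ k ∈ Finset.range (i + 1),
      if 2 * k ≤ i then taylorHom (fun x ξ => Pk k x ξ r s) ξ₀ (i - 2 * k) else 0 := by
    funext y η
    simp only [normalCoeff, Matrix.of_apply, Finset.sum_apply]
    refine Finset.sum_congr rfl fun k _ => ?_
    split_ifs <;> rfl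
  rw [this]
  refine Submodule.sum_mem _ fun k _ => ?_
  split_ifs
  · exact taylorHom_mem_polySymbols _ _ _
  · exact Submodule.zero_mem _

/-- `h^k = ε^{2k}` multiplies Taylor parts of degree `i` carrying `ε^i`; the terms are collected by
the total power. Any cutoff `M ≥ N` in `k` will do, because the inner sum is empty once `2k ≥ N`. -/
theorem sum_pow_mul_taylor (Pk : ℕ → ℝ → ℝ → Mat2) (ξ₀ : ℝ) (N M : ℕ) (hNM : N ≤ M) (ε : ℂ)
    (y η : ℝ) (r s : Fin 2) :
    ∑ i ∈ Finset.range N, ε ^ i * normalCoeff Pk ξ₀ i y η r s =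
      ∑ k ∈ Finset.range M, ε ^ (2 * k) * ∑ i ∈ Finset.range (N - 2 * k),
        ε ^ i * taylorHom (fun x ξ => Pk k x ξ r s) ξ₀ i y η := by
  have h1 : ∀ i ∈ Finset.range N, ε ^ i * normalCoeff Pk ξ₀ i y η r s =
      ∑ k ∈ Finset.range M, if 2 * k ≤ i then
        ε ^ i * taylorHom (fun x ξ => Pk k x ξ r s) ξ₀ (i - 2 * k) y η else 0 := by
    intro i hi
    have := Finset.mem_range.1 hi
    simp only [normalCoeff, Matrix.of_apply, Finset.mul_sum, mul_ite, mul_zero]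
    refine Finset.sum_subset (Finset.range_subset_range.2 (by omega)) fun k _ hk => ?_
    rw [Finset.mem_range] at hk
    rw [if_neg (by omega)]
  rw [Finset.sum_congr rfl h1, Finset.sum_comm]
  refine Finset.sum_congr rfl fun k _ => ?_
  have hf : (Finset.range N).filter (fun i => 2 * k ≤ i) = Finset.Ico (2 * k) N := by
    ext i; simp only [Finset.mem_filter, Finset.mem_range, Finset.mem_Ico]; tauto
  rw [← Finset.sum_filter, hf, Finset.sum_Ico_eq_sum_range, Finset.mul_sum]
  refine Finset.sum_congr rfl fun i _ => ?_
  rw [show 2 * k + i - 2 * k = i by omega, pow_add]; ring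

theorem HIdx.sqrt_sq (h : HIdx) : ((Real.sqrt h : ℝ) : ℂ) ^ 2 = ((h : ℝ) : ℂ) := by
  rw [← Complex.ofReal_pow, Real.sq_sqrt h.2.1.le]

theorem HIdx.sqrt_ne_zero (h : HIdx) : ((Real.sqrt h : ℝ) : ℂ) ≠ 0 := by
  exact_mod_cast h.sqrt_pos.ne'

theorem HIdx.norm_sqrt_pow_le_one (h : HIdx) (k : ℕ) : ‖((Real.sqrt h : ℝ) : ℂ) ^ k‖ ≤ 1 := by
  rw [norm_pow, Complex.norm_real, Real.norm_eq_abs]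
  exact pow_le_one₀ (abs_nonneg _) h.abs_sqrt_le_one

/-- The scaled remainder of the expansion of the rescaled symbol. -/
def normalRem (P : ℝ → ℝ → ℝ → Mat2) (Pk : ℕ → ℝ → ℝ → Mat2) (ξ₀ : ℝ) (N : ℕ) (h : HIdx)
    (y η : ℝ) : Mat2 :=
  (((Real.sqrt h : ℝ) : ℂ) ^ N)⁻¹ • (normalForm P ξ₀ h y η -
    ∑ i ∈ Finset.range N, ((Real.sqrt h : ℝ) : ℂ) ^ i • normalCoeff Pk ξ₀ i y η)

/-- Two errors combine: the tail of the expansion in `h`, and for each `P_k` the Taylor remainder of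
order `N - 2k`. A Taylor remainder of order at most `N` raises the weight exponent from 2 to at most
`2 + N`. -/
theorem HasSymbolExpansion.unifSymMat_normalRem (hP : HasSymbolExpansion P Pk) (ξ₀ : ℝ) (N : ℕ) :
    UnifSymMat (2 + N) (normalRem P Pk ξ₀ N) := by
  intro r s
  -- `N + 2` terms are at least two, as required. The tail is of size `ε^(2(N+2)) = ε^(N+4) ε^N`, so
  -- division by `ε^N` leaves the factor `ε^(N+4)`.
  have h1 := (((hP.remainder_unif (M := N + 2) (by omega) r s).rescale ξ₀).const_mul
    (c := fun h : HIdx => ((Real.sqrt h : ℝ) : ℂ) ^ (N + 4))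
    (fun h => h.norm_sqrt_pow_le_one _)).mono (Nat.le_add_right 2 N)
  -- With truncated subtraction the exponent `2k + (N - 2k) - N` is 0 for `2k ≤ N` and `2k - N`
  -- otherwise.
  have h2 := UnifSym.sum (Finset.range (N + 2)) (K := 2 + N) (f := fun k (h : HIdx) y η =>
    ((Real.sqrt h : ℝ) : ℂ) ^ (2 * k + (N - 2 * k) - N) *
      ((((Real.sqrt h : ℝ) : ℂ) ^ (N - 2 * k))⁻¹ *
      (rescale ξ₀ (fun x ξ => Pk k x ξ r s) h y η - ∑ i ∈ Finset.range (N - 2 * k),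
        ((Real.sqrt h : ℝ) : ℂ) ^ i * taylorHom (fun x ξ => Pk k x ξ r s) ξ₀ i y η)))
      (fun k _ => (UnifSym.const_mul (c := fun h : HIdx =>
        ((Real.sqrt h : ℝ) : ℂ) ^ (2 * k + (N - 2 * k) - N)) (unifSym_taylor_remainder
        (hP.coeff Unit k r s) ξ₀ (N - 2 * k)) (fun h => h.norm_sqrt_pow_le_one _)).mono (by omega))
  convert h1.add h2 using 1
  funext h y η
  have hε := h.sqrt_ne_zero
  have hh := h.sqrt_sq
  have e0 : normalRem P Pk ξ₀ N h y η r s = (((Real.sqrt h : ℝ) : ℂ) ^ N)⁻¹ *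
      (normalForm P ξ₀ h y η r s -
        ∑ i ∈ Finset.range N, ((Real.sqrt h : ℝ) : ℂ) ^ i * normalCoeff Pk ξ₀ i y η r s) := by
    simp [normalRem, Matrix.sum_apply]
  rw [e0, sum_pow_mul_taylor Pk ξ₀ N (N + 2) (by omega)]
  simp only [rescale, normalForm]
  set ε : ℂ := ((Real.sqrt h : ℝ) : ℂ)
  have hp : ∀ k : ℕ, ((h : ℝ) : ℂ) ^ k = ε ^ (2 * k) := fun k => by rw [← hh, ← pow_mul]
  simp only [hp]
  have e1 : ∀ k, ε ^ (2 * k + (N - 2 * k) - N) * ((ε ^ (N - 2 * k))⁻¹ *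
      (Pk k (Real.sqrt h * y) (Real.sqrt h * η + ξ₀) r s - ∑ i ∈ Finset.range (N - 2 * k),
        ε ^ i * taylorHom (fun x ξ => Pk k x ξ r s) ξ₀ i y η)) =
      (ε ^ N)⁻¹ * (ε ^ (2 * k) * Pk k (Real.sqrt h * y) (Real.sqrt h * η + ξ₀) r s -
        ε ^ (2 * k) * ∑ i ∈ Finset.range (N - 2 * k),
        ε ^ i * taylorHom (fun x ξ => Pk k x ξ r s) ξ₀ i y η) := by
    intro k
    have h3 : ε ^ (2 * k + (N - 2 * k) - N) * (ε ^ (N - 2 * k))⁻¹ = (ε ^ N)⁻¹ * ε ^ (2 * k) := by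
      have h4 : ε ^ (2 * k + (N - 2 * k) - N) * ε ^ N = ε ^ (2 * k) * ε ^ (N - 2 * k) := by
        rw [← pow_add, ← pow_add]; congr 1; omega
      field_simp
      linear_combination h4
    rw [← mul_assoc, h3]; ring
  simp only [e1]
  rw [← Finset.mul_sum, Finset.sum_sub_distrib]
  have h5 : ε ^ (N + 4) * (ε ^ (2 * (N + 2)))⁻¹ = (ε ^ N)⁻¹ := by
    rw [show 2 * (N + 2) = N + 4 + N by ring, pow_add ε (N + 4) N, mul_inv,
      mul_inv_cancel_left₀ (pow_ne_zero _ hε)]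
  rw [← mul_assoc, h5]; ring

theorem eq_zero_of_sum_sqrt_le (N : ℕ) {c : ℕ → ℂ} {C : ℝ}
    (h : ∀ h : HIdx, ‖∑ i ∈ Finset.range N, ((Real.sqrt h : ℝ) : ℂ) ^ i * c i‖ ≤
      C * Real.sqrt h ^ N) : ∀ i < N, c i = 0 := by
  refine eq_zero_of_sum_isBigO N (IsBigO.of_bound C ?_)
  filter_upwards [Ioo_mem_nhdsGT (zero_lt_one' ℝ)] with ε hε
  have hs : Real.sqrt (ε ^ 2) = ε := Real.sqrt_sq hε.1.le
  have := h ⟨ε ^ 2, by have := hε.1; positivity, pow_lt_one₀ hε.1.le hε.2 two_ne_zero⟩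
  simp only [hs] at this
  rwa [Real.norm_of_nonneg (pow_nonneg hε.1.le N)]

theorem HasSymbolExpansion.norm_sub_sum_le (hP : HasSymbolExpansion P Pk) (ξ₀ : ℝ) (N : ℕ)
    (y η : ℝ) (r s : Fin 2) : ∃ C : ℝ, ∀ h : HIdx, ‖normalForm P ξ₀ h y η r s -
        ∑ i ∈ Finset.range N, ((Real.sqrt h : ℝ) : ℂ) ^ i * normalCoeff Pk ξ₀ i y η r s‖ ≤
      C * Real.sqrt h ^ N := by
  obtain ⟨C, _, hC⟩ := (hP.unifSymMat_normalRem ξ₀ N r s).norm_le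
  refine ⟨C * symWeight (2 + N) y η, fun h => ?_⟩
  have := hC h y η
  have e0 : normalRem P Pk ξ₀ N h y η r s = (((Real.sqrt h : ℝ) : ℂ) ^ N)⁻¹ *
      (normalForm P ξ₀ h y η r s -
        ∑ i ∈ Finset.range N, ((Real.sqrt h : ℝ) : ℂ) ^ i * normalCoeff Pk ξ₀ i y η r s) := by
    simp [normalRem, Matrix.sum_apply]
  have hp : 0 < Real.sqrt h ^ N := pow_pos h.sqrt_pos N
  rw [e0, norm_mul, norm_inv, norm_pow, Complex.norm_real, Real.norm_of_nonneg h.sqrt_pos.le,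
    inv_mul_le_iff₀ hp] at this
  linarith

/-- Symmetry of `P` passes to each coefficient by uniqueness of asymptotic expansions at a fixed
point; `HasSymbolExpansion` does not impose it on the `P_k`. -/
theorem HasSymbolExpansion.isHermitian_normalCoeff (hP : HasSymbolExpansion P Pk) (ξ₀ : ℝ) (i : ℕ)
    (y η : ℝ) : (normalCoeff Pk ξ₀ i y η).conjTranspose = normalCoeff Pk ξ₀ i y η := by
  ext r s
  obtain ⟨C, hC⟩ := hP.norm_sub_sum_le ξ₀ (i + 1) y η r s
  obtain ⟨D, hD⟩ := hP.norm_sub_sum_le ξ₀ (i + 1) y η s r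
  have key := eq_zero_of_sum_sqrt_le (i + 1) (C := C + D) (c := fun i =>
    (starRingEnd ℂ) (normalCoeff Pk ξ₀ i y η s r) - normalCoeff Pk ξ₀ i y η r s) (fun h => by
      have hherm : (starRingEnd ℂ) (normalForm P ξ₀ h y η s r) = normalForm P ξ₀ h y η r s := by
        have := hP.hermitian h h.2 (Real.sqrt h * y) (Real.sqrt h * η + ξ₀)
        exact congrFun (congrFun this r) s
      have h1 := hC h
      have h2 := hD h
      rw [← RCLike.norm_conj] at h2
      simp only [map_sub, map_sum, map_mul, map_pow, Complex.conj_ofReal, hherm] at h2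
      simp only [mul_sub, Finset.sum_sub_distrib]
      rw [add_mul]
      refine le_trans (le_of_eq ?_) ((norm_sub_le _ _).trans (add_le_add h1 h2))
      congr 1; ring) i (by omega)
  exact sub_eq_zero.1 key

theorem taylorHom_zero (a : ℝ → ℝ → ℂ) (ξ₀ y η : ℝ) : taylorHom a ξ₀ 0 y η = a 0 ξ₀ := by
  simp [taylorHom, monoSym, mixedDeriv_zero_zero]

/-- The Taylor coefficients at the bottom of a potential well. -/
theorem taylorHom_well (hP : HasSymbolExpansion P Pk) {ω ξ₀ : ℝ}
    (hwell : HasPotentialWell (Pk 0) 1 (ω ^ 2) 0 ξ₀) (r s : Fin 2) (y η : ℝ) :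
    taylorHom (fun x ξ => Pk 0 x ξ r s) ξ₀ 0 y η = 0 ∧
    taylorHom (fun x ξ => Pk 0 x ξ r s) ξ₀ 1 y η = 0 ∧
    taylorHom (fun x ξ => Pk 0 x ξ r s) ξ₀ 2 y η =
      ((η ^ 2 + ω ^ 2 * y ^ 2 : ℝ) : ℂ) * (1 : Mat2) r s := by
  set a : ℝ → ℝ → ℂ := fun x ξ => Pk 0 x ξ r s with ha
  obtain ⟨C, _, hC⟩ := (unifSym_taylor_remainder (hP.coeff Unit 0 r s) ξ₀ 3).norm_le
  -- The well condition and Taylor's formula are compared along this ray, and the coefficients of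
  -- `ε⁰`, `ε¹`, `ε²` are read off by uniqueness.
  have hO := (hwell.2.2.2 r s).comp_tendsto (k := fun ε : ℝ => ((ε * y, ε * η + ξ₀) : ℝ × ℝ))
    (l' := 𝓝[>] 0) (by
      have : Continuous (fun ε : ℝ => ((ε * y, ε * η + ξ₀) : ℝ × ℝ)) := by fun_prop
      simpa using (this.tendsto 0).mono_left nhdsWithin_le_nhds)
  set c : ℕ → ℂ := fun i => taylorHom a ξ₀ i y η -
    if i = 2 then ((η ^ 2 + ω ^ 2 * y ^ 2 : ℝ) : ℂ) * (1 : Mat2) r s else 0 with hc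
  have key : ∀ i < 3, c i = 0 := by
    refine eq_zero_of_sum_isBigO 3 ?_
    have h1 : (fun ε : ℝ => a (ε * y) (ε * η + ξ₀) -
        ∑ i ∈ Finset.range 3, (ε : ℂ) ^ i * taylorHom a ξ₀ i y η) =O[𝓝[>] 0] (fun ε : ℝ => ε ^ 3) := by
      refine IsBigO.of_bound (C * symWeight (2 + 3) y η) ?_
      filter_upwards [Ioo_mem_nhdsGT (zero_lt_one' ℝ)] with ε hε
      have hs : Real.sqrt (ε ^ 2) = ε := Real.sqrt_sq hε.1.le
      have := hC ⟨ε ^ 2, by have := hε.1; positivity, pow_lt_one₀ hε.1.le hε.2 two_ne_zero⟩ y η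
      have hp : 0 < ε ^ 3 := pow_pos hε.1 3
      simp only [rescale, hs] at this
      rw [norm_mul, norm_inv, norm_pow, Complex.norm_real, Real.norm_of_nonneg hε.1.le,
        inv_mul_le_iff₀ hp] at this
      rw [Real.norm_of_nonneg hp.le]
      linarith
    have h2 : (fun ε : ℝ => a (ε * y) (ε * η + ξ₀) -
        ((((ε * η) ^ 2 + ω ^ 2 * (ε * y) ^ 2 : ℝ) : ℂ)) * (1 : Mat2) r s) =O[𝓝[>] 0]
        (fun ε : ℝ => ε ^ 3) := by
      have e1 : (fun ε : ℝ => a (ε * y) (ε * η + ξ₀) -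
        ((((ε * η) ^ 2 + ω ^ 2 * (ε * y) ^ 2 : ℝ) : ℂ)) * (1 : Mat2) r s) =
        ((fun p : ℝ × ℝ => (Pk 0 p.1 p.2 - ((1 * (p.2 - ξ₀) ^ 2 + ω ^ 2 * (p.1 - 0) ^ 2 : ℝ) : ℂ) •
          (1 : Mat2)) r s) ∘ fun ε : ℝ => ((ε * y, ε * η + ξ₀) : ℝ × ℝ)) := by
        funext ε
        simp [ha]
      rw [e1]
      refine hO.trans (IsBigO.of_bound (‖((y, η) : ℝ × ℝ)‖ ^ 3) (Eventually.of_forall fun ε => ?_))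
      have e2 : ((ε * y, ε * η + ξ₀) : ℝ × ℝ) - (0, ξ₀) = ε • ((y, η) : ℝ × ℝ) := by
        ext <;> simp
      simp only [Function.comp_apply, e2, norm_smul, norm_pow, norm_norm, norm_mul]
      rw [mul_pow]; exact le_of_eq (mul_comm _ _)
    refine (h2.sub h1).congr_left fun ε => ?_
    simp only [Finset.sum_range_succ, Finset.sum_range_zero, hc]
    norm_num
    ring
  have h0 := key 0 (by norm_num)
  have h1 := key 1 (by norm_num)
  have h2 := key 2 (by norm_num)
  simp only [hc] at h0 h1 h2
  norm_num at h0 h1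
  refine ⟨h0, h1, ?_⟩
  simp only [if_true] at h2
  exact sub_eq_zero.1 h2

/-- Orders 0 and 1 see only the value and gradient of `P₀`, which vanish at the well. At order 2 the
quadratic part of `P₀` meets the value of `P₁`. -/
theorem normalCoeff_well (hP : HasSymbolExpansion P Pk) {ω ξ₀ : ℝ} {μ : Fin 2 → ℝ}
    (hwell : HasPotentialWell (Pk 0) 1 (ω ^ 2) 0 ξ₀)
    (hP1 : Pk 1 0 ξ₀ = Matrix.diagonal (fun j => ((μ j : ℝ) : ℂ))) (y η : ℝ) :
    normalCoeff Pk ξ₀ 0 y η = 0 ∧ normalCoeff Pk ξ₀ 1 y η = 0 ∧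
    normalCoeff Pk ξ₀ 2 y η = Matrix.diagonal (fun j => monoSym 2 0 y η +
      (ω : ℂ) ^ 2 * monoSym 0 2 y η + ((μ j : ℝ) : ℂ)) := by
  refine ⟨?_, ?_, ?_⟩ <;> ext r s <;> obtain ⟨h0, h1, h2⟩ := taylorHom_well hP hwell r s y η
  · simp [normalCoeff, h0]
  · simp [normalCoeff, Finset.sum_range_succ, h1]
  · simp only [normalCoeff, Matrix.of_apply, Finset.sum_range_succ, Finset.sum_range_zero]
    norm_num
    rw [h2, taylorHom_zero, hP1]
    by_cases h : r = s
    · subst h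
      simp [monoSym]
    · simp [h]

end SymbolExpansion

end

noncomputable section

open MeasureTheory

/-! ### Quasimodes on the line -/

section WeylVecLinear

variable {ι : Type*} {K : ℕ} {A B : ι → ℝ → ℝ → Mat2} {φ ψ : ι → ℝ → C2}

theorem UnifSchwartz.smul (hφ : UnifSchwartz φ) {c : ι → ℂ} {D : ℝ} (hc : ∀ i, ‖c i‖ ≤ D) :
    UnifSchwartz (fun i y => c i • φ i y) :=
  hφ.clm (L := fun i => (c i • ContinuousLinearMap.id ℂ C2).restrictScalars ℝ) (B := D) (fun i => by
    rw [ContinuousLinearMap.norm_restrictScalars, norm_smul]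
    exact (mul_le_of_le_one_right (norm_nonneg _) ContinuousLinearMap.norm_id_le).trans (hc i))

theorem weylVec_smul_symbol (c : ℂ) (A : ℝ → ℝ → Mat2) (φ : ℝ → C2) (x : ℝ) :
    weylVec (fun x ξ => c • A x ξ) φ x = c • weylVec A φ x := by
  ext r
  simp only [weylVec_apply, PiLp.smul_apply, Matrix.smul_apply, smul_eq_mul, Finset.mul_sum,
    weylScalar_const_mul_symbol]

theorem weylVec_smul_fun (c : ℂ) (A : ℝ → ℝ → Mat2) (φ : ℝ → C2) (x : ℝ) :
    weylVec A (fun y => c • φ y) x = c • weylVec A φ x := by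
  ext r
  simp only [weylVec_apply, PiLp.smul_apply, smul_eq_mul, Finset.mul_sum,
    weylScalar_const_mul_fun]

theorem weylVec_add_symbol (hA : UnifSymMat K A) (hB : UnifSymMat K B) (hφ : UnifSchwartz φ) (i : ι)
    (x : ℝ) : weylVec (fun x ξ => A i x ξ + B i x ξ) (φ i) x =
      weylVec (A i) (φ i) x + weylVec (B i) (φ i) x := by
  ext r
  simp only [weylVec_apply, PiLp.add_apply, Matrix.add_apply]
  rw [← Finset.sum_add_distrib]
  exact Finset.sum_congr rfl fun s _ => weylScalar_add_symbol (hA r s) (hB r s) (hφ.coord s) i x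

theorem weylVec_sum_symbol {α : Type*} (s : Finset α) {A : α → ι → ℝ → ℝ → Mat2}
    (hA : ∀ b ∈ s, UnifSymMat K (A b)) (hφ : UnifSchwartz φ) (i : ι) (x : ℝ) :
    weylVec (fun x ξ => ∑ b ∈ s, A b i x ξ) (φ i) x = ∑ b ∈ s, weylVec (A b i) (φ i) x := by
  ext r
  simp only [weylVec_apply, WithLp.ofLp_sum, Finset.sum_apply, Matrix.sum_apply]
  rw [Finset.sum_comm]
  exact Finset.sum_congr rfl fun t _ => weylScalar_sum_symbol s (K := K)
    (f := fun b i x ξ => A b i x ξ r t) (fun b hb => hA b hb r t) (hφ.coord t) i x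

theorem weylVec_sum_fun {α : Type*} (s : Finset α) {φ : α → ι → ℝ → C2} (hA : UnifSymMat K A)
    (hφ : ∀ b ∈ s, UnifSchwartz (φ b)) (i : ι) (x : ℝ) :
    weylVec (A i) (fun y => ∑ b ∈ s, φ b i y) x = ∑ b ∈ s, weylVec (A i) (φ b i) x := by
  ext r
  simp only [weylVec_apply, WithLp.ofLp_sum, Finset.sum_apply]
  rw [Finset.sum_comm]
  exact Finset.sum_congr rfl fun t _ => weylScalar_sum_fun s (F := fun i x ξ => A i x ξ r t)
    (f := fun b i y => φ b i y t) (hA r t) (fun b hb => (hφ b hb).coord t) i x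

theorem UnifSymMat.smul (hA : UnifSymMat K A) {c : ι → ℂ} {D : ℝ} (hc : ∀ i, ‖c i‖ ≤ D) :
    UnifSymMat K (fun i x ξ => c i • A i x ξ) := fun r s => (hA r s).const_mul hc

theorem UnifSymMat.sum {α : Type*} (s : Finset α) {A : α → ι → ℝ → ℝ → Mat2}
    (hA : ∀ b ∈ s, UnifSymMat K (A b)) : UnifSymMat K (fun i x ξ => ∑ b ∈ s, A b i x ξ) := by
  intro r t
  simp only [Matrix.sum_apply]
  exact UnifSym.sum s (f := fun b i x ξ => A b i x ξ r t) fun b hb => hA b hb r t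

end WeylVecLinear

theorem HIdx.rpow_half (h : HIdx) (N : ℕ) : (h : ℝ) ^ ((N : ℝ) / 2) = Real.sqrt h ^ N := by
  rw [Real.sqrt_eq_rpow, ← Real.rpow_natCast, ← Real.rpow_mul h.2.1.le]
  congr 1; ring

/-- Error bounds become boundedness of a rescaled family, to which the mapping properties of
quantization and periodization apply. -/
theorem isBigOSchwartz_iff {N : ℕ} {r : ℝ → ℝ → C2} : IsBigOSchwartz ((N : ℝ) / 2) r ↔
    UnifSchwartz (fun (h : HIdx) y => (((Real.sqrt h : ℝ) : ℂ) ^ N)⁻¹ • r h y) := by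
  have hnorm : ∀ h : HIdx, ‖(((Real.sqrt h : ℝ) : ℂ) ^ N)⁻¹‖ = (Real.sqrt h ^ N)⁻¹ := fun h => by
    rw [norm_inv, norm_pow, Complex.norm_real, Real.norm_of_nonneg h.sqrt_pos.le]
  have hit : ∀ (h : HIdx) (q : ℕ) (y : ℝ), ContDiff ℝ ((⊤ : ℕ∞) : WithTop ℕ∞) (r h) →
      iteratedDeriv q (fun y => (((Real.sqrt h : ℝ) : ℂ) ^ N)⁻¹ • r h y) y =
        (((Real.sqrt h : ℝ) : ℂ) ^ N)⁻¹ • iteratedDeriv q (r h) y := fun h q y hr =>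
    iteratedDeriv_clm_comp (((((Real.sqrt h : ℝ) : ℂ) ^ N)⁻¹ •
      ContinuousLinearMap.id ℂ C2).restrictScalars ℝ) hr q y
  have hne : ∀ h : HIdx, (((Real.sqrt h : ℝ) : ℂ) ^ N) ≠ 0 := fun h => pow_ne_zero _ h.sqrt_ne_zero
  constructor
  · rintro ⟨h1, h2⟩
    refine ⟨fun h => (h1 h h.2).const_smul _, fun p q => ?_⟩
    obtain ⟨C, hC⟩ := h2 p q
    refine ⟨C, fun h y => ?_⟩
    rw [hit h q y (h1 h h.2), norm_smul, hnorm]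
    have := hC h h.2 y
    rw [h.rpow_half] at this
    have hp : 0 < Real.sqrt h ^ N := pow_pos h.sqrt_pos N
    calc _ = (Real.sqrt h ^ N)⁻¹ * (|y| ^ p * ‖iteratedDeriv q (r h) y‖) := by ring
      _ ≤ (Real.sqrt h ^ N)⁻¹ * (C * Real.sqrt h ^ N) := by gcongr
      _ = C := by field_simp
  · intro hu
    have hs : ∀ h : HIdx, ContDiff ℝ ((⊤ : ℕ∞) : WithTop ℕ∞) (r h) := fun h => by
      have := (hu.smooth h).const_smul (((Real.sqrt h : ℝ) : ℂ) ^ N)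
      convert this using 1
      funext y
      rw [smul_smul, mul_inv_cancel₀ (hne h), one_smul]
    refine ⟨fun h hh => hs ⟨h, hh⟩, fun p q => ?_⟩
    obtain ⟨C, hC⟩ := hu.bound p q
    refine ⟨C, fun h hh y => ?_⟩
    have := hC ⟨h, hh⟩ y
    rw [hit ⟨h, hh⟩ q y (hs _), norm_smul, hnorm] at this
    have e := HIdx.rpow_half ⟨h, hh⟩ N
    have hp : 0 < Real.sqrt h ^ N := pow_pos (HIdx.sqrt_pos ⟨h, hh⟩) N
    simp only at this e
    rw [e]
    calc _ = Real.sqrt h ^ N * (|y| ^ p * ((Real.sqrt h ^ N)⁻¹ * ‖iteratedDeriv q (r h) y‖)) := by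
          field_simp
      _ ≤ Real.sqrt h ^ N * C := by gcongr
      _ = _ := mul_comm _ _

theorem polyGaussVec_sum {α : Type*} (ω : ℝ) (s : Finset α) (f : α → Fin 2 → ℂ[X]) (y : ℝ) :
    polyGaussVec ω (∑ b ∈ s, f b) y = ∑ b ∈ s, polyGaussVec ω (f b) y := by
  have := congrFun (map_sum (polyGaussLin ω) f s) y
  rw [Finset.sum_apply] at this
  exact this

theorem polyGaussVec_sub (ω : ℝ) (p q : Fin 2 → ℂ[X]) (y : ℝ) :
    polyGaussVec ω (p - q) y = polyGaussVec ω p y - polyGaussVec ω q y :=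
  congrFun (map_sub (polyGaussLin ω) p q) y

/-- The Gaussian never vanishes and a polynomial is determined by its values on the line; identities
of operators on amplitudes can thus be checked on functions. -/
theorem polyGaussVec_injective (ω : ℝ) : Function.Injective (polyGaussVec ω) := by
  intro p q h
  funext r
  refine Polynomial.eq_of_infinite_eval_eq _ _ (Set.Infinite.mono (s := Set.range ((↑) : ℝ → ℂ)) ?_
    (Set.infinite_range_of_injective Complex.ofReal_injective))
  rintro _ ⟨y, rfl⟩
  have h1 : polyGauss ω (p r) y = polyGauss ω (q r) y :=
    congrArg (fun u : C2 => u r) (congrFun h y)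
  have h2 : ((Real.exp (-(ω * y ^ 2 / 2)) : ℝ) : ℂ) ≠ 0 := by exact_mod_cast (Real.exp_pos _).ne'
  exact mul_left_cancel₀ h2 h1

theorem lineMode_eq (ω : ℝ) (ℓ : ℕ) (v : ℕ → Fin 2 → ℂ[X]) (h : HIdx) (y : ℝ) :
    lineMode ω ℓ v h y = ∑ i ∈ Finset.range (2 * ℓ + 1),
      ((Real.sqrt h : ℝ) : ℂ) ^ i • polyGaussVec ω (v i) y := by
  unfold lineMode
  refine Finset.sum_congr rfl fun i _ => ?_
  rw [h.rpow_half, polyGaussVec_eq, smul_smul]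
  push_cast; rfl

theorem unifSchwartz_lineMode {ω : ℝ} (hω : 0 < ω) (ℓ : ℕ) (v : ℕ → Fin 2 → ℂ[X]) :
    UnifSchwartz (fun h : HIdx => lineMode ω ℓ v h) := by
  have := UnifSchwartz.sum (Finset.range (2 * ℓ + 1)) (f := fun i (h : HIdx) y =>
    ((Real.sqrt h : ℝ) : ℂ) ^ i • polyGaussVec ω (v i) y) fun i _ =>
    (unifSchwartz_polyGaussVec HIdx hω (v i)).smul (fun h => h.norm_sqrt_pow_le_one i)
  convert this using 1
  funext h y
  exact lineMode_eq ω ℓ v h y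

theorem approxEigenvalue_eq (ℓ : ℕ) (lam : ℕ → ℝ) (h : HIdx) :
    ((approxEigenvalue ℓ lam h : ℝ) : ℂ) = ((Real.sqrt h : ℝ) : ℂ) ^ 2 *
      ∑ i ∈ Finset.range (2 * ℓ + 1), ((Real.sqrt h : ℝ) : ℂ) ^ i * ((lam i : ℝ) : ℂ) := by
  unfold approxEigenvalue
  rw [h.sqrt_sq]
  push_cast [h.rpow_half]
  rfl

theorem unifSymMat_normalCoeff (ι : Type*) (Pk : ℕ → ℝ → ℝ → Mat2) (ξ₀ : ℝ) {i K : ℕ} (hi : i ≤ K) :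
    UnifSymMat K (fun _ : ι => normalCoeff Pk ξ₀ i) := by
  intro r s
  refine UnifSym.sum (Finset.range (i + 1)) (f := fun k _ y η =>
    if 2 * k ≤ i then taylorHom (fun x ξ => Pk k x ξ r s) ξ₀ (i - 2 * k) y η else 0) fun k _ => ?_
  split_ifs
  · exact unifSym_taylorHom _ _ (by omega)
  · exact UnifSym.zero

/-- The triangle `p + q < m`, where the formal equations hold, is separated from the terms of order
at least `m`. -/
theorem sum_range_mul_range {M : Type*} [AddCommMonoid M] (f : ℕ → ℕ → M) (m : ℕ) :
    ∑ p ∈ Finset.range m, ∑ q ∈ Finset.range m, f p q =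
      ∑ n ∈ Finset.range m, ∑ p ∈ Finset.range (n + 1), f p (n - p) +
        ∑ p ∈ Finset.range m, ∑ q ∈ Finset.Ico (m - p) m, f p q := by
  rw [Finset.sum_range_diag_flip, ← Finset.sum_add_distrib]
  exact Finset.sum_congr rfl fun p _ =>
    (Finset.sum_range_add_sum_Ico (f p) (Nat.sub_le m p)).symm

/-! ### From formal series to quasimodes on the line -/

section LineQuasimode

variable {P : ℝ → ℝ → ℝ → Mat2} {Pk : ℕ → ℝ → ℝ → Mat2} {ξ₀ ω : ℝ} {μ : Fin 2 → ℝ}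

/-- The operators on amplitudes that correspond to the coefficients of the rescaled symbol. -/
theorem exists_normalOp (hω : 0 < ω) (Pk : ℕ → ℝ → ℝ → Mat2) (ξ₀ : ℝ) :
    ∃ H : ℕ → (Fin 2 → ℂ[X]) →ₗ[ℂ] (Fin 2 → ℂ[X]), ∀ i q,
      weylVec (normalCoeff Pk ξ₀ i) (polyGaussVec ω q) = polyGaussVec ω (H i q) := by
  choose H hH using fun i => exists_amplitude_op_mat hω (normalCoeff_mem_polySymbols Pk ξ₀ i)
  exact ⟨H, hH⟩

theorem weylVec_normalForm (hω : 0 < ω) (hP : HasSymbolExpansion P Pk)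
    {H : ℕ → (Fin 2 → ℂ[X]) →ₗ[ℂ] (Fin 2 → ℂ[X])}
    (hH : ∀ i q, weylVec (normalCoeff Pk ξ₀ i) (polyGaussVec ω q) = polyGaussVec ω (H i q))
    (N ℓ : ℕ) (v : ℕ → Fin 2 → ℂ[X]) (h : HIdx) (y : ℝ) :
    weylVec (normalForm P ξ₀ h) (lineMode ω ℓ v h) y =
      ∑ p ∈ Finset.range N, ∑ q ∈ Finset.range (2 * ℓ + 1),
        ((Real.sqrt h : ℝ) : ℂ) ^ (p + q) • polyGaussVec ω (H p (v q)) y +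
      ((Real.sqrt h : ℝ) : ℂ) ^ N • weylVec (normalRem P Pk ξ₀ N h) (lineMode ω ℓ v h) y := by
  have hV := unifSchwartz_lineMode hω ℓ v
  have hT : ∀ p ∈ Finset.range N, UnifSymMat (2 + N) (fun (h : HIdx) y η =>
      ((Real.sqrt h : ℝ) : ℂ) ^ p • normalCoeff Pk ξ₀ p y η) := fun p hp =>
    (unifSymMat_normalCoeff HIdx Pk ξ₀ (by have := Finset.mem_range.1 hp; omega)).smul
      (fun h => h.norm_sqrt_pow_le_one p)
  have e : normalForm P ξ₀ h = fun y η =>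
      ∑ p ∈ Finset.range N, ((Real.sqrt h : ℝ) : ℂ) ^ p • normalCoeff Pk ξ₀ p y η +
      ((Real.sqrt h : ℝ) : ℂ) ^ N • normalRem P Pk ξ₀ N h y η := by
    funext y η
    rw [normalRem, smul_smul, mul_inv_cancel₀ (pow_ne_zero N h.sqrt_ne_zero), one_smul]
    abel
  rw [e, weylVec_add_symbol (UnifSymMat.sum _ hT) ((hP.unifSymMat_normalRem ξ₀ N).smul
      (fun h => h.norm_sqrt_pow_le_one N)) hV h y, weylVec_smul_symbol,
    weylVec_sum_symbol (Finset.range N) hT hV h y]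
  congr 1
  refine Finset.sum_congr rfl fun p _ => ?_
  have e2 : lineMode ω ℓ v h = fun y => ∑ i ∈ Finset.range (2 * ℓ + 1),
      ((Real.sqrt h : ℝ) : ℂ) ^ i • polyGaussVec ω (v i) y := funext (lineMode_eq ω ℓ v h)
  rw [weylVec_smul_symbol, e2, weylVec_sum_fun (Finset.range (2 * ℓ + 1))
    (φ := fun i (h : HIdx) y => ((Real.sqrt h : ℝ) : ℂ) ^ i • polyGaussVec ω (v i) y)
    (unifSymMat_normalCoeff HIdx Pk ξ₀ (le_refl p)) (fun i _ =>
      (unifSchwartz_polyGaussVec HIdx hω (v i)).smul (fun h => h.norm_sqrt_pow_le_one i)) h y,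
    Finset.smul_sum]
  refine Finset.sum_congr rfl fun q _ => ?_
  rw [weylVec_smul_fun, hH, smul_smul, pow_add]

/-- Solutions of the formal eigenvalue equation give quasimodes. -/
theorem isBigOSchwartz_of_formalRes (hω : 0 < ω) (hP : HasSymbolExpansion P Pk)
    {H : ℕ → (Fin 2 → ℂ[X]) →ₗ[ℂ] (Fin 2 → ℂ[X])}
    (hH : ∀ i q, weylVec (normalCoeff Pk ξ₀ i) (polyGaussVec ω q) = polyGaussVec ω (H i q))
    (hH0 : H 0 = 0) (hH1 : H 1 = 0) (ℓ : ℕ) {v : ℕ → Fin 2 → ℂ[X]} {lam : ℕ → ℝ}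
    (hres : ∀ n ≤ 2 * ℓ, formalRes (fun p => H (p + 2)) lam v n = 0) :
    IsBigOSchwartz ((ℓ : ℝ) + 3 / 2) (fun h y =>
      weyl 1 (normalForm P ξ₀ h) (lineMode ω ℓ v h) y -
        ((approxEigenvalue ℓ lam h : ℝ) : ℂ) • lineMode ω ℓ v h y) := by
  have hV := unifSchwartz_lineMode hω ℓ v
  -- `2ℓ + 1` retained coefficients, plus two because the operator itself starts at order `ε² = h`.
  rw [show (ℓ : ℝ) + 3 / 2 = ((2 * ℓ + 1 + 2 : ℕ) : ℝ) / 2 by push_cast; ring, isBigOSchwartz_iff]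
  set m := 2 * ℓ + 1 with hm
  -- The products with `p + q ≥ m` are not cancelled; divided by `ε^(m+2)` they keep the nonnegative
  -- power `p + q - m`.
  have h1 := UnifSchwartz.sum (Finset.range m) (f := fun p (h : HIdx) y =>
    ∑ q ∈ Finset.Ico (m - p) m, ((Real.sqrt h : ℝ) : ℂ) ^ (p + q - m) •
      polyGaussVec ω (H (p + 2) (v q) - (lam p : ℂ) • v q) y) fun p _ =>
    UnifSchwartz.sum (Finset.Ico (m - p) m) (f := fun q (h : HIdx) y =>
      ((Real.sqrt h : ℝ) : ℂ) ^ (p + q - m) •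
      polyGaussVec ω (H (p + 2) (v q) - (lam p : ℂ) • v q) y) fun q _ =>
      (unifSchwartz_polyGaussVec HIdx hω _).smul (fun h => h.norm_sqrt_pow_le_one _)
  have h2 := UnifSchwartz.weylVec (hP.unifSymMat_normalRem ξ₀ (m + 2)) hV
  convert h1.add h2 using 1
  funext h y
  have hε := h.sqrt_ne_zero
  rw [weyl_one_eq_weylVec (hP.unifSymMat_normalForm ξ₀) hV h,
    weylVec_normalForm hω hP hH (m + 2) ℓ v h y, approxEigenvalue_eq]
  rw [Finset.sum_range_succ', Finset.sum_range_succ']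
  have hz : polyGaussVec ω 0 y = 0 := congrFun (map_zero (polyGaussLin ω)) y
  simp only [hH0, hH1, zero_add, LinearMap.zero_apply, hz, smul_zero, Finset.sum_const_zero,
    add_zero, ← hm]
  rw [lineMode_eq, ← hm]
  set ε : ℂ := ((Real.sqrt h : ℝ) : ℂ)
  have e3 : (ε ^ 2 * ∑ i ∈ Finset.range m, ε ^ i * ((lam i : ℝ) : ℂ)) •
      ∑ i ∈ Finset.range m, ε ^ i • polyGaussVec ω (v i) y =
      ∑ p ∈ Finset.range m, ∑ q ∈ Finset.range m,
        ε ^ (p + 1 + 1 + q) • polyGaussVec ω ((lam p : ℂ) • v q) y := by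
    rw [Finset.mul_sum, Finset.sum_smul]
    refine Finset.sum_congr rfl fun p _ => ?_
    rw [Finset.smul_sum]
    refine Finset.sum_congr rfl fun q _ => ?_
    rw [polyGaussVec_smul, smul_smul, smul_smul]
    congr 1; ring
  have e4 : ∑ p ∈ Finset.range m, ∑ q ∈ Finset.range m,
        ε ^ (p + 1 + 1 + q) • polyGaussVec ω (H (p + 1 + 1) (v q)) y -
      ∑ p ∈ Finset.range m, ∑ q ∈ Finset.range m,
        ε ^ (p + 1 + 1 + q) • polyGaussVec ω ((lam p : ℂ) • v q) y =
      ∑ p ∈ Finset.range m, ∑ q ∈ Finset.range m, ε ^ (p + q + 2) •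
        polyGaussVec ω (H (p + 2) (v q) - (lam p : ℂ) • v q) y := by
    rw [← Finset.sum_sub_distrib]
    refine Finset.sum_congr rfl fun p _ => ?_
    rw [← Finset.sum_sub_distrib]
    refine Finset.sum_congr rfl fun q _ => ?_
    rw [← smul_sub, ← polyGaussVec_sub]
    congr 2; ring
  -- For each `n < m` the inner sum is `ε^(n+2)` times the formal residual of order `n`, which is
  -- zero.
  have e5 : ∑ n ∈ Finset.range m, ∑ p ∈ Finset.range (n + 1), ε ^ (p + (n - p) + 2) •
        polyGaussVec ω (H (p + 2) (v (n - p)) - (lam p : ℂ) • v (n - p)) y = 0 := by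
    refine Finset.sum_eq_zero fun n hn => ?_
    have hn' := Finset.mem_range.1 hn
    have : ∀ p ∈ Finset.range (n + 1), ε ^ (p + (n - p) + 2) •
        polyGaussVec ω (H (p + 2) (v (n - p)) - (lam p : ℂ) • v (n - p)) y = ε ^ (n + 2) •
        polyGaussVec ω (H (p + 2) (v (n - p)) - (lam p : ℂ) • v (n - p)) y := fun p hp => by
      have := Finset.mem_range.1 hp
      rw [show p + (n - p) = n by omega]
    rw [Finset.sum_congr rfl this, ← Finset.smul_sum, ← polyGaussVec_sum]
    have h0 := hres n (by omega)
    unfold formalRes at h0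
    rw [h0, hz, smul_zero]
  rw [e3, add_sub_right_comm, e4, sum_range_mul_range, e5, zero_add, smul_add, smul_smul,
    inv_mul_cancel₀ (pow_ne_zero _ hε), one_smul]
  congr 1
  rw [Finset.smul_sum]
  refine Finset.sum_congr rfl fun p _ => ?_
  rw [Finset.smul_sum]
  refine Finset.sum_congr rfl fun q hq => ?_
  have := Finset.mem_Ico.1 hq
  rw [smul_smul]
  congr 1
  rw [inv_mul_eq_iff_eq_mul₀ (pow_ne_zero _ hε), ← pow_add]
  congr 1; omega

/-- `polyVec` as a linear map. -/
def polyVecLin : (Fin 2 → ℂ[X]) →ₗ[ℂ] (ℝ → C2) where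
  toFun := polyVec
  map_add' p q := by funext y; ext r; simp [polyVec]
  map_smul' c p := by funext y; ext r; simp [polyVec]

/-- The leading part of the rescaled operator on amplitudes. -/
theorem normalOp_two (hω : 0 < ω) (hP : HasSymbolExpansion P Pk)
    (hwell : HasPotentialWell (Pk 0) 1 (ω ^ 2) 0 ξ₀)
    (hP1 : Pk 1 0 ξ₀ = Matrix.diagonal (fun j => ((μ j : ℝ) : ℂ)))
    {T : (Fin 2 → ℂ[X]) →ₗ[ℂ] (Fin 2 → ℂ[X])}
    (hT : ∀ q, weylVec (normalCoeff Pk ξ₀ 2) (polyGaussVec ω q) = polyGaussVec ω (T q))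
    (q : Fin 2 → ℂ[X]) : T q = fun r => monoOp ω 2 0 (q r) + (ω : ℂ) ^ 2 • monoOp ω 0 2 (q r) +
      ((μ r : ℝ) : ℂ) • q r := by
  apply polyGaussVec_injective ω
  rw [← hT]
  funext y
  ext r
  have hs : ∀ s, (fun x ξ => normalCoeff Pk ξ₀ 2 x ξ r s) = if r = s then fun x ξ =>
      (monoSym 2 0 x ξ + (ω : ℂ) ^ 2 * monoSym 0 2 x ξ) + ((μ r : ℝ) : ℂ) * 1 else fun _ _ => 0 := by
    intro s
    funext x ξ
    rw [(normalCoeff_well hP hwell hP1 x ξ).2.2, Matrix.diagonal_apply]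
    split_ifs <;> simp
  rw [weylVec_apply, Finset.sum_eq_single r]
  · rw [hs r, if_pos rfl]
    have hφ := unifSchwartz_polyGauss Unit hω (q r)
    have u1 : UnifSym 2 (fun _ : Unit => monoSym 2 0) := unifSym_monoSym le_rfl (by omega)
    have u2 : UnifSym 2 (fun (_ : Unit) x ξ => (ω : ℂ) ^ 2 * monoSym 0 2 x ξ) :=
      UnifSym.const_mul (c := fun _ => (ω : ℂ) ^ 2) (unifSym_monoSym (by omega) le_rfl)
        (fun _ => le_rfl)
    have u3 : UnifSym 2 (fun (_ : Unit) (x ξ : ℝ) => ((μ r : ℝ) : ℂ) * 1) :=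
      UnifSym.const_mul (c := fun _ => ((μ r : ℝ) : ℂ)) UnifSym.one (fun _ => le_rfl)
    have e1 := weylScalar_add_symbol (u1.add u2) u3 hφ () y
    have e2 := weylScalar_add_symbol u1 u2 hφ () y
    have e3 := weylScalar_one hφ () y
    simp only [weylScalar_const_mul_symbol] at e1 e2
    refine e1.trans ?_
    rw [e2, e3, weylScalar_monoSym hω, weylScalar_monoSym hω]
    simp only [polyGaussVec, polyGauss_add, polyGauss_smul]
  · intro s _ hsr
    rw [hs s, if_neg (Ne.symm hsr), weylScalar_zero_symbol]
  · simp

/-- Existence of quasimodes on the line at all levels. -/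
theorem exists_lineQuasimodes (hω : 0 < ω) (hP : HasSymbolExpansion P Pk)
    (hwell : HasPotentialWell (Pk 0) 1 (ω ^ 2) 0 ξ₀)
    (hP1 : Pk 1 0 ξ₀ = Matrix.diagonal (fun j => ((μ j : ℝ) : ℂ))) (ℓ : ℕ) :
    ∃ (v : Fin 2 → ℕ → ℕ → Fin 2 → ℂ[X]) (lam : Fin 2 → ℕ → ℕ → ℝ),
      (∀ (j : Fin 2) (n : ℕ), IsLineQuasimode P ξ₀ ω μ ℓ j n (v j n) (lam j n)) ∧
      (∀ (j j' : Fin 2) (n n' : ℕ), (j, n) ≠ (j', n') →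
        gaussInner ω (polyVec (v j n 0)) (polyVec (v j' n' 0)) = 0) ∧
      (∀ (j : Fin 2) (n : ℕ),
        (ℓ = 0 ∨ ∀ (k : Fin 2) (m : ℕ), k ≠ j → oscEnergy ω μ k m ≠ oscEnergy ω μ j n) →
        polyVec (v j n 0) = oscAmp ω j n) := by
  obtain ⟨H, hH⟩ := exists_normalOp hω Pk ξ₀
  have hz : ∀ i, (∀ y η, normalCoeff Pk ξ₀ i y η = 0) → H i = 0 := by
    intro i hi
    refine LinearMap.ext fun q => ?_
    apply polyGaussVec_injective ω
    rw [← hH]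
    have e : normalCoeff Pk ξ₀ i = fun y η => (0 : ℂ) • normalCoeff Pk ξ₀ i y η := by
      funext y η; rw [hi, smul_zero]
    funext y
    rw [e, weylVec_smul_symbol, zero_smul]
    exact (congrFun (map_zero (polyGaussLin ω)) y).symm
  have hH0 := hz 0 fun y η => (normalCoeff_well hP hwell hP1 y η).1
  have hH1 := hz 1 fun y η => (normalCoeff_well hP hwell hP1 y η).2.1
  -- The form on amplitudes is the `L²` product of the functions, where the adjoint formula applies
  -- to Hermitian coefficients.
  have hsymm : ∀ p x y, ampForm hω (H (p + 2) x) y = ampForm hω x (H (p + 2) y) := by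
    intro p x y
    rw [ampForm_eq_integral, ampForm_eq_integral, ← hH, ← hH]
    have := integral_inner_weylVec (unifSymMat_normalCoeff Unit Pk ξ₀ (le_refl (p + 2)))
      (unifSchwartz_polyGaussVec Unit hω x) (unifSchwartz_polyGaussVec Unit hω y) ()
    simp only [hP.isHermitian_normalCoeff] at this
    exact this.symm
  have h0 : ∀ l : Fin 2 × ℕ, H 2 (oscPoly ω l) =
      ((oscEnergy ω μ l.1 l.2 : ℝ) : ℂ) • oscPoly ω l := by
    intro l
    rw [normalOp_two hω hP hwell hP1 (hH 2)]
    funext r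
    rw [Pi.smul_apply]
    by_cases hr : r = l.1
    · subst hr
      simp only [oscPoly, Pi.single_eq_same]
      rw [oscillator_hermitePoly hω, ← add_smul, oscEnergy]
      push_cast; rfl
    · simp [oscPoly, hr]
  -- The index of `H` is shifted by two because `H 0 = H 1 = 0`; the order `2 * ℓ` counts powers of
  -- `√h`.
  obtain ⟨v, lam, hs, hlead⟩ := FormalEigensystem.exists_system (B := ampForm hω)
    (H := fun p => H (p + 2)) (b := oscPoly ω) (e := fun l => oscEnergy ω μ l.1 l.2)
    (ampForm_conj hω) hsymm (finite_level hω μ)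
    (fun k l hkl => by rw [ampForm_oscPoly, if_neg hkl])
    (fun k => by rw [ampForm_oscPoly, if_pos rfl]) (mem_span_oscPoly hω) h0 (2 * ℓ)
  refine ⟨fun j n => v (j, n), fun j n => lam (j, n), fun j n => ⟨hs.lam_zero (j, n), ?_, ?_, ?_⟩,
    fun j j' n n' h => ?_, fun j n h => ?_⟩
  · have := Submodule.mem_map_of_mem (f := polyVecLin) (hs.level (j, n))
    rw [Submodule.map_span] at this
    refine Submodule.span_mono ?_ this
    rintro _ ⟨_, ⟨k, hk, rfl⟩, rfl⟩
    exact ⟨k.1, k.2, hk, polyVec_oscPoly k⟩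
  · rw [gaussInner_polyVec hω]; exact hs.normal _
  · exact isBigOSchwartz_of_formalRes hω hP hH hH0 hH1 ℓ (hs.eqn (j, n))
  · rw [gaussInner_polyVec hω]; exact hs.ortho _ _ h
  · have : v (j, n) 0 = oscPoly ω (j, n) := by
      refine hlead (j, n) (h.imp (fun h => by rw [h]) fun h k hk => ?_)
      obtain ⟨i, m⟩ := k
      by_cases hij : i = j
      -- Within one oscillator different `n` have different energies, so only coincidences between
      -- the two oscillators can make a level degenerate.
      · subst hij
        intro he
        have h2 : (2 * (m : ℝ) + 1) * ω = (2 * (n : ℝ) + 1) * ω := by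
          simp only [oscEnergy] at he; linarith
        have h3 := mul_right_cancel₀ hω.ne' h2
        have h4 : (m : ℝ) = n := by linarith
        exact hk (by rw [Nat.cast_inj.1 h4])
      · exact h i m hij
    show polyVec (v (j, n) 0) = _
    rw [this]
    exact polyVec_oscPoly (j, n)

end LineQuasimode

end

noncomputable section

open MeasureTheory

/-! ### Periodic sums -/

/-- Schwartz functions with values in `ℂ²`. -/
abbrev IsSchwartz (g : ℝ → C2) : Prop := UnifSchwartz (fun _ : Unit => g)

/-- The 1-periodic function `∑_k g(x - k)`. -/
def perSum (g : ℝ → C2) (x : ℝ) : C2 := ∑' k : ℤ, g (x - k)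

theorem inv_one_add_int_sq_le {k : ℤ} (hk : k ≠ 0) : ((k : ℝ) ^ 2)⁻¹ ≤ 2 * (1 + (k : ℝ) ^ 2)⁻¹ := by
  have h1 : (1 : ℝ) ≤ (k : ℝ) ^ 2 := by
    have : (1 : ℤ) ≤ k ^ 2 := by have := sq_pos_of_ne_zero hk; omega
    exact_mod_cast this
  rw [← div_eq_mul_inv, inv_eq_one_div, div_le_div_iff₀ (by positivity) (by positivity)]
  linarith

theorem summable_inv_one_add_int_sq : Summable fun k : ℤ => (1 + (k : ℝ) ^ 2)⁻¹ := by
  refine (Real.summable_one_div_int_pow.2 one_lt_two).of_norm_bounded_eventually ?_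
  filter_upwards [(Set.finite_singleton (0 : ℤ)).compl_mem_cofinite] with k hk
  have hk : k ≠ 0 := hk
  have h0 : 0 < (k : ℝ) ^ 2 := by positivity
  rw [Real.norm_of_nonneg (by positivity), one_div]
  exact inv_anti₀ h0 (by linarith)

/-- Peetre's inequality: it separates decay in the translation `k` from growth in `x`. -/
theorem inv_one_add_sub_sq_le (x k : ℝ) :
    (1 + (x - k) ^ 2)⁻¹ ≤ 2 * (1 + x ^ 2) * (1 + k ^ 2)⁻¹ := by
  rw [← div_eq_mul_inv, inv_eq_one_div, div_le_div_iff₀ (by positivity) (by positivity)]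
  nlinarith [sq_nonneg (x - k), sq_nonneg (x + (x - k)), mul_nonneg (sq_nonneg x) (sq_nonneg (x - k)),
    sq_nonneg (x - (x - k))]

section

variable {g φ : ℝ → C2}

theorem IsSchwartz.exists_norm_shift_le (hg : IsSchwartz g) : ∃ C : ℝ, 0 ≤ C ∧ ∀ (x : ℝ) (k : ℤ),
    ‖g (x - k)‖ ≤ C * (1 + x ^ 2) * (1 + (k : ℝ) ^ 2)⁻¹ := by
  obtain ⟨C, hC0, hC⟩ := hg.decay 0
  refine ⟨C * 2, by positivity, fun x k => ?_⟩
  have := hC () (x - k)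
  rw [pow_zero, one_mul] at this
  refine this.trans ?_
  calc _ ≤ C * (2 * (1 + x ^ 2) * (1 + (k : ℝ) ^ 2)⁻¹) :=
        mul_le_mul_of_nonneg_left (inv_one_add_sub_sq_le x k) hC0
    _ = _ := by ring

theorem IsSchwartz.summable (hg : IsSchwartz g) (x : ℝ) : Summable fun k : ℤ => g (x - k) := by
  obtain ⟨C, _, hC⟩ := hg.exists_norm_shift_le
  exact (summable_inv_one_add_int_sq.mul_left (C * (1 + x ^ 2))).of_norm_bounded (hC x)

theorem IsSchwartz.iteratedDeriv (hg : IsSchwartz g) (n : ℕ) : IsSchwartz (iteratedDeriv n g) := by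
  induction n with
  | zero => simpa using hg
  | succ n ih => rw [iteratedDeriv_succ]; exact UnifSchwartz.deriv ih

theorem IsSchwartz.hasDerivAt_perSum (hg : IsSchwartz g) (x : ℝ) :
    HasDerivAt (perSum g) (perSum (deriv g) x) x := by
  have hg' : IsSchwartz (deriv g) := UnifSchwartz.deriv hg
  obtain ⟨C, hC0, hC⟩ := hg'.exists_norm_shift_le
  refine hasDerivAt_tsum_of_isPreconnected (t := Set.Ioo (x - 1) (x + 1)) (y₀ := x)
    (u := fun k : ℤ => C * (1 + (|x| + 1) ^ 2) * (1 + (k : ℝ) ^ 2)⁻¹)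
    (summable_inv_one_add_int_sq.mul_left _) isOpen_Ioo isPreconnected_Ioo (fun k y _ => ?_)
    (fun k y hy => (hC y k).trans ?_) ⟨by linarith, by linarith⟩ (hg.summable x)
    ⟨by linarith, by linarith⟩
  · exact (UnifSchwartz.differentiable hg () (y - k)).hasDerivAt.comp_sub_const y k
  · have hy2 : y ^ 2 ≤ (|x| + 1) ^ 2 := by
      rw [← sq_abs y]
      have : |y| ≤ |x| + 1 := by
        have h1 : |y - x| < 1 := abs_sub_lt_iff.2 ⟨by linarith [hy.2], by linarith [hy.1]⟩
        have h2 := abs_sub_abs_le_abs_sub y x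
        linarith
      gcongr
    gcongr

theorem IsSchwartz.contDiff_perSum (hg : IsSchwartz g) :
    ContDiff ℝ ((⊤ : ℕ∞) : WithTop ℕ∞) (perSum g) := by
  refine (contDiff_of_hasDerivAt_seq (f := fun n => perSum (_root_.iteratedDeriv n g)) fun n x => ?_).1
  rw [iteratedDeriv_succ]
  exact (hg.iteratedDeriv n).hasDerivAt_perSum x

theorem perSum_periodic (g : ℝ → C2) : Function.Periodic (perSum g) 1 := by
  intro x
  unfold perSum
  rw [← (Equiv.addRight (1 : ℤ)).tsum_eq]
  refine tsum_congr fun k => ?_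
  simp only [Equiv.coe_addRight]
  push_cast
  congr 1; ring

theorem IsSchwartz.exists_norm_perSum_le (hg : IsSchwartz g) :
    ∃ C : ℝ, 0 ≤ C ∧ ∀ x, ‖perSum g x‖ ≤ C * (1 + x ^ 2) := by
  obtain ⟨C, hC0, hC⟩ := hg.exists_norm_shift_le
  refine ⟨C * ∑' k : ℤ, (1 + (k : ℝ) ^ 2)⁻¹, by positivity, fun x => ?_⟩
  refine (tsum_of_norm_bounded (summable_inv_one_add_int_sq.hasSum.mul_left (C * (1 + x ^ 2)))
    (hC x)).trans (le_of_eq (by ring))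

theorem IsSchwartz.exists_mul_norm_le (hφ : IsSchwartz φ) :
    ∃ C : ℝ, 0 ≤ C ∧ ∀ x, ‖φ x‖ * (1 + x ^ 2) ≤ C * (1 + x ^ 2)⁻¹ := by
  obtain ⟨C, hC0, hC⟩ := hφ.decay 2
  refine ⟨C, hC0, fun x => le_trans ?_ (hC () x)⟩
  rw [mul_comm]
  gcongr
  rw [← sq_abs x]
  nlinarith [abs_nonneg x]

theorem IsSchwartz.integrable_inner (hφ : IsSchwartz φ) (hg : IsSchwartz g) (k : ℤ) :
    Integrable fun x => inner ℂ (φ x) (g (x - k)) := by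
  obtain ⟨C, hC0, hC⟩ := hg.exists_norm_shift_le
  obtain ⟨D, hD0, hD⟩ := hφ.exists_mul_norm_le
  refine (integrable_inv_one_add_sq.const_mul (D * C * (1 + (k : ℝ) ^ 2)⁻¹)).mono' ?_
    (Eventually.of_forall fun x => ?_)
  · have h1 := UnifSchwartz.continuous hφ ()
    have h2 := UnifSchwartz.continuous hg ()
    exact (h1.inner (h2.comp (continuous_id.sub continuous_const))).aestronglyMeasurable
  · calc _ ≤ ‖φ x‖ * ‖g (x - k)‖ := norm_inner_le_norm _ _
      _ ≤ ‖φ x‖ * (C * (1 + x ^ 2) * (1 + (k : ℝ) ^ 2)⁻¹) := by gcongr; exact hC x k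
      _ = C * (1 + (k : ℝ) ^ 2)⁻¹ * (‖φ x‖ * (1 + x ^ 2)) := by ring
      _ ≤ C * (1 + (k : ℝ) ^ 2)⁻¹ * (D * (1 + x ^ 2)⁻¹) :=
          mul_le_mul_of_nonneg_left (hD x) (by positivity)
      _ = _ := by ring

theorem IsSchwartz.integrable_inner_perSum (hφ : IsSchwartz φ) (hg : IsSchwartz g) :
    Integrable fun x => inner ℂ (φ x) (perSum g x) := by
  obtain ⟨C, hC0, hC⟩ := hg.exists_norm_perSum_le
  obtain ⟨D, hD0, hD⟩ := hφ.exists_mul_norm_le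
  refine (integrable_inv_one_add_sq.const_mul (D * C)).mono' ?_ (Eventually.of_forall fun x => ?_)
  · exact ((UnifSchwartz.continuous hφ ()).inner
      hg.contDiff_perSum.continuous).aestronglyMeasurable
  · calc _ ≤ ‖φ x‖ * ‖perSum g x‖ := norm_inner_le_norm _ _
      _ ≤ ‖φ x‖ * (C * (1 + x ^ 2)) := by gcongr; exact hC x
      _ = C * (‖φ x‖ * (1 + x ^ 2)) := by ring
      _ ≤ C * (D * (1 + x ^ 2)⁻¹) := mul_le_mul_of_nonneg_left (hD x) hC0
      _ = _ := by ring

/-- Unfolding of the pairing with a periodic sum. -/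
theorem IsSchwartz.integral_inner_perSum (hφ : IsSchwartz φ) (hg : IsSchwartz g) :
    ∫ x : ℝ, inner ℂ (φ x) (perSum g x) = ∑' k : ℤ, ∫ x : ℝ, inner ℂ (φ x) (g (x - k)) := by
  have e : ∀ x, inner ℂ (φ x) (perSum g x) = ∑' k : ℤ, inner ℂ (φ x) (g (x - k)) := fun x =>
    (innerSL ℂ (φ x)).map_tsum (hg.summable x)
  simp only [e]
  refine (integral_tsum_of_summable_integral_norm (fun k => hφ.integrable_inner hg k) ?_).symm
  obtain ⟨C, hC0, hC⟩ := hg.exists_norm_shift_le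
  obtain ⟨D, hD0, hD⟩ := hφ.exists_mul_norm_le
  refine (summable_inv_one_add_int_sq.mul_left (C * D * Real.pi)).of_nonneg_of_le
    (fun k => integral_nonneg fun x => norm_nonneg _) (fun k => ?_)
  calc _ ≤ ∫ x : ℝ, C * D * (1 + (k : ℝ) ^ 2)⁻¹ * (1 + x ^ 2)⁻¹ := by
        refine integral_mono (hφ.integrable_inner hg k).norm
          (integrable_inv_one_add_sq.const_mul _) fun x => ?_
        calc _ ≤ ‖φ x‖ * ‖g (x - k)‖ := norm_inner_le_norm _ _
          _ ≤ ‖φ x‖ * (C * (1 + x ^ 2) * (1 + (k : ℝ) ^ 2)⁻¹) := by gcongr; exact hC x k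
          _ = C * (1 + (k : ℝ) ^ 2)⁻¹ * (‖φ x‖ * (1 + x ^ 2)) := by ring
          _ ≤ C * (1 + (k : ℝ) ^ 2)⁻¹ * (D * (1 + x ^ 2)⁻¹) :=
          mul_le_mul_of_nonneg_left (hD x) (by positivity)
          _ = _ := by ring
    _ = _ := by rw [integral_const_mul, integral_univ_inv_one_add_sq]; ring

/-- The pairing of two periodic sums over a period. -/
theorem IsSchwartz.intervalIntegral_inner_perSum (hφ : IsSchwartz φ) (hg : IsSchwartz g) :
    ∫ x in (0 : ℝ)..1, inner ℂ (perSum φ x) (perSum g x) =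
      ∫ x : ℝ, inner ℂ (φ x) (perSum g x) := by
  -- The line is cut into unit intervals. Periodicity of the second factor leaves the translates of
  -- `φ`, which are summed under the integral by dominated convergence.
  have h1 := (hφ.integrable_inner_perSum hg).hasSum_intervalIntegral_comp_add_int
  have hper : ∀ (n : ℤ) (x : ℝ), perSum g (x + n) = perSum g x := fun n x => by
    have := (perSum_periodic g).int_mul n x
    simpa using this
  simp only [hper] at h1
  obtain ⟨C, hC0, hC⟩ := hφ.exists_norm_shift_le
  obtain ⟨D, hD0, hD⟩ := hg.exists_norm_perSum_le
  have hbd : ∀ x ∈ Set.uIoc (0 : ℝ) 1, 1 + x ^ 2 ≤ 2 := fun x hx => by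
    rw [Set.uIoc_of_le zero_le_one] at hx
    nlinarith [hx.1, hx.2]
  have h2 : HasSum (fun n : ℤ => ∫ x in (0 : ℝ)..1, inner ℂ (φ (x + n)) (perSum g x))
      (∫ x in (0 : ℝ)..1, inner ℂ (perSum φ x) (perSum g x)) := by
    refine intervalIntegral.hasSum_integral_of_dominated_convergence
      (fun n _ => C * 2 * (1 + (n : ℝ) ^ 2)⁻¹ * (D * 2)) (fun n => ?_) (fun n => ?_) ?_ ?_ ?_
    · have h1 := UnifSchwartz.continuous hφ ()
      exact ((h1.comp (continuous_id.add continuous_const)).inner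
        hg.contDiff_perSum.continuous).aestronglyMeasurable
    · refine Eventually.of_forall fun x hx => (norm_inner_le_norm _ _).trans ?_
      have h3 := hC x (-n)
      push_cast at h3
      rw [sub_neg_eq_add, neg_sq] at h3
      have h4 := hbd x hx
      refine mul_le_mul (h3.trans ?_) ((hD x).trans ?_) (norm_nonneg _) (by positivity) <;> gcongr
    · exact Eventually.of_forall fun x _ => (summable_inv_one_add_int_sq.mul_left _).mul_right _
    · simp
    · refine Eventually.of_forall fun x _ => ?_
      have h3 : HasSum (fun n : ℤ => φ (x + n)) (perSum φ x) := by
        have h4 : HasSum (fun k : ℤ => φ (x - k)) (perSum φ x) := (hφ.summable x).hasSum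
        have h5 := (Equiv.neg ℤ).hasSum_iff.2 h4
        convert h5 using 2 with n
        simp
      have h4 := h3.mapL ((innerSLFlip ℂ) (perSum g x))
      exact h4
  exact h2.unique h1

/-- One of the two periodic sums is unfolded to pass from a period to the line, and the other is
then expanded. The result is a sum of correlations of `g` with its translates. -/
theorem IsSchwartz.circleNorm_sq_perSum (hg : IsSchwartz g) :
    ((circleNorm (perSum g) ^ 2 : ℝ) : ℂ) = ∑' k : ℤ, ∫ x : ℝ, inner ℂ (g x) (g (x - k)) := by
  rw [← hg.integral_inner_perSum hg, ← hg.intervalIntegral_inner_perSum hg, circleNorm,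
    Real.sq_sqrt (intervalIntegral.integral_nonneg zero_le_one fun x _ => by positivity),
    ← intervalIntegral.integral_ofReal]
  congr 1; funext x
  rw [inner_self_eq_norm_sq_to_K]
  push_cast; rfl

/-- The action of a Weyl operator on a periodic sum. -/
theorem isWeylOnCircle_perSum {K : ℕ} {h : ℝ} (hh : 0 < h) {A : ℝ → ℝ → Mat2}
    (hA : UnifSymMat K (fun (_ : Unit) x ξ => A x (h * ξ))) (hper : ∀ x ξ, A (x + 1) ξ = A x ξ)
    (hg : IsSchwartz g) :
    IsWeylOnCircle h A (perSum g) (perSum (weylVec (fun x ξ => A x (h * ξ)) g)) := by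
  have hG : IsSchwartz (weylVec (fun x ξ => A x (h * ξ)) g) := UnifSchwartz.weylVec hA hg
  refine ⟨hG.contDiff_perSum, perSum_periodic _, fun φ => ?_⟩
  have hφ : IsSchwartz φ := SchwartzMap.unifSchwartz Unit φ
  have hΦ : IsSchwartz (weylVec (fun x ξ => (A x (h * ξ)).conjTranspose) φ) :=
    UnifSchwartz.weylVec hA.conjTranspose hφ
  rw [weyl_eq_weylVec hh (A := fun (_ : Unit) z ζ => (A z ζ).conjTranspose) hA.conjTranspose hφ (),
    hφ.integral_inner_perSum hG, hΦ.integral_inner_perSum hg]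
  -- It suffices to treat a single translate: the periodic symbol is invariant under the integer
  -- shift, and the adjoint formula holds on the line.
  refine tsum_congr fun k => ?_
  have hgk : IsSchwartz (fun x => g (x + (-(k : ℝ)))) := by
    refine ⟨fun _ => (hg.smooth ()).comp (contDiff_id.add contDiff_const), fun p q => ?_⟩
    obtain ⟨C, hC⟩ := hg.bound p q
    obtain ⟨D, hD⟩ := hg.bound 0 q
    refine ⟨2 ^ p * (C + |(k : ℝ)| ^ p * D), fun _ y => ?_⟩
    rw [iteratedDeriv_comp_add_const]
    have h1 := hC () (y + -(k : ℝ))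
    have h2 := hD () (y + -(k : ℝ))
    rw [pow_zero, one_mul] at h2
    have h3 : |y| ^ p ≤ 2 ^ p * (|y + -(k : ℝ)| ^ p + |(k : ℝ)| ^ p) := by
      have h4 : |y| ≤ |y + -(k : ℝ)| + |(k : ℝ)| := by
        have := abs_add_le (y + -(k : ℝ)) k
        simpa using this
      rcases le_total |y + -(k : ℝ)| |(k : ℝ)| with h5 | h5
      · calc |y| ^ p ≤ (2 * |(k : ℝ)|) ^ p := by gcongr; linarith
          _ ≤ _ := by rw [mul_pow]; gcongr; exact le_add_of_nonneg_left (by positivity)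
      · calc |y| ^ p ≤ (2 * |y + -(k : ℝ)|) ^ p := by gcongr; linarith
          _ ≤ _ := by rw [mul_pow]; gcongr; exact le_add_of_nonneg_right (by positivity)
    calc _ ≤ 2 ^ p * (|y + -(k : ℝ)| ^ p + |(k : ℝ)| ^ p) *
          ‖_root_.iteratedDeriv q g (y + -(k : ℝ))‖ := by gcongr
      _ = 2 ^ p * (|y + -(k : ℝ)| ^ p * ‖_root_.iteratedDeriv q g (y + -(k : ℝ))‖ +
          |(k : ℝ)| ^ p * ‖_root_.iteratedDeriv q g (y + -(k : ℝ))‖) := by ring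
      _ ≤ _ := by gcongr
  have h1 := integral_inner_weylVec hA hφ hgk ()
  have hperk : ∀ x ξ, A (x - -(k : ℝ)) ξ = A x ξ := fun x ξ => by
    have : Function.Periodic (fun x => A x ξ) 1 := fun x => hper x ξ
    have := this.int_mul k x
    rw [sub_neg_eq_add]
    simpa using this
  simp only [weylVec_comp_add, hperk] at h1
  simpa only [sub_eq_add_neg] using h1

/-- Testing against `χ e_r` with smooth compactly supported scalar `χ` determines each component.
Negligibility only asserts that some `f` exists; uniqueness makes it the explicit one. -/
theorem IsWeylOnCircle.unique {h : ℝ} {A : ℝ → ℝ → Mat2} {u f f' : ℝ → C2}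
    (hf : IsWeylOnCircle h A u f) (hf' : IsWeylOnCircle h A u f') : f = f' := by
  have hc := hf.1.continuous
  have hc' := hf'.1.continuous
  have key : ∀ r, (fun x => f x r) = fun x => f' x r := by
    intro r
    have h1 : Continuous fun x => f x r := (EuclideanSpace.proj (𝕜 := ℂ) r).continuous.comp hc
    have h2 : Continuous fun x => f' x r := (EuclideanSpace.proj (𝕜 := ℂ) r).continuous.comp hc'
    refine (Continuous.ae_eq_iff_eq volume h1 h2).1 ?_
    refine ae_eq_of_integral_contDiff_smul_eq h1.locallyIntegrable h2.locallyIntegrable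
      fun χ hχ hχc => ?_
    have hs : ContDiff ℝ ((⊤ : ℕ∞) : WithTop ℕ∞)
        (fun x => ((χ x : ℝ) : ℂ) • EuclideanSpace.single r (1 : ℂ)) :=
      (Complex.ofRealCLM.contDiff.comp hχ).smul contDiff_const
    have hsc : HasCompactSupport (fun x => ((χ x : ℝ) : ℂ) • EuclideanSpace.single r (1 : ℂ)) := by
      refine hχc.mono fun x hx => ?_
      contrapose! hx
      simp only [Function.mem_support, ne_eq, not_not] at hx ⊢
      simp [hx]
    set φ : SchwartzMap ℝ C2 := hsc.toSchwartzMap hs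
    have e : ∀ (k : ℝ → C2) x, inner ℂ (φ x) (k x) = χ x • k x r := by
      intro k x
      show inner ℂ (((χ x : ℝ) : ℂ) • EuclideanSpace.single r (1 : ℂ)) (k x) = _
      rw [inner_smul_left, EuclideanSpace.inner_single_left, Complex.conj_ofReal]
      simp
    have h3 := (hf.2.2 φ).trans (hf'.2.2 φ).symm
    simpa only [e] using h3
  funext x
  ext r
  exact congrFun (key r) x

end

end

noncomputable section

open MeasureTheory

/-! ### Periodized wave packets -/

section

variable {g : ℝ → C2} {ξ₀ : ℝ}

theorem IsSchwartz.comp_mul (hg : IsSchwartz g) {t : ℝ} (ht : 0 < t) :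
    IsSchwartz (fun x => g (x * t)) := by
  refine ⟨fun _ => (hg.smooth ()).comp (contDiff_id.mul contDiff_const), fun p q => ?_⟩
  obtain ⟨C, hC⟩ := hg.bound p q
  refine ⟨t ^ q * (t ^ p)⁻¹ * C, fun _ x => ?_⟩
  have h1 := iteratedDeriv_comp_mul_add (f := g) (n := q)
    ((hg.smooth ()).of_le (by exact_mod_cast le_top)) t 0 x
  simp only [add_zero] at h1
  have h2 : (fun x => g (x * t)) = fun x => g (t * x) := by funext x; rw [mul_comm]
  rw [h2, h1, norm_smul, norm_pow, Real.norm_of_nonneg ht.le]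
  have h3 := hC () (t * x)
  rw [abs_mul, abs_of_pos ht, mul_pow] at h3
  calc _ = t ^ q * (t ^ p)⁻¹ * (t ^ p * |x| ^ p * ‖_root_.iteratedDeriv q g (t * x)‖) := by
        field_simp
    _ ≤ _ := by gcongr

theorem IsSchwartz.modulate (hg : IsSchwartz g) (a : ℝ) :
    IsSchwartz (fun x => Complex.exp (Complex.I * ((a * x : ℝ) : ℂ)) • g x) := by
  have hexp : ContDiff ℝ ((⊤ : ℕ∞) : WithTop ℕ∞)
      (fun x : ℝ => Complex.exp (Complex.I * ((a * x : ℝ) : ℂ))) := by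
    have h1 : ContDiff ℝ ((⊤ : ℕ∞) : WithTop ℕ∞) (fun x : ℝ => ((a * x : ℝ) : ℂ)) :=
      Complex.ofRealCLM.contDiff.comp (contDiff_const.mul contDiff_id)
    exact (contDiff_const.mul h1).cexp
  refine ⟨fun _ => hexp.smul (hg.smooth ()), fun p q => ?_⟩
  -- Differentiation turns the modulation of `g` into the modulation of `i a g + g'`, again a
  -- Schwartz function.
  induction q generalizing g with
  | zero =>
    obtain ⟨C, hC⟩ := hg.bound p 0
    refine ⟨C, fun _ y => ?_⟩
    have := hC () y
    simp only [iteratedDeriv_zero] at this ⊢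
    rwa [norm_smul, mul_comm Complex.I, Complex.norm_exp_ofReal_mul_I, one_mul]
  | succ q ih =>
    have h1 : IsSchwartz (fun y => (Complex.I * a) • g y + _root_.deriv g y) :=
      (UnifSchwartz.smul hg (c := fun _ => Complex.I * a) fun _ => le_rfl).add (UnifSchwartz.deriv hg)
    obtain ⟨C, hC⟩ := ih h1
    refine ⟨C, fun _ y => ?_⟩
    have e : _root_.deriv (fun x : ℝ => Complex.exp (Complex.I * ((a * x : ℝ) : ℂ)) • g x) =
        fun x => Complex.exp (Complex.I * ((a * x : ℝ) : ℂ)) •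
          ((Complex.I * a) • g x + _root_.deriv g x) := by
      funext x
      have h2 : HasDerivAt (fun x : ℝ => Complex.exp (Complex.I * ((a * x : ℝ) : ℂ)))
          (Complex.exp (Complex.I * ((a * x : ℝ) : ℂ)) * (Complex.I * a)) x := by
        have h3 : HasDerivAt (fun x : ℝ => Complex.I * ((a * x : ℝ) : ℂ)) (Complex.I * a) x := by
          have := (((hasDerivAt_id x).const_mul a).ofReal_comp).const_mul Complex.I
          simpa using this
        exact h3.cexp
      have h3 := (h2.smul (UnifSchwartz.differentiable hg () x).hasDerivAt).deriv
      refine h3.trans ?_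
      rw [smul_add, smul_smul, add_comm]
    rw [iteratedDeriv_succ', e]
    exact hC () y

theorem IsSchwartz.wavePacket (hg : IsSchwartz g) (ξ₀ : ℝ) {s : ℝ} (hs : 0 < s) (c : ℂ) :
    IsSchwartz (wavePacket ξ₀ s c g) := by
  have := UnifSchwartz.smul (IsSchwartz.modulate (hg.comp_mul (inv_pos.2 hs)) (ξ₀ / s ^ 2))
    (c := fun _ => c) (fun _ => le_rfl)
  have e : _root_.wavePacket ξ₀ s c g =
      fun x => c • Complex.exp (Complex.I * ((ξ₀ / s ^ 2 * x : ℝ) : ℂ)) • g (x * s⁻¹) := by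
    funext x
    rw [_root_.wavePacket, smul_smul, mul_div_right_comm]
  rw [e]
  exact this

/-- The normalizing factor of the wave packets. -/
def packetScale (h : HIdx) : ℂ := (((h : ℝ) ^ (-(1 : ℝ) / 4) : ℝ) : ℂ)

/-- The square of `h^{-1/4}` compensates the Jacobian of `x = √h y`. -/
theorem norm_packetScale_sq (h : HIdx) : ‖packetScale h‖ ^ 2 * Real.sqrt h = 1 := by
  rw [packetScale, Complex.norm_real, Real.norm_of_nonneg (Real.rpow_nonneg h.2.1.le _),
    ← Real.rpow_natCast, ← Real.rpow_mul h.2.1.le, Real.sqrt_eq_rpow, ← Real.rpow_add h.2.1]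
  norm_num

theorem periodTerm_eq (ξ₀ : ℝ) (w : ℝ → ℝ → C2) (h : HIdx) (x : ℝ) (k : ℤ) :
    periodTerm ξ₀ w h x k = wavePacket ξ₀ (Real.sqrt h) (packetScale h) (w h) (x - k) := by
  have h1 : (h : ℝ) ^ (-(1 : ℝ) / 2) = (Real.sqrt h)⁻¹ := by
    rw [Real.sqrt_eq_rpow, ← Real.rpow_neg h.2.1.le]; norm_num
  rw [periodTerm, wavePacket, Real.sq_sqrt h.2.1.le, h1]
  rfl

theorem periodize_eq (ξ₀ : ℝ) (w : ℝ → ℝ → C2) (h : HIdx) : periodize ξ₀ w h =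
    perSum (wavePacket ξ₀ (Real.sqrt h) (packetScale h) (w h)) := by
  funext x
  simp only [periodize, perSum, periodTerm_eq]

theorem UnifSchwartz.isSchwartz {κ : Type*} {z : κ → ℝ → C2} (hz : UnifSchwartz z) (i : κ) :
    IsSchwartz (z i) := hz.comp_index fun _ => i

theorem isSchwartz_packet {w : ℝ → ℝ → C2} (hw : UnifSchwartz (fun h : HIdx => w h)) (ξ₀ : ℝ)
    (h : HIdx) : IsSchwartz (wavePacket ξ₀ (Real.sqrt h) (packetScale h) (w h)) :=
  IsSchwartz.wavePacket (hw.isSchwartz h) ξ₀ h.sqrt_pos _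

theorem norm_wavePacket (ξ₀ s : ℝ) (c : ℂ) (w : ℝ → C2) (x : ℝ) :
    ‖wavePacket ξ₀ s c w x‖ = ‖c‖ * ‖w (x * s⁻¹)‖ := by
  rw [wavePacket, norm_smul, norm_mul, mul_comm Complex.I, Complex.norm_exp_ofReal_mul_I, mul_one]

theorem UnifSchwartz.exists_norm_mul_le {κ : Type*} {z r : κ → ℝ → C2} (hz : UnifSchwartz z)
    (hr : UnifSchwartz r) : ∃ C : ℝ, 0 ≤ C ∧ ∀ i y, ‖z i y‖ * ‖r i y‖ ≤ C * (1 + y ^ 2)⁻¹ := by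
  obtain ⟨C, hC0, hC⟩ := hz.decay 0
  obtain ⟨D, hD0, hD⟩ := hr.decay 0
  refine ⟨C * D, by positivity, fun i y => ?_⟩
  have h1 := hC i y
  have h2 := hD i y
  rw [pow_zero, one_mul] at h1 h2
  have h3 : (1 + y ^ 2)⁻¹ ≤ 1 := inv_le_one_of_one_le₀ (by nlinarith [sq_nonneg y])
  calc _ ≤ (C * (1 + y ^ 2)⁻¹) * (D * 1) := by
        gcongr
        exact h2.trans (by gcongr)
    _ = _ := by ring

theorem UnifSchwartz.integrable_norm_sq {κ : Type*} {z : κ → ℝ → C2} (hz : UnifSchwartz z) (i : κ) :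
    Integrable fun y => ‖z i y‖ ^ 2 := by
  obtain ⟨C, hC0, hC⟩ := hz.exists_norm_mul_le hz
  refine (integrable_inv_one_add_sq.const_mul C).mono'
    ((hz.continuous i).norm.pow 2).aestronglyMeasurable (Eventually.of_forall fun y => ?_)
  rw [Real.norm_of_nonneg (by positivity), pow_two]
  exact hC i y

theorem UnifSchwartz.exists_integral_norm_sq_le {κ : Type*} {z : κ → ℝ → C2} (hz : UnifSchwartz z) :
    ∃ C : ℝ, 0 ≤ C ∧ ∀ i, ∫ y : ℝ, ‖z i y‖ ^ 2 ≤ C := by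
  obtain ⟨C, hC0, hC⟩ := hz.exists_norm_mul_le hz
  refine ⟨C * Real.pi, by positivity, fun i => ?_⟩
  rw [← integral_univ_inv_one_add_sq, ← integral_const_mul]
  refine integral_mono (hz.integrable_norm_sq i) (integrable_inv_one_add_sq.const_mul C) fun y => ?_
  simp only [pow_two]
  simpa only [pow_two] using hC i y

/-- Distinct translates of a wave packet are almost orthogonal. -/
theorem UnifSchwartz.exists_norm_packet_inner_le {w : ℝ → ℝ → C2}
    (hw : UnifSchwartz (fun h : HIdx => w h)) (ξ₀ : ℝ) :
    ∃ C : ℝ, 0 ≤ C ∧ ∀ (h : HIdx) (k : ℤ), k ≠ 0 →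
      ‖∫ x : ℝ, inner ℂ (wavePacket ξ₀ (Real.sqrt h) (packetScale h) (w h) x)
        (wavePacket ξ₀ (Real.sqrt h) (packetScale h) (w h) (x - k))‖ ≤
      C * Real.sqrt h ^ 2 * (1 + (k : ℝ) ^ 2)⁻¹ := by
  obtain ⟨C, hC0, hC⟩ := hw.decay 2
  refine ⟨C * C * Real.pi * 2, by positivity, fun h k hk => ?_⟩
  set ε := Real.sqrt h with hε
  have hεp : 0 < ε := h.sqrt_pos
  set c := packetScale h
  have hk0 : 0 < |(k : ℝ)| := by positivity
  have hpt : ∀ y : ℝ, ‖w h y‖ * ‖w h (y - k * ε⁻¹)‖ ≤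
      C * C * ε ^ 2 * ((k : ℝ) ^ 2)⁻¹ * (1 + y ^ 2)⁻¹ := by
    intro y
    have h1 := hC h y
    have h2 := hC h (y - k * ε⁻¹)
    have h3 : (1 + (y - k * ε⁻¹) ^ 2)⁻¹ ≤ 1 :=
      inv_le_one_of_one_le₀ (by nlinarith [sq_nonneg (y - k * ε⁻¹)])
    -- The two profiles are centred at distance `|k| / ε`, so one argument is large. Squaring this
    -- inequality gives `ε² / k²`, that is `O(h)` with a summable constant.
    have h4 : |(k : ℝ)| * ε⁻¹ ≤ (1 + |y|) * (1 + |y - k * ε⁻¹|) := by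
      have h5 : |(k : ℝ)| * ε⁻¹ ≤ |y| + |y - k * ε⁻¹| := by
        rw [← abs_of_pos (inv_pos.2 hεp), ← abs_mul, abs_of_pos (inv_pos.2 hεp)]
        have := abs_sub y (y - k * ε⁻¹)
        simpa using this
      nlinarith [abs_nonneg y, abs_nonneg (y - k * ε⁻¹),
        mul_nonneg (abs_nonneg y) (abs_nonneg (y - k * ε⁻¹))]
    have h6 : (|(k : ℝ)| * ε⁻¹) ^ 2 * (‖w h y‖ * ‖w h (y - k * ε⁻¹)‖) ≤
        C * C * (1 + y ^ 2)⁻¹ := by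
      calc _ ≤ ((1 + |y|) * (1 + |y - k * ε⁻¹|)) ^ 2 * (‖w h y‖ * ‖w h (y - k * ε⁻¹)‖) := by
            gcongr
        _ = ((1 + |y|) ^ 2 * ‖w h y‖) * ((1 + |y - k * ε⁻¹|) ^ 2 * ‖w h (y - k * ε⁻¹)‖) := by ring
        _ ≤ (C * (1 + y ^ 2)⁻¹) * (C * 1) :=
            mul_le_mul h1 (h2.trans (mul_le_mul_of_nonneg_left h3 hC0)) (by positivity)
              (by positivity)
        _ = _ := by ring
    rw [mul_pow, sq_abs] at h6
    have hk2 : 0 < (k : ℝ) ^ 2 := by positivity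
    calc _ = ε ^ 2 * ((k : ℝ) ^ 2)⁻¹ *
          ((k : ℝ) ^ 2 * ε⁻¹ ^ 2 * (‖w h y‖ * ‖w h (y - k * ε⁻¹)‖)) := by field_simp
      _ ≤ ε ^ 2 * ((k : ℝ) ^ 2)⁻¹ * (C * C * (1 + y ^ 2)⁻¹) := by gcongr
      _ = _ := by ring
  set D := ‖c‖ ^ 2 * (C * C * ε ^ 2 * ((k : ℝ) ^ 2)⁻¹) with hD
  have hint : Integrable (fun x : ℝ => D * (1 + (x * ε⁻¹) ^ 2)⁻¹) :=
    (integrable_inv_one_add_sq.comp_mul_right' (inv_pos.2 hεp).ne').const_mul D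
  refine (norm_integral_le_of_norm_le hint (Eventually.of_forall fun x => ?_)).trans ?_
  · refine (norm_inner_le_norm _ _).trans ?_
    rw [norm_wavePacket, norm_wavePacket, sub_mul]
    have := hpt (x * ε⁻¹)
    calc _ = ‖c‖ ^ 2 * (‖w h (x * ε⁻¹)‖ * ‖w h (x * ε⁻¹ - k * ε⁻¹)‖) := by ring
      _ ≤ ‖c‖ ^ 2 * (C * C * ε ^ 2 * ((k : ℝ) ^ 2)⁻¹ * (1 + (x * ε⁻¹) ^ 2)⁻¹) := by gcongr
      _ = _ := by rw [hD]; ring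
  · rw [integral_const_mul, Measure.integral_comp_mul_right (fun y => (1 + y ^ 2)⁻¹) ε⁻¹, inv_inv,
      abs_of_pos hεp, integral_univ_inv_one_add_sq, smul_eq_mul]
    have hn := norm_packetScale_sq h
    calc D * (ε * Real.pi) = (‖c‖ ^ 2 * ε) * (C * C * Real.pi * ε ^ 2 * ((k : ℝ) ^ 2)⁻¹) := by
          rw [hD]; ring
      _ = C * C * Real.pi * ε ^ 2 * ((k : ℝ) ^ 2)⁻¹ := by rw [hn, one_mul]
      _ ≤ C * C * Real.pi * ε ^ 2 * (2 * (1 + (k : ℝ) ^ 2)⁻¹) := by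
          gcongr; exact inv_one_add_int_sq_le hk
      _ = _ := by ring

/-- The norm of a periodized wave packet is the norm of its profile, up to `O(h)`. -/
theorem UnifSchwartz.exists_circleNorm_sq_sub_le {w : ℝ → ℝ → C2}
    (hw : UnifSchwartz (fun h : HIdx => w h)) (ξ₀ : ℝ) :
    ∃ C : ℝ, 0 ≤ C ∧ ∀ h : HIdx,
      |circleNorm (periodize ξ₀ w h) ^ 2 - ∫ y : ℝ, ‖w h y‖ ^ 2| ≤ C * Real.sqrt h ^ 2 := by
  obtain ⟨C, hC0, hC⟩ := hw.exists_norm_packet_inner_le ξ₀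
  refine ⟨C * ∑' k : ℤ, (1 + (k : ℝ) ^ 2)⁻¹, by positivity, fun h => ?_⟩
  have hg := isSchwartz_packet hw ξ₀ h
  set G := wavePacket ξ₀ (Real.sqrt h) (packetScale h) (w h) with hG
  have hbd : ∀ k : ℤ, ‖(if k = 0 then 0 else ∫ x : ℝ, inner ℂ (G x) (G (x - k)) : ℂ)‖ ≤
      C * Real.sqrt h ^ 2 * (1 + (k : ℝ) ^ 2)⁻¹ := by
    intro k
    split_ifs with hk
    · rw [norm_zero]; positivity
    · exact hC h k hk
  have hsum : Summable fun k : ℤ => ∫ x : ℝ, inner ℂ (G x) (G (x - k)) := by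
    have h1 : Summable fun k : ℤ => (if k = 0 then 0 else ∫ x : ℝ, inner ℂ (G x) (G (x - k)) : ℂ) :=
      (summable_inv_one_add_int_sq.mul_left _).of_norm_bounded hbd
    refine (summable_congr_cofinite ?_).1 h1
    filter_upwards [(Set.finite_singleton (0 : ℤ)).compl_mem_cofinite] with k hk
    exact if_neg hk
  have h0 : ∫ x : ℝ, inner ℂ (G x) (G (x - (0 : ℤ))) = ((∫ y : ℝ, ‖w h y‖ ^ 2 : ℝ) : ℂ) := by
    have e : ∀ x : ℝ, inner ℂ (G x) (G (x - (0 : ℤ))) =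
        ((‖packetScale h‖ ^ 2 * ‖w h (x * (Real.sqrt h)⁻¹)‖ ^ 2 : ℝ) : ℂ) := by
      intro x
      rw [Int.cast_zero, sub_zero, inner_self_eq_norm_sq_to_K, hG, norm_wavePacket, ← mul_pow]
      push_cast; rfl
    have e2 : ∫ x : ℝ, ‖packetScale h‖ ^ 2 * ‖w h (x * (Real.sqrt h)⁻¹)‖ ^ 2 =
        ∫ y : ℝ, ‖w h y‖ ^ 2 := by
      rw [integral_const_mul, Measure.integral_comp_mul_right (fun y => ‖w h y‖ ^ 2),
        inv_inv, abs_of_pos h.sqrt_pos, smul_eq_mul, ← mul_assoc, norm_packetScale_sq, one_mul]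
    simp only [e]
    rw [← e2]
    exact integral_ofReal
  have key := hg.circleNorm_sq_perSum
  -- The diagonal term is the squared norm of the profile; the others are the almost orthogonal
  -- correlations.
  rw [hsum.tsum_eq_add_tsum_ite 0, h0] at key
  rw [periodize_eq, ← Real.norm_eq_abs, ← Complex.norm_real]
  push_cast at key ⊢
  rw [key, add_sub_cancel_left]
  refine (tsum_of_norm_bounded (summable_inv_one_add_int_sq.hasSum.mul_left _) hbd).trans
    (le_of_eq (by ring))

/-- Errors are measured with this bound once their power of `h` has been factored out of the
profile. -/
theorem UnifSchwartz.exists_circleNorm_le {w : ℝ → ℝ → C2}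
    (hw : UnifSchwartz (fun h : HIdx => w h)) (ξ₀ : ℝ) :
    ∃ C : ℝ, ∀ h : HIdx, circleNorm (periodize ξ₀ w h) ≤ C := by
  obtain ⟨C, hC0, hC⟩ := hw.exists_circleNorm_sq_sub_le ξ₀
  obtain ⟨D, hD0, hD⟩ := hw.exists_integral_norm_sq_le
  refine ⟨Real.sqrt (D + C), fun h => Real.le_sqrt_of_sq_le ?_⟩
  have h1 := (abs_le.1 (hC h)).2
  have h2 : C * Real.sqrt h ^ 2 ≤ C * 1 := by
    gcongr; exact pow_le_one₀ h.sqrt_pos.le h.sqrt_le_one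
  linarith [hD h]

/-- The norm of a periodized wave packet with a given leading profile. -/
theorem exists_circleNorm_sq_sub_leading_le {z r : ℝ → ℝ → C2} {z₀ : ℝ → C2} (hz₀ : IsSchwartz z₀)
    (hr : UnifSchwartz (fun h : HIdx => r h))
    (hz : ∀ (h : HIdx) y, z h y = z₀ y + ((Real.sqrt h : ℝ) : ℂ) • r h y) (ξ₀ : ℝ) :
    ∃ C : ℝ, 0 ≤ C ∧ ∀ h : HIdx,
      |circleNorm (periodize ξ₀ z h) ^ 2 - ∫ y : ℝ, ‖z₀ y‖ ^ 2| ≤ C * Real.sqrt h := by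
  have hz₀' : UnifSchwartz (fun _ : HIdx => z₀) := hz₀.comp_index fun _ => ()
  have hzS : UnifSchwartz (fun h : HIdx => z h) := by
    have := hz₀'.add (hr.smul (c := fun h : HIdx => ((Real.sqrt h : ℝ) : ℂ)) (D := 1)
      (fun h => by simpa using h.norm_sqrt_pow_le_one 1))
    convert this using 1
    funext h y
    exact hz h y
  obtain ⟨C, hC0, hC⟩ := hzS.exists_circleNorm_sq_sub_le ξ₀
  obtain ⟨D, hD0, hD⟩ := hz₀'.exists_norm_mul_le hr
  obtain ⟨E, hE0, hE⟩ := hzS.exists_norm_mul_le hr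
  refine ⟨C + (D + E) * Real.pi, by positivity, fun h => ?_⟩
  have hεp := h.sqrt_pos
  have hpt : ∀ y, ‖‖z h y‖ ^ 2 - ‖z₀ y‖ ^ 2‖ ≤ Real.sqrt h * (D + E) * (1 + y ^ 2)⁻¹ := by
    intro y
    have h1 : |‖z h y‖ - ‖z₀ y‖| ≤ Real.sqrt h * ‖r h y‖ := by
      refine (abs_norm_sub_norm_le _ _).trans (le_of_eq ?_)
      rw [hz h y, add_sub_cancel_left, norm_smul, Complex.norm_real, Real.norm_of_nonneg hεp.le]
    calc ‖‖z h y‖ ^ 2 - ‖z₀ y‖ ^ 2‖ = |‖z h y‖ - ‖z₀ y‖| * (‖z h y‖ + ‖z₀ y‖) := by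
          rw [sq_sub_sq, Real.norm_eq_abs, abs_mul, abs_of_nonneg (by positivity), mul_comm]
      _ ≤ Real.sqrt h * ‖r h y‖ * (‖z h y‖ + ‖z₀ y‖) := by gcongr
      _ = Real.sqrt h * (‖z₀ y‖ * ‖r h y‖ + ‖z h y‖ * ‖r h y‖) := by ring
      _ ≤ Real.sqrt h * (D * (1 + y ^ 2)⁻¹ + E * (1 + y ^ 2)⁻¹) :=
          mul_le_mul_of_nonneg_left (add_le_add (hD h y) (hE h y)) hεp.le
      _ = _ := by ring
  have h2 : |(∫ y : ℝ, ‖z h y‖ ^ 2) - ∫ y : ℝ, ‖z₀ y‖ ^ 2| ≤ Real.sqrt h * (D + E) * Real.pi := by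
    rw [← integral_univ_inv_one_add_sq, ← integral_const_mul]
    have h3 : (∫ y : ℝ, ‖z h y‖ ^ 2) - ∫ y : ℝ, ‖z₀ y‖ ^ 2 =
        ∫ y : ℝ, (‖z h y‖ ^ 2 - ‖z₀ y‖ ^ 2) :=
      (integral_sub (hzS.integrable_norm_sq h) (UnifSchwartz.integrable_norm_sq hz₀ ())).symm
    exact (congrArg _ h3).trans_le (norm_integral_le_of_norm_le
      (integrable_inv_one_add_sq.const_mul _) (Eventually.of_forall hpt))
  have h4 : C * Real.sqrt h ^ 2 ≤ C * Real.sqrt h := by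
    gcongr
    rw [pow_two]; exact mul_le_of_le_one_left hεp.le h.sqrt_le_one
  have h5 := abs_add_le (circleNorm (periodize ξ₀ z h) ^ 2 - ∫ y : ℝ, ‖z h y‖ ^ 2)
    ((∫ y : ℝ, ‖z h y‖ ^ 2) - ∫ y : ℝ, ‖z₀ y‖ ^ 2)
  rw [sub_add_sub_cancel] at h5
  have h6 := hC h
  nlinarith

theorem circleNorm_smul (c : ℂ) (f : ℝ → C2) :
    circleNorm (fun x => c • f x) = ‖c‖ * circleNorm f := by
  unfold circleNorm
  simp only [norm_smul, mul_pow]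
  rw [intervalIntegral.integral_const_mul, Real.sqrt_mul (by positivity),
    Real.sqrt_sq (norm_nonneg c)]

theorem periodize_smul (ξ₀ : ℝ) (c : ℂ) (w : ℝ → ℝ → C2) (h x : ℝ) :
    periodize ξ₀ (fun h y => c • w h y) h x = c • periodize ξ₀ w h x := by
  unfold periodize
  rw [← tsum_const_smul'']
  refine tsum_congr fun k => ?_
  simp only [periodTerm]
  rw [smul_comm]

theorem summable_periodTerm {w : ℝ → ℝ → C2} (h : HIdx) (hw : IsSchwartz (w h)) (ξ₀ x : ℝ) :
    Summable (periodTerm ξ₀ w h x) := by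
  have := (IsSchwartz.wavePacket hw ξ₀ h.sqrt_pos (packetScale h)).summable x
  simp only [← periodTerm_eq] at this
  exact this

theorem periodize_sub {w w' : ℝ → ℝ → C2} (h : HIdx) (hw : IsSchwartz (w h))
    (hw' : IsSchwartz (w' h)) (ξ₀ x : ℝ) :
    periodize ξ₀ (fun h y => w h y - w' h y) h x = periodize ξ₀ w h x - periodize ξ₀ w' h x := by
  unfold periodize
  rw [← (summable_periodTerm h hw ξ₀ x).tsum_sub (summable_periodTerm h hw' ξ₀ x)]
  refine tsum_congr fun k => ?_
  simp only [periodTerm, smul_sub]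

theorem periodize_congr {w w' : ℝ → ℝ → C2} {h : ℝ} (hw : w h = w' h) (ξ₀ : ℝ) :
    periodize ξ₀ w h = periodize ξ₀ w' h := by
  funext x
  simp only [periodize, periodTerm, hw]

/-- The action of a Weyl operator on a periodized wave packet. -/
theorem isWeylOnCircle_periodize {K : ℕ} {A : ℝ → ℝ → Mat2} (hA : UnifSymMat K (fun _ : Unit => A))
    (hper : ∀ x ξ, A (x + 1) ξ = A x ξ) {w w' : ℝ → ℝ → C2} (h : HIdx) (hw : IsSchwartz (w h))
    (hw' : w' h = weylVec (fun y η => A (Real.sqrt h * y) (Real.sqrt h * η + ξ₀)) (w h)) :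
    IsWeylOnCircle h A (periodize ξ₀ w h) (periodize ξ₀ w' h) := by
  have hA' : UnifSymMat K (fun (_ : Unit) x ξ => A x ((h : ℝ) * ξ)) := by
    intro r s
    have := (hA r s).comp_affine (α := fun _ => 1) (β := fun _ => (h : ℝ)) (α' := fun _ => 0)
      (β' := fun _ => 0) (A := 0) (by simp) (fun _ => by rw [abs_of_pos h.2.1]; exact h.2.2.le)
      (by simp) (by simp)
    simpa using this
  have := isWeylOnCircle_perSum h.2.1 hA' hper
    (IsSchwartz.wavePacket hw ξ₀ h.sqrt_pos (packetScale h))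
  have e := weylVec_wavePacket A ξ₀ h.sqrt_pos (packetScale h) (w h)
  rw [Real.sq_sqrt h.2.1.le] at e
  rw [periodize_eq, periodize_eq, hw', ← e]
  exact this

end

end

noncomputable section

open MeasureTheory

/-! ### Wavefront sets -/

section

variable {ξ₀ : ℝ} {a : ℝ → ℝ → ℂ}

theorem mixedDeriv_eq_zero_of_isOpen {U V : Set ℝ} (hU : IsOpen U) (hV : IsOpen V)
    (h : ∀ x ∈ U, ∀ ξ ∈ V, a x ξ = 0) (j k : ℕ) :
    ∀ x ∈ U, ∀ ξ ∈ V, mixedDeriv j k a x ξ = 0 := by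
  induction k generalizing a with
  | zero =>
    induction j with
    | zero => rwa [mixedDeriv_zero_zero]
    | succ j ih =>
      intro x hx ξ hξ
      rw [mixedDeriv_succ_left, symDxi]
      have : (fun ζ => mixedDeriv j 0 a x ζ) =ᶠ[𝓝 ξ] fun _ => 0 := by
        filter_upwards [hV.mem_nhds hξ] with ζ hζ using ih x hx ζ hζ
      rw [this.deriv_eq, deriv_const]
  | succ k ih =>
    rw [mixedDeriv_succ_right]
    refine ih fun x hx ξ hξ => ?_
    have : (fun z => a z ξ) =ᶠ[𝓝 x] fun _ => 0 := by
      filter_upwards [hU.mem_nhds hx] with z hz using h z hz ξ hξ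
    rw [symDx, this.deriv_eq, deriv_const]

/-- Periodicity in `x` and compact support in `ξ` reduce each derivative to its values on a compact
rectangle, hence weight exponent 0. -/
theorem IsCircleTestSymbol.unifSym (ha : IsCircleTestSymbol a) (ι : Type*) :
    UnifSym 0 (fun _ : ι => a) := by
  obtain ⟨hs, hper, R, hR⟩ := ha
  refine ⟨fun _ => hs, fun j k => ?_⟩
  have hper' : ∀ ξ, Function.Periodic (fun x => mixedDeriv j k a x ξ) 1 := by
    intro ξ x
    have := mixedDeriv_comp_affine hs 1 1 1 0 j k x ξ
    simp only [one_mul, add_zero, one_pow, mul_one, Complex.ofReal_one, hper] at this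
    exact this.symm
  have hzero : ∀ x ξ, R < |ξ| → mixedDeriv j k a x ξ = 0 := fun x ξ hξ =>
    mixedDeriv_eq_zero_of_isOpen (U := Set.univ) (V := {ξ | R < |ξ|}) isOpen_univ
      (isOpen_lt continuous_const continuous_abs) (fun x _ ξ hξ => hR x ξ hξ) j k x trivial ξ hξ
  obtain ⟨C, hC⟩ := (isCompact_Icc.prod isCompact_Icc).exists_bound_of_continuousOn
    (s := Set.Icc (0 : ℝ) 1 ×ˢ Set.Icc (-R) R) (hs.mixedDeriv j k).continuous.continuousOn
  refine ⟨|C|, fun _ x ξ => ?_⟩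
  have h1 : symWeight 0 x ξ = 1 := by simp [symWeight]
  rw [h1, mul_one]
  rcases lt_or_ge R |ξ| with hξ | hξ
  · rw [hzero x ξ hξ, norm_zero]; exact abs_nonneg C
  · have h2 := (hper' ξ).sub_int_mul_eq ⌊x⌋ (x := x)
    rw [mul_one] at h2
    rw [← h2]
    exact (hC (x - ⌊x⌋, ξ) ⟨⟨Int.fract_nonneg x, (Int.fract_lt_one x).le⟩, abs_le.1 hξ⟩).trans
      (le_abs_self C)

theorem isCircleTestSymbol_bump {χ : ℝ → ℝ} (hχ : ContDiff ℝ ((⊤ : ℕ∞) : WithTop ℕ∞) χ)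
    (hper : Function.Periodic χ 1) {ξ₁ : ℝ} (f : ContDiffBump ξ₁) :
    IsCircleTestSymbol (fun x ξ => ((χ x * f ξ : ℝ) : ℂ)) := by
  refine ⟨?_, fun x ξ => by simp only [hper x], |ξ₁| + f.rOut, fun x ξ hξ => ?_⟩
  · have h1 : ContDiff ℝ ((⊤ : ℕ∞) : WithTop ℕ∞) (fun p : ℝ × ℝ => χ p.1 * f p.2) :=
      (hχ.comp contDiff_fst).mul (f.contDiff.comp contDiff_snd)
    exact Complex.ofRealCLM.contDiff.comp h1
  · have : f.rOut ≤ dist ξ ξ₁ := by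
      rw [Real.dist_eq]
      linarith [abs_sub_abs_le_abs_sub ξ ξ₁]
    simp only [f.zero_of_le_dist this, mul_zero, Complex.ofReal_zero]

/-- Test symbols that detect a point and vanish near another one. -/
theorem exists_testSymbol {x₁ ξ₁ ξ₀ : ℝ} (h : ((x₁ : UnitAddCircle), ξ₁) ≠ (0, ξ₀)) :
    ∃ a, IsCircleTestSymbol a ∧ a x₁ ξ₁ ≠ 0 ∧ ∀ j k, mixedDeriv j k a 0 ξ₀ = 0 := by
  by_cases hξ : ξ₁ = ξ₀
  -- `sin(πx)` vanishes exactly at the integers and its square is 1-periodic, so it separates `x₁`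
  -- from the base point of the circle.
  · have hx : Real.sin (Real.pi * x₁) ≠ 0 := by
      intro h0
      obtain ⟨n, hn⟩ := Real.sin_eq_zero_iff.1 h0
      have hn' : (n : ℝ) = x₁ := by
        have := Real.pi_pos.ne'
        rw [mul_comm] at hn
        exact mul_left_cancel₀ this hn
      refine h (Prod.ext ?_ hξ)
      exact (AddCircle.coe_eq_zero_iff 1).2 ⟨n, by simpa using hn'⟩
    -- Half the value at `x₁`: the cutoff vanishes near the integers and is positive at `x₁`.
    set δ := Real.sin (Real.pi * x₁) ^ 2 / 2 with hδ
    have hδ0 : 0 < δ := by positivity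
    set χ : ℝ → ℝ := fun x => expNegInvGlue (Real.sin (Real.pi * x) ^ 2 - δ) with hχ
    have hχs : ContDiff ℝ ((⊤ : ℕ∞) : WithTop ℕ∞) χ :=
      expNegInvGlue.contDiff.comp (((Real.contDiff_sin.comp (contDiff_const.mul contDiff_id)).pow
        2).sub contDiff_const)
    have hχp : Function.Periodic χ 1 := by
      intro x
      simp only [hχ]
      rw [mul_add, mul_one, Real.sin_add_pi, neg_sq]
    let f : ContDiffBump ξ₁ := ⟨1, 2, one_pos, one_lt_two⟩
    refine ⟨_, isCircleTestSymbol_bump hχs hχp f, ?_, fun j k => ?_⟩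
    · have h1 : f ξ₁ = 1 := f.one_of_mem_closedBall (by simp [f])
      have h2 : χ x₁ ≠ 0 := (expNegInvGlue.pos_of_pos (by rw [hδ]; linarith)).ne'
      rw [h1, mul_one]
      exact_mod_cast h2
    · refine mixedDeriv_eq_zero_of_isOpen (U := {x | Real.sin (Real.pi * x) ^ 2 < δ})
        (V := Set.univ) (isOpen_lt (by fun_prop) continuous_const) isOpen_univ
        (fun x hx ξ _ => ?_) j k 0 (by simpa using hδ0) ξ₀ trivial
      have hx : Real.sin (Real.pi * x) ^ 2 < δ := hx
      have : χ x = 0 := expNegInvGlue.zero_of_nonpos (by linarith)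
      rw [this]; simp
  · have hd : 0 < |ξ₁ - ξ₀| := abs_pos.2 (sub_ne_zero.2 hξ)
    let f : ContDiffBump ξ₁ := ⟨|ξ₁ - ξ₀| / 4, |ξ₁ - ξ₀| / 2, by positivity, by linarith⟩
    refine ⟨_, isCircleTestSymbol_bump (χ := fun _ => 1) contDiff_const (fun _ => rfl) f, ?_,
      fun j k => ?_⟩
    · have h1 : f ξ₁ = 1 := f.one_of_mem_closedBall (Metric.mem_closedBall_self f.rIn_pos.le)
      simp [h1]
    · refine mixedDeriv_eq_zero_of_isOpen (U := Set.univ) (V := {ξ | |ξ₁ - ξ₀| / 2 < dist ξ ξ₁})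
        isOpen_univ (isOpen_lt continuous_const (by fun_prop)) (fun x _ ξ hξ => ?_) j k 0 trivial ξ₀
        (by
          show |ξ₁ - ξ₀| / 2 < dist ξ₀ ξ₁
          rw [dist_comm, Real.dist_eq]; linarith)
      have hξ : |ξ₁ - ξ₀| / 2 < dist ξ ξ₁ := hξ
      rw [f.zero_of_le_dist hξ.le]; simp

theorem UnifSym.scalarMat {ι : Type*} {K : ℕ} {F : ι → ℝ → ℝ → ℂ} (hF : UnifSym K F) :
    UnifSymMat K (fun i x ξ => F i x ξ • (1 : Mat2)) := by
  intro r s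
  simp only [Matrix.smul_apply, Matrix.one_apply, smul_eq_mul, mul_ite, mul_one, mul_zero]
  by_cases h : r = s
  · simpa only [h, if_true] using hF
  · simpa only [h, if_false] using UnifSym.zero

theorem weylVec_one {ι : Type*} {φ : ι → ℝ → C2} (hφ : UnifSchwartz φ) (i : ι) (x : ℝ) :
    weylVec (fun _ _ => 1) (φ i) x = φ i x := by
  ext r
  rw [weylVec_apply, Finset.sum_eq_single r]
  · simp only [Matrix.one_apply_eq]
    exact weylScalar_one (hφ.coord r) i x
  · intro s _ hs
    simp only [Matrix.one_apply_ne (Ne.symm hs)]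
    exact weylScalar_zero_symbol _ x
  · simp

/-- The profile of the action of a scalar operator on a periodized wave packet. -/
def scalarProfile (ξ₀ : ℝ) (a : ℝ → ℝ → ℂ) (w : ℝ → ℝ → C2) (h : ℝ) : ℝ → C2 :=
  weylVec (fun y η => rescale ξ₀ a h y η • (1 : Mat2)) (w h)

theorem isWeylOnCircle_scalarProfile (ha : IsCircleTestSymbol a) {w : ℝ → ℝ → C2}
    (hw : UnifSchwartz (fun h : HIdx => w h)) (h : HIdx) :
    IsWeylOnCircle h (fun x ξ => a x ξ • (1 : Mat2)) (periodize ξ₀ w h)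
      (periodize ξ₀ (scalarProfile ξ₀ a w) h) :=
  isWeylOnCircle_periodize (A := fun x ξ => a x ξ • (1 : Mat2)) (ha.unifSym Unit).scalarMat
    (fun x ξ => by rw [ha.2.1]) h (hw.isSchwartz h) rfl

/-- Operators whose symbol vanishes to infinite order at the centre of a wave packet are
negligible on it. -/
theorem isMicrolocallyNegligible_periodize (ha : IsCircleTestSymbol a)
    (h0 : ∀ j k, mixedDeriv j k a 0 ξ₀ = 0) {w : ℝ → ℝ → C2}
    (hw : UnifSchwartz (fun h : HIdx => w h)) : IsMicrolocallyNegligible a (periodize ξ₀ w) := by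
  refine ⟨fun h => periodize ξ₀ (scalarProfile ξ₀ a w) h,
    fun h hh => isWeylOnCircle_scalarProfile ha hw ⟨h, hh⟩, fun N => ?_⟩
  have ht : ∀ i y η, taylorHom a ξ₀ i y η = 0 := fun i y η =>
    Finset.sum_eq_zero fun q _ => by rw [h0]; simp
  -- All Taylor parts vanish, so the rescaled symbol is its own remainder; order `2N` in `√h` is
  -- order `N` in `h`.
  have h1 := unifSym_taylor_remainder (ha.unifSym Unit) ξ₀ (2 * N)
  simp only [ht, mul_zero, Finset.sum_const_zero, sub_zero] at h1
  set r : ℝ → ℝ → C2 := fun h => weylVec (fun y η =>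
    ((((Real.sqrt h : ℝ) : ℂ) ^ (2 * N))⁻¹ * rescale ξ₀ a h y η) • (1 : Mat2)) (w h) with hr
  have h2 : UnifSchwartz (fun h : HIdx => r h) := UnifSchwartz.weylVec h1.scalarMat hw
  obtain ⟨C, hC⟩ := h2.exists_circleNorm_le ξ₀
  refine IsBigO.of_bound C ?_
  filter_upwards [Ioo_mem_nhdsGT (zero_lt_one' ℝ)] with h hh
  have hs : scalarProfile ξ₀ a w h = fun y => ((Real.sqrt h : ℝ) : ℂ) ^ (2 * N) • r h y := by
    funext y
    rw [hr, ← weylVec_smul_symbol, scalarProfile]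
    simp only [smul_smul]
    simp only [mul_inv_cancel_left₀ (pow_ne_zero (2 * N) (HIdx.sqrt_ne_zero ⟨h, hh⟩))]
  have hp : periodize ξ₀ (scalarProfile ξ₀ a w) h =
      fun x => ((Real.sqrt h : ℝ) : ℂ) ^ (2 * N) • periodize ξ₀ r h x := by
    rw [periodize_congr (w' := fun h' y => ((Real.sqrt h : ℝ) : ℂ) ^ (2 * N) • r h' y) hs]
    funext x
    rw [periodize_smul]
  have hn : ‖((Real.sqrt h : ℝ) : ℂ) ^ (2 * N)‖ = h ^ N := by
    rw [norm_pow, Complex.norm_real, Real.norm_of_nonneg (Real.sqrt_nonneg h), pow_mul,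
      Real.sq_sqrt hh.1.le]
  have hN : 0 < h ^ N := pow_pos hh.1 N
  rw [hp, circleNorm_smul, hn, Real.norm_of_nonneg hN.le, Real.norm_of_nonneg
    (mul_nonneg hN.le (show 0 ≤ circleNorm (periodize ξ₀ r h) from Real.sqrt_nonneg _)), mul_comm]
  exact mul_le_mul_of_nonneg_right (hC ⟨h, hh⟩) hN.le

theorem tendsto_sqrt_nhdsGT_zero : Tendsto Real.sqrt (𝓝[>] 0) (𝓝 0) := by
  have := (Real.continuous_sqrt.tendsto 0).mono_left (nhdsWithin_le_nhds (s := Set.Ioi (0 : ℝ)))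
  rwa [Real.sqrt_zero] at this

/-- The wavefront set of a periodized wave packet with a non-trivial leading profile. -/
theorem circleWF_periodize {w r : ℝ → ℝ → C2} {z₀ : ℝ → C2} (hz₀ : IsSchwartz z₀)
    (hw : UnifSchwartz (fun h : HIdx => w h)) (hr : UnifSchwartz (fun h : HIdx => r h))
    (hz : ∀ (h : HIdx) y, w h y = z₀ y + ((Real.sqrt h : ℝ) : ℂ) • r h y)
    (hn : ∫ y : ℝ, ‖z₀ y‖ ^ 2 ≠ 0) :
    circleWF (periodize ξ₀ w) = {((0 : UnitAddCircle), ξ₀)} := by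
  ext p
  rw [Set.mem_singleton_iff]
  constructor
  · intro hp
    by_contra hne
    obtain ⟨x₁, hx₁⟩ := QuotientAddGroup.mk_surjective p.1
    obtain ⟨a, ha, ha1, ha0⟩ := exists_testSymbol (x₁ := x₁) (ξ₁ := p.2) (ξ₀ := ξ₀) (by
      intro h
      apply hne
      rw [← h]
      exact Prod.ext hx₁.symm rfl)
    exact hp ⟨a, x₁, ha, hx₁, ha1, isMicrolocallyNegligible_periodize ha ha0 hw⟩
  · rintro rfl ⟨a, x, ha, hx, hax, f, hf, hfN⟩
    obtain ⟨n, hn'⟩ := (AddCircle.coe_eq_zero_iff 1).1 hx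
    have ha0 : a 0 ξ₀ ≠ 0 := by
      have hper : Function.Periodic (fun x => a x ξ₀) 1 := fun x => ha.2.1 x ξ₀
      have := hper.int_mul n 0
      rw [zero_add, mul_one] at this
      rw [← hn', zsmul_one] at hax
      rwa [← this]
    set z : ℝ → ℝ → C2 := scalarProfile ξ₀ a w
    -- The functions `f h` are given only weakly; uniqueness identifies them with explicit
    -- periodizations.
    have hfz : ∀ h : HIdx, f h = periodize ξ₀ z h := fun h =>
      (hf h h.2).unique (isWeylOnCircle_scalarProfile ha hw h)
    -- To leading order the operator multiplies the profile by `a 0 ξ₀`, with an error `O(√h)`.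
    have h1 := unifSym_taylor_remainder (ha.unifSym Unit) ξ₀ 1
    simp only [pow_one, Finset.range_one, Finset.sum_singleton, pow_zero, one_mul,
      taylorHom_zero] at h1
    set q : ℝ → ℝ → C2 := fun h => weylVec (fun y η =>
      (((Real.sqrt h : ℝ) : ℂ)⁻¹ * (rescale ξ₀ a h y η - a 0 ξ₀)) • (1 : Mat2)) (w h) with hq
    have hqS : UnifSchwartz (fun h : HIdx => q h) := UnifSchwartz.weylVec h1.scalarMat hw
    have hzq : ∀ (h : HIdx) y, z h y = a 0 ξ₀ • z₀ y +
        ((Real.sqrt h : ℝ) : ℂ) • (a 0 ξ₀ • r h y + q h y) := by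
      intro h y
      have hc : UnifSymMat (0 + 1) (fun (_ : HIdx) (_ _ : ℝ) => (a 0 ξ₀) • (1 : Mat2)) :=
        UnifSymMat.smul (c := fun _ => a 0 ξ₀) (by
          have := UnifSym.scalarMat (UnifSym.one (ι := HIdx) (K := 0 + 1))
          simpa only [one_smul] using this) (fun _ => le_rfl)
      have hm := h1.scalarMat.smul (c := fun h : HIdx => ((Real.sqrt h : ℝ) : ℂ)) (D := 1)
        (fun h => by simpa using h.norm_sqrt_pow_le_one 1)
      have h3 := weylVec_add_symbol hc hm hw h y
      have e : z h y = weylVec (fun y η => a 0 ξ₀ • (1 : Mat2) + ((Real.sqrt h : ℝ) : ℂ) •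
          (((Real.sqrt h : ℝ) : ℂ)⁻¹ * (rescale ξ₀ a h y η - a 0 ξ₀)) • (1 : Mat2)) (w h) y := by
        show weylVec (fun y η => rescale ξ₀ a h y η • (1 : Mat2)) (w h) y = _
        simp only [smul_smul, mul_inv_cancel_left₀ h.sqrt_ne_zero, ← add_smul, add_sub_cancel]
      rw [e, h3, weylVec_smul_symbol, weylVec_smul_symbol, weylVec_one hw, hz h y]
      module
    obtain ⟨C, _, hC⟩ := exists_circleNorm_sq_sub_leading_le (z := z) (z₀ := fun y => a 0 ξ₀ • z₀ y)
      (r := fun h y => a 0 ξ₀ • r h y + q h y)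
      (UnifSchwartz.smul hz₀ (c := fun _ => a 0 ξ₀) fun _ => le_rfl)
      ((hr.smul (c := fun _ => a 0 ξ₀) fun _ => le_rfl).add hqS) hzq ξ₀
    set I : ℝ := ∫ y : ℝ, ‖a 0 ξ₀ • z₀ y‖ ^ 2 with hI
    have hI0 : I ≠ 0 := by
      rw [hI]
      simp only [norm_smul, mul_pow]
      rw [integral_const_mul]
      exact mul_ne_zero (by positivity) hn
    -- The nonzero limit of the squared norms contradicts negligibility, for which already the bound
    -- `O(h)` suffices.
    have t1 : Tendsto (fun h => circleNorm (f h) ^ 2) (𝓝[>] 0) (𝓝 I) := by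
      rw [tendsto_iff_norm_sub_tendsto_zero]
      refine squeeze_zero' (Eventually.of_forall fun h => norm_nonneg _) ?_
        (by simpa using tendsto_sqrt_nhdsGT_zero.const_mul C)
      filter_upwards [Ioo_mem_nhdsGT (zero_lt_one' ℝ)] with h hh
      rw [hfz ⟨h, hh⟩]
      exact hC ⟨h, hh⟩
    have t2 : Tendsto (fun h => circleNorm (f h) ^ 2) (𝓝[>] 0) (𝓝 0) := by
      have h3 : Tendsto (fun h : ℝ => h ^ 1) (𝓝[>] 0) (𝓝 0) := by
        simp only [pow_one]
        exact tendsto_id.mono_left nhdsWithin_le_nhds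
      simpa using ((hfN 1).trans_tendsto h3).pow 2
    exact hI0 (tendsto_nhds_unique t1 t2)

end

/-! ### Quasimodes on the circle -/

section CircleQuasimode

variable {P : ℝ → ℝ → ℝ → Mat2} {Pk : ℕ → ℝ → ℝ → Mat2} {ξ₀ ω : ℝ} {μ : Fin 2 → ℝ}

theorem IsLineQuasimode.integral_norm_sq (hω : 0 < ω) {ℓ : ℕ} {j : Fin 2} {n : ℕ}
    {v : ℕ → Fin 2 → ℂ[X]} {lam : ℕ → ℝ} (hq : IsLineQuasimode P ξ₀ ω μ ℓ j n v lam) :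
    ∫ y : ℝ, ‖polyGaussVec ω (v 0) y‖ ^ 2 = 1 := by
  have h1 := hq.normalized
  rw [gaussInner_polyVec hω, ampForm_eq_integral] at h1
  have e : ∀ y, inner ℂ (polyGaussVec ω (v 0) y) (polyGaussVec ω (v 0) y) =
      ((‖polyGaussVec ω (v 0) y‖ ^ 2 : ℝ) : ℂ) := fun y => by
    rw [inner_self_eq_norm_sq_to_K]; push_cast; rfl
  simp only [e] at h1
  have h2 : ((∫ y : ℝ, ‖polyGaussVec ω (v 0) y‖ ^ 2 : ℝ) : ℂ) = 1 := Eq.trans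
    (integral_ofReal (𝕜 := ℂ)).symm h1
  exact_mod_cast h2

/-- Periodizations of quasimodes on the line are quasimodes on the circle. -/
theorem IsLineQuasimode.isCircleQuasimode (hω : 0 < ω) (hP : HasSymbolExpansion P Pk) {ℓ : ℕ}
    {j : Fin 2} {n : ℕ} {v : ℕ → Fin 2 → ℂ[X]} {lam : ℕ → ℝ}
    (hq : IsLineQuasimode P ξ₀ ω μ ℓ j n v lam) :
    IsCircleQuasimode P ξ₀ ℓ (lineMode ω ℓ v) (approxEigenvalue ℓ lam) := by
  have hw := unifSchwartz_lineMode hω ℓ v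
  have hz₀ : IsSchwartz (polyGaussVec ω (v 0)) := unifSchwartz_polyGaussVec Unit hω (v 0)
  set r : ℝ → ℝ → C2 := fun h y => ∑ i ∈ Finset.range (2 * ℓ),
    ((Real.sqrt h : ℝ) : ℂ) ^ i • polyGaussVec ω (v (i + 1)) y with hr
  have hrS : UnifSchwartz (fun h : HIdx => r h) :=
    UnifSchwartz.sum (Finset.range (2 * ℓ)) (f := fun i (h : HIdx) y =>
      ((Real.sqrt h : ℝ) : ℂ) ^ i • polyGaussVec ω (v (i + 1)) y) fun i _ =>
      (unifSchwartz_polyGaussVec HIdx hω _).smul (fun h => h.norm_sqrt_pow_le_one i)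
  have hz : ∀ (h : HIdx) y, lineMode ω ℓ v h y =
      polyGaussVec ω (v 0) y + ((Real.sqrt h : ℝ) : ℂ) • r h y := by
    intro h y
    rw [lineMode_eq, Finset.sum_range_succ', hr, Finset.smul_sum, pow_zero, one_smul, add_comm]
    congr 1
    refine Finset.sum_congr rfl fun i _ => ?_
    rw [smul_smul, pow_succ']
  have hn := hq.integral_norm_sq hω
  refine ⟨fun h hh x => summable_periodTerm ⟨h, hh⟩ (hw.isSchwartz ⟨h, hh⟩) ξ₀ x,
    fun h hh => ?_, fun h hh => ?_, circleWF_periodize hz₀ hw hrS hz (by rw [hn]; exact one_ne_zero),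
    ?_, ?_⟩
  · rw [periodize_eq ξ₀ _ ⟨h, hh⟩]
    exact (isSchwartz_packet hw ξ₀ ⟨h, hh⟩).contDiff_perSum
  · rw [periodize_eq ξ₀ _ ⟨h, hh⟩]
    exact perSum_periodic _
  · obtain ⟨C, _, hC⟩ := exists_circleNorm_sq_sub_leading_le hz₀ hrS hz ξ₀
    refine ⟨C, fun h hh => ?_⟩
    have h1 := hC ⟨h, hh⟩
    rw [hn] at h1
    rw [← Real.sqrt_eq_rpow]
    refine le_trans ?_ h1
    have h0 : 0 ≤ circleNorm (periodize ξ₀ (lineMode ω ℓ v) h) := Real.sqrt_nonneg _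
    set N := circleNorm (periodize ξ₀ (lineMode ω ℓ v) h)
    -- Since `N ≥ 0`, the estimate for the square passes to the norm.
    calc |N - 1| ≤ |N - 1| * (N + 1) := le_mul_of_one_le_right (abs_nonneg _) (by linarith)
      _ = |N ^ 2 - 1| := by
        rw [show N ^ 2 - 1 = (N - 1) * (N + 1) by ring, abs_mul, abs_of_nonneg (a := N + 1)
          (by linarith)]
  · have hexp : (ℓ : ℝ) + 3 / 2 = ((2 * ℓ + 3 : ℕ) : ℝ) / 2 := by push_cast; ring
    set F : ℝ → ℝ → C2 := fun h => weyl 1 (normalForm P ξ₀ h) (lineMode ω ℓ v h) with hF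
    have hFv : ∀ h : HIdx, F h = weylVec (normalForm P ξ₀ h) (lineMode ω ℓ v h) := fun h =>
      weyl_one_eq_weylVec (hP.unifSymMat_normalForm ξ₀) hw h
    have hFS : UnifSchwartz (fun h : HIdx => F h) := by
      simp only [hFv]
      exact UnifSchwartz.weylVec (hP.unifSymMat_normalForm ξ₀) hw
    refine ⟨fun h => periodize ξ₀ F h, fun h hh => isWeylOnCircle_periodize (K := 2)
      (fun r s => (hP.unifSymMat r s).comp_index fun _ => ⟨h, hh⟩) (hP.periodic h hh) ⟨h, hh⟩
      (hw.isSchwartz ⟨h, hh⟩) (hFv ⟨h, hh⟩), ?_⟩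
    have he := hq.equation
    rw [hexp, isBigOSchwartz_iff] at he
    set R : ℝ → ℝ → C2 := fun h y => (((Real.sqrt h : ℝ) : ℂ) ^ (2 * ℓ + 3))⁻¹ •
      (F h y - ((approxEigenvalue ℓ lam h : ℝ) : ℂ) • lineMode ω ℓ v h y) with hR
    have hRS : UnifSchwartz (fun h : HIdx => R h) := he
    obtain ⟨C, hC⟩ := hRS.exists_circleNorm_le ξ₀
    refine ⟨C, fun h hh => ?_⟩
    have hε := HIdx.sqrt_ne_zero ⟨h, hh⟩
    set c : ℂ := ((approxEigenvalue ℓ lam h : ℝ) : ℂ) with hc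
    -- Periodization is linear: the residual on the circle is the periodization of the residual on
    -- the line, and the factor `(√h)^(2ℓ+3) = h^(ℓ+3/2)` comes out.
    have e1 : (fun x => periodize ξ₀ F h x - c • periodize ξ₀ (lineMode ω ℓ v) h x) =
        fun x => ((Real.sqrt h : ℝ) : ℂ) ^ (2 * ℓ + 3) • periodize ξ₀ R h x := by
      funext x
      have h1 := periodize_sub (w := F) (w' := fun h y => c • lineMode ω ℓ v h y) ⟨h, hh⟩
        (hFS.isSchwartz ⟨h, hh⟩) (UnifSchwartz.smul (hw.isSchwartz ⟨h, hh⟩) (c := fun _ => c)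
        fun _ => le_rfl) ξ₀ x
      rw [periodize_smul] at h1
      rw [← h1, ← periodize_smul]
      refine congrFun (periodize_congr ?_ ξ₀) x
      funext y
      simp only [hR]
      rw [smul_smul, mul_inv_cancel₀ (pow_ne_zero _ hε), one_smul]
    rw [e1, circleNorm_smul, norm_pow, Complex.norm_real, Real.norm_of_nonneg (Real.sqrt_nonneg h),
      hexp]
    have h2 := HIdx.rpow_half ⟨h, hh⟩ (2 * ℓ + 3)
    simp only at h2
    rw [h2, mul_comm]
    exact mul_le_mul_of_nonneg_right (hC ⟨h, hh⟩) (by positivity)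

end CircleQuasimode

end

theorem theorem3p3 (P : ℝ → ℝ → ℝ → Mat2) (Pk : ℕ → ℝ → ℝ → Mat2)
    (ξ₀ ω : ℝ) (μ : Fin 2 → ℝ) (hω : 0 < ω)
    (hP : HasSymbolExpansion P Pk)
    (hwell : HasPotentialWell (Pk 0) 1 (ω ^ 2) 0 ξ₀)
    (hP1 : Pk 1 0 ξ₀ = Matrix.diagonal (fun j => ((μ j : ℝ) : ℂ)))
    (ℓ : ℕ) :
    (∃ (v : Fin 2 → ℕ → ℕ → Fin 2 → ℂ[X]) (lam : Fin 2 → ℕ → ℕ → ℝ),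
      (∀ (j : Fin 2) (n : ℕ),
        IsLineQuasimode P ξ₀ ω μ ℓ j n (v j n) (lam j n) ∧
        IsCircleQuasimode P ξ₀ ℓ (lineMode ω ℓ (v j n)) (approxEigenvalue ℓ (lam j n))) ∧
      (∀ (j j' : Fin 2) (n n' : ℕ), (j, n) ≠ (j', n') →
        gaussInner ω (polyVec (v j n 0)) (polyVec (v j' n' 0)) = 0) ∧
      (∀ (j : Fin 2) (n : ℕ),
        (ℓ = 0 ∨ ∀ (k : Fin 2) (m : ℕ), k ≠ j → oscEnergy ω μ k m ≠ oscEnergy ω μ j n) →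
        polyVec (v j n 0) = oscAmp ω j n)) ∧
    (∀ (j : Fin 2) (n : ℕ) (v : ℕ → Fin 2 → ℂ[X]) (lam : ℕ → ℝ),
      IsLineQuasimode P ξ₀ ω μ ℓ j n v lam →
      IsCircleQuasimode P ξ₀ ℓ (lineMode ω ℓ v) (approxEigenvalue ℓ lam)) := by
  obtain ⟨v, lam, h1, h2, h3⟩ := exists_lineQuasimodes hω hP hwell hP1 ℓ
  exact ⟨⟨v, lam, fun j n => ⟨h1 j n, (h1 j n).isCircleQuasimode hω hP⟩, h2, h3⟩,
    fun _ _ _ _ hq => hq.isCircleQuasimode hω hP⟩
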